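/- **Setting.** Let $G$ be a finite connected multigraph (self-loops and parallel edges allowed) with $N$ edges (massless propagators) and external lines $p_1,\dots,p_K,q_1,\dots,q_L$, $K+L\ge 1$, attached to its vertices. The external momenta are incoming vectors in Minkowski space which sum to zero and depend on a scaling variable $t\to0^+$ such that $p_i^2=\Theta(t)$, $q_j^2=\Theta(1)$, $p_k\cdot p_l=\Theta(1)$ for $k\neq l$, and the square of every partial sum other than the empty sum, $\pm p_i$ and the total is $\Theta(1)$ (on-shell expansion of wide-angle scattering). Let $$\mathcal U=\sum_{T^1}\prod_{e\notin T^1}x_e,\qquad \mathcal F=-\sum_{T^2}s_{T^2}\prod_{e\notin T^2}x_e ,$$ where $T^1$ and $T^2$ run over the spanning trees and spanning 2-trees and $s_{T^2}$ is the squared total momentum flowing into one component of $T^2$. Let $\Delta^{(N+1)}[\mathcal U+\mathcal F]\subset\mathbb R^{N+1}$ be the convex hull of the points $(r_1,\dots,r_N;r_{N+1})$ such that the coefficient of $x_1^{r_1}\cdots x_N^{r_N}$ in $\mathcal U+\mathcal F$ is $\Theta(t^{r_{N+1}})$. A vector $v$ is *normal to a lower facet* if its last component is positive and the set of points of $\Delta^{(N+1)}$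 minimising $v\cdot r$ has dimension $N$. **Configurations.** Declare every edge hard, jet of type $i\in\{1,\dots,K\}$, or soft, and put $v_R=(u_R;1)$ with $u_{R,e}=0,-1,-2$ for $e$ hard, jet and soft. A vertex is soft if all its edges are soft and no external line ends at it. It is in $J_i$ if it lies on an edge of $J_i$, all its edges are in $J_i$ or soft, and no external line other than $p_i$ ends at it. It is hard otherwise. $H$ is the graph of the hard vertices and the hard edges between them. Assume: (a) $H$ is non-empty and connected, and all $q_j$ are attached to $H$. (b) Every non-empty $J_i$ is connected through its own vertices, has an edge ending on $H$, and $p_i$ and no other external line is attached to its vertices; if $J_i$ is empty, $p_i$ is attached to $H$. (c) No external line is attached to a soft vertex, and every connected component of the soft subgraph $S$ (soft edges being connected through soft vertices) is attached to $H\cup J$. The contracted graph $\widetilde J_i$ (respectively $\widetilde S$, and $\widetilde S_k$ for a connected component $S_k$ of $S$) consists of the edges of $J_i$ (respectively $S$, $S_k$), all their ends that are not vertices of $J_i$ (respectively soft vertices) being identified to one auxiliary vertex. In $\widetilde J_i$ the momentum $p_i$ enters where it is attached and leaves at the auxiliary vertex. **Reduced form.** A graph is 1VI if it remains connected after the removal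 of any one vertex (the edges ending there being kept without that end; so a self-loop is 1VI only on its own). The 1VI components of a graph are its maximal 1VI subgraphs, and they are nontrivial if they contain a loop. The reduced form $\Gamma_{\rm red}$ of $\Gamma$ is obtained by contracting each nontrivial 1VI component $\gamma$ to a vertex; moreover, for each vertex $v$ of $\gamma$ that belongs to another 1VI component, or at which at least two different external momenta enter, $v$ is kept and an auxiliary propagator joins $v$ to the contracted $\gamma$. For $\Gamma=H$ the external momenta are those of the external lines attached to $H$ and those of the jets, $p_i$ entering at every hard vertex on which an edge of $J_i$ ends. For $\Gamma=\widetilde J_i$ only the first of the two alternatives applies. $\Gamma_{\rm red}$ is a tree, and the momentum of each of its propagators is determined by momentum conservation, soft momenta being neglected, once it is specified which nonnegative fractions (of sum $1$) of each $p_i$ enter $H$ at the various vertices where $p_i$ enters. **Requirements.** * *H*: every internal propagator of $H_{\rm red}$ is off-shell, i.e. the square of its momentum is $\Theta(1)$ for some choice of these fractions. * *J*: for every $i$, every internal propagator of $\widetilde J_{i,\rm red}$ carries exactly the momentum $p_i$ (in one of its two directions). * *S*: every connected component of $S$ is attached to vertices of at least two different jets $J_i$, $J_j$. **Theorem.** For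 every such configuration: if $v_R$ is normal to a lower facet of $\Delta^{(N+1)}[\mathcal U+\mathcal F]$, then the requirements of $H$, $J$ and $S$ hold. Conversely, if the requirements of $H$, $J$ and $S$ hold and the contracted graph $\widetilde S_k$ of every connected component $S_k$ of $S$ is 1VI, then $v_R$ is normal to a lower facet of $\Delta^{(N+1)}[\mathcal U+\mathcal F]$. -/

import Mathlib

open Filter Topology Asymptotics Graph
open scoped BigOperators

noncomputable section

namespace OnShell

/-! ### Multigraphs: connectivity, spanning (2-)trees, 1VI components

Multigraphs are Mathlib's `Graph`; self-loops and parallel edges are allowed. -/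

section Multigraph

universe u w

/-- `x` and `y` are joined by a path of `Γ`. -/
def Reach {α : Type u} {β : Type w} (Γ : Graph α β) (x y : α) : Prop :=
  Relation.ReflTransGen Γ.Adj x y

/-- A connected graph (with at least one vertex). -/
def IsConn {α : Type u} {β : Type w} (Γ : Graph α β) : Prop :=
  V(Γ).Nonempty ∧ ∀ x ∈ V(Γ), ∀ y ∈ V(Γ), Reach Γ x y

/-- A set `T` of edges without cycles: deleting any `e ∈ T` separates the ends of `e`. -/
def IsForest {α : Type u} {β : Type w} (Γ : Graph α β) (T : Set β) : Prop :=
  T ⊆ E(Γ) ∧ ∀ e ∈ T, ∀ x y, Γ.IsLink e x y → ¬ Reach (Γ.restrict (T \ {e})) x y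

/-- `T` is (the edge set of) a spanning tree `T¹` of `Γ`. -/
def IsSpanningTree {α : Type u} {β : Type w} (Γ : Graph α β) (T : Set β) : Prop :=
  IsForest Γ T ∧ IsConn (Γ.restrict T)

/-- `T` is (the edge set of) a spanning 2-tree `T²` of `Γ`: a spanning forest with exactly two
connected components. -/
def IsSpanningTwoTree {α : Type u} {β : Type w} (Γ : Graph α β) (T : Set β) : Prop :=
  IsForest Γ T ∧ ∃ x ∈ V(Γ), ∃ y ∈ V(Γ), ¬ Reach (Γ.restrict T) x y ∧
    ∀ z ∈ V(Γ), Reach (Γ.restrict T) x z ∨ Reach (Γ.restrict T) y z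

/-- The edges `e` and `f` are joined by a chain of edges of `X`, two consecutive ones having a
common end in `W`. -/
def EdgeLinked {α : Type u} {β : Type w} (Γ : Graph α β) (X : Set β) (W : Set α) (e f : β) : Prop :=
  Relation.ReflTransGen (fun a b => a ∈ X ∧ b ∈ X ∧ ∃ v ∈ W, Γ.Inc a v ∧ Γ.Inc b v) e f

/-- The subgraph with edge set `B` is one-vertex irreducible: it remains connected after the removal
of any one vertex `v`. Edges ending at `v` lose that end but are kept, so that a self-loop is 1VI
only on its own. -/
def IsOneVI {α : Type u} {β : Type w} (Γ : Graph α β) (B : Set β) : Prop :=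
  B.Nonempty ∧ B ⊆ E(Γ) ∧ ∀ v, ∀ e ∈ B, ∀ f ∈ B, EdgeLinked Γ B {x | x ≠ v} e f

/-- The 1VI components (blocks): the maximal 1VI subgraphs. -/
def IsOneVIComponent {α : Type u} {β : Type w} (Γ : Graph α β) (B : Set β) : Prop :=
  Maximal (IsOneVI Γ) B

/-- The ends of the edges of `B`. -/
def endsOf {α : Type u} {β : Type w} (Γ : Graph α β) (B : Set β) : Set α :=
  {v | ∃ e ∈ B, Γ.Inc e v}

/-- A nontrivial 1VI component: one with at least one loop, `N - V + 1 ≥ 1`. -/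
def IsNontrivial {α : Type u} {β : Type w} (Γ : Graph α β) (B : Set β) : Prop :=
  IsOneVIComponent Γ B ∧ (endsOf Γ B).ncard ≤ B.ncard

/-! ### The reduced form of a graph

Every nontrivial 1VI component `γ` is contracted to a vertex. At each vertex `v` of `γ` which `γ`
shares with something else, an auxiliary propagator `(γ, v)` separates `γ` from the rest. -/

/-- A vertex `v` which lies in two different 1VI components, or at which two different external
momenta enter (`v ∈ M`). -/
def IsShared {α : Type u} {β : Type w} (Γ : Graph α β) (M : Set α) (v : α) : Prop :=
  (∃ B B', IsOneVIComponent Γ B ∧ IsOneVIComponent Γ B' ∧ B ≠ B' ∧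
    v ∈ endsOf Γ B ∧ v ∈ endsOf Γ B') ∨ v ∈ M

open Classical in
/-- The vertex of the reduced form to which the vertex `v` belongs. A vertex of a nontrivial 1VI
component `γ` that is not shared becomes part of the contracted `γ` (and `γ` is then the only
1VI component containing it, hence equal to the union); all others remain. -/
def place {α : Type u} {β : Type w} (Γ : Graph α β) (M : Set α) (v : α) : α ⊕ Set β :=
  if (∃ B, IsNontrivial Γ B ∧ v ∈ endsOf Γ B) ∧ ¬ IsShared Γ M v then
    Sum.inr (⋃₀ {B | IsNontrivial Γ B ∧ v ∈ endsOf Γ B})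
  else Sum.inl v

/-- Incidence in the reduced form. Its propagators are the edges `e` of `Γ` outside all nontrivial
1VI components, and the auxiliary propagators `(γ, v)` joining the contracted `γ` to `v`. -/
def reducedLink {α : Type u} {β : Type w} (Γ : Graph α β) (M : Set α) :
    β ⊕ (Set β × α) → α ⊕ Set β → α ⊕ Set β → Prop
  | Sum.inl e, x, y => (∀ B, IsNontrivial Γ B → e ∉ B) ∧
      ∃ a b, Γ.IsLink e a b ∧ x = place Γ M a ∧ y = place Γ M b
  | Sum.inr (γ, v), x, y => (IsNontrivial Γ γ ∧ v ∈ endsOf Γ γ ∧ IsShared Γ M v) ∧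
      ((x = Sum.inr γ ∧ y = Sum.inl v) ∨ (x = Sum.inl v ∧ y = Sum.inr γ))

theorem reducedLink_symm {α : Type u} {β : Type w} (Γ : Graph α β) (M : Set α)
    (f : β ⊕ (Set β × α)) (x y : α ⊕ Set β) (h : reducedLink Γ M f x y) :
    reducedLink Γ M f y x := by
  rcases f with e | ⟨γ, v⟩
  · obtain ⟨h1, a, b, hab, hx, hy⟩ := h
    exact ⟨h1, b, a, hab.symm, hy, hx⟩
  · obtain ⟨h1, h2 | h2⟩ := h
    · exact ⟨h1, Or.inr ⟨h2.2, h2.1⟩⟩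
    · exact ⟨h1, Or.inl ⟨h2.2, h2.1⟩⟩

theorem reducedLink_eq_or_eq {α : Type u} {β : Type w} (Γ : Graph α β) (M : Set α)
    (f : β ⊕ (Set β × α)) (x y v w : α ⊕ Set β) (h : reducedLink Γ M f x y)
    (h' : reducedLink Γ M f v w) : x = v ∨ x = w := by
  rcases f with e | ⟨γ, z⟩
  · obtain ⟨-, a, b, hab, rfl, rfl⟩ := h
    obtain ⟨-, c, d, hcd, rfl, rfl⟩ := h'
    rcases hab.left_eq_or_eq hcd with rfl | rfl <;> simp
  · obtain ⟨-, h2⟩ := h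
    obtain ⟨-, h3⟩ := h'
    rcases h2 with ⟨rfl, rfl⟩ | ⟨rfl, rfl⟩ <;> rcases h3 with ⟨rfl, rfl⟩ | ⟨rfl, rfl⟩ <;> simp

/-- The reduced form `Γ_red`, where `M` is the set of vertices at which two different external
momenta enter. -/
def reducedForm {α : Type u} {β : Type w} (Γ : Graph α β) (M : Set α) :
    Graph (α ⊕ Set β) (β ⊕ (Set β × α)) where
  vertexSet := {x | (∃ v ∈ V(Γ), x = place Γ M v) ∨ (∃ B, IsNontrivial Γ B ∧ x = Sum.inr B) ∨
    ∃ f y, reducedLink Γ M f x y}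
  IsLink := reducedLink Γ M
  isLink_symm := fun f _ => ⟨fun x y h => reducedLink_symm Γ M f x y h⟩
  eq_or_eq_of_isLink_of_isLink := fun f x y v w h h' => reducedLink_eq_or_eq Γ M f x y v w h h'
  left_mem_of_isLink := fun f _ y h => Or.inr (Or.inr ⟨f, y, h⟩)

open Classical in
/-- The momentum carried by the propagator `f` of the reduced form, out of the side of its end `x`,
when the external momentum `m v` enters `Γ` at `v`: by momentum conservation it is the total
external momentum entering on that side. -/
def carried {α : Type u} {β : Type w} [Fintype α] {P : Type} [AddCommMonoid P]
    (Γ : Graph α β) (M : Set α) (m : α → P) (f : β ⊕ (Set β × α)) (x : α ⊕ Set β) : P :=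
  ∑ v : α, if v ∈ V(Γ) ∧ Reach ((reducedForm Γ M).deleteEdges {f}) x (place Γ M v)
    then m v else 0

end Multigraph

/-! ### Kinematics -/

/-- Momenta in `(d + 1)`-dimensional Minkowski space. -/
abbrev Momentum (d : ℕ) : Type := Fin (d + 1) → ℝ

/-- The Minkowski product, with signature `(+, -, …, -)`. -/
def mdot {d : ℕ} (k l : Momentum d) : ℝ := k 0 * l 0 - ∑ i : Fin d, k i.succ * l i.succ

/-- The external lines: `Sum.inl i` carries the nearly on-shell momentum `p_i`, and `Sum.inr j` the
off-shell momentum `q_j`; all are incoming. -/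
abbrev Leg (K L : ℕ) : Type := Fin K ⊕ Fin L

/-- On-shell expansion of wide-angle scattering: the external momenta depend on the scaling
variable `t → 0⁺`, all `p_i²` scale as `t`, all the other invariants are of order one, in units of
the hard scale. -/
structure IsWideAngle {d K L : ℕ} (P : ℝ → Leg K L → Momentum d) : Prop where
  legs : 0 < K + L
  conservation : ∀ t, ∑ l, P t l = 0
  on_shell : ∀ i : Fin K,
    (fun t => mdot (P t (Sum.inl i)) (P t (Sum.inl i))) =Θ[𝓝[>] (0 : ℝ)] (fun t => t)
  off_shell : ∀ j : Fin L,
    (fun t => mdot (P t (Sum.inr j)) (P t (Sum.inr j))) =Θ[𝓝[>] (0 : ℝ)] (fun _ => (1 : ℝ))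
  wide_angle : ∀ k l : Fin K, k ≠ l →
    (fun t => mdot (P t (Sum.inl k)) (P t (Sum.inl l))) =Θ[𝓝[>] (0 : ℝ)] (fun _ => (1 : ℝ))
  /-- Non-exceptional momenta: apart from the empty sum, `± p_i` and the total momentum, every
  partial sum of the external momenta is off-shell. -/
  non_exceptional : ∀ A : Finset (Leg K L), A.Nonempty → Aᶜ.Nonempty →
    (∀ i : Fin K, A ≠ {Sum.inl i}) → (∀ i : Fin K, Aᶜ ≠ {Sum.inl i}) →
    (fun t => mdot (∑ l ∈ A, P t l) (∑ l ∈ A, P t l)) =Θ[𝓝[>] (0 : ℝ)] (fun _ => (1 : ℝ))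

/-! ### The Lee-Pomeransky polynomial and its Newton polytope -/

section Polynomial

variable {V E : Type} [Fintype V] [Fintype E] [Nonempty V] {d K L : ℕ}

open Classical in
/-- The invariant `s_{T²}`: the square of the total momentum flowing into a component of `T²` (by
momentum conservation, the same for both components). -/
def invariant (G : Graph V E) (att : Leg K L → V) (p : Leg K L → Momentum d) (T : Set E) : ℝ :=
  let k : Momentum d := ∑ l : Leg K L,
    if Reach (G.restrict T) (Classical.arbitrary V) (att l) then p l else 0
  mdot k k

open Classical in
/-- The first Symanzik polynomial `U(x) = ∑_{T¹} ∏_{e ∉ T¹} x_e`. -/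
def symanzikU (G : Graph V E) : MvPolynomial E ℝ :=
  ∑ T : Finset E, if IsSpanningTree G (T : Set E) then ∏ e ∈ Tᶜ, MvPolynomial.X e else 0

open Classical in
/-- The second Symanzik polynomial `F(x; s) = - ∑_{T²} s_{T²} ∏_{e ∉ T²} x_e` (massless
propagators). -/
def symanzikF (G : Graph V E) (att : Leg K L → V) (p : Leg K L → Momentum d) :
    MvPolynomial E ℝ :=
  - ∑ T : Finset E, if IsSpanningTwoTree G (T : Set E) then
      MvPolynomial.C (invariant G att p (T : Set E)) * ∏ e ∈ Tᶜ, MvPolynomial.X e else 0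

/-- The Lee-Pomeransky polynomial `U + F`. -/
def leePomeransky (G : Graph V E) (att : Leg K L → V) (p : Leg K L → Momentum d) :
    MvPolynomial E ℝ :=
  symanzikU G + symanzikF G att p

/-- The exponent vectors `(r_1, …, r_N; r_{N+1})` of a polynomial whose coefficients depend on the
scaling variable: `x_1^{r_1} ⋯ x_N^{r_N}` has a coefficient that scales as `t ^ r_{N+1}`. -/
def exponentVectors (f : ℝ → MvPolynomial E ℝ) : Set ((E → ℝ) × ℝ) :=
  {r | ∃ (m : E →₀ ℕ) (n : ℕ),
    (fun t => MvPolynomial.coeff m (f t)) =Θ[𝓝[>] (0 : ℝ)] (fun t => t ^ n) ∧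
    r = (fun e => (m e : ℝ), (n : ℝ))}

/-- The Newton polytope `Δ^{(N+1)}`, in `ℝ^N × ℝ`. -/
def newtonPolytope (f : ℝ → MvPolynomial E ℝ) : Set ((E → ℝ) × ℝ) :=
  convexHull ℝ (exponentVectors f)

/-- The scalar product of `ℝ^{N+1}`. -/
def pairing (v r : (E → ℝ) × ℝ) : ℝ := ∑ e, v.1 e * r.1 e + v.2 * r.2

/-- The face of `Δ` on which `v · r` is minimal. -/
def minFace (Δ : Set ((E → ℝ) × ℝ)) (v : (E → ℝ) × ℝ) : Set ((E → ℝ) × ℝ) :=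
  {r ∈ Δ | ∀ r' ∈ Δ, pairing v r ≤ pairing v r'}

/-- `v` is an inward-pointing normal vector of a lower facet of `Δ ⊆ ℝ^{N+1}`: its last component is
positive, and the face of `Δ` minimising `v · r` has dimension `N`. -/
def IsNormalToLowerFacet (Δ : Set ((E → ℝ) × ℝ)) (v : (E → ℝ) × ℝ) : Prop :=
  0 < v.2 ∧ (minFace Δ v).Nonempty ∧
    Module.finrank ℝ (vectorSpan ℝ (minFace Δ v)) = Fintype.card E

end Polynomial

/-! ### Hard, jet and soft subgraphs -/

/-- The type of an edge: hard, in the jet `J_i`, or soft. -/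
inductive Mode (K : ℕ) : Type
  | hard : Mode K
  | jet (i : Fin K) : Mode K
  | soft : Mode K

/-- The entry of the region vector for an edge of the given type. -/
def Mode.weight {K : ℕ} : Mode K → ℝ
  | Mode.hard => 0
  | Mode.jet _ => -1
  | Mode.soft => -2

/-- The vector `v_R = (u_R; 1)`. -/
def regionVector {E : Type} {K : ℕ} (mode : E → Mode K) : (E → ℝ) × ℝ :=
  (fun e => (mode e).weight, 1)

section Configuration

variable {V E : Type} {d K L : ℕ}

/-- The edges of type `c`. -/
def edgesOf (mode : E → Mode K) (c : Mode K) : Set E := {e | mode e = c}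

/-- The vertices of `S`: those on soft edges only, without external lines. -/
def softVerts (G : Graph V E) (att : Leg K L → V) (mode : E → Mode K) : Set V :=
  {v | v ∈ V(G) ∧ (∀ e, G.Inc e v → mode e = Mode.soft) ∧ ∀ l, att l ≠ v}

/-- The vertices of `J_i`: those on at least one edge of `J_i` and possibly on soft edges, but on no
others, and without external lines other than `p_i`. -/
def jetVerts (G : Graph V E) (att : Leg K L → V) (mode : E → Mode K) (i : Fin K) : Set V :=
  {v | v ∈ V(G) ∧ (∃ e, G.Inc e v ∧ mode e = Mode.jet i) ∧
    (∀ e, G.Inc e v → mode e = Mode.jet i ∨ mode e = Mode.soft) ∧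
    ∀ l, att l = v → l = Sum.inl i}

/-- The vertices of `H`: all the others. -/
def hardVerts (G : Graph V E) (att : Leg K L → V) (mode : E → Mode K) : Set V :=
  {v | v ∈ V(G) ∧ v ∉ softVerts G att mode ∧ ∀ i, v ∉ jetVerts G att mode i}

/-- The hard subgraph `H`. -/
def hardGraph (G : Graph V E) (att : Leg K L → V) (mode : E → Mode K) : Graph V E :=
  (G.restrict (edgesOf mode Mode.hard)).induce (hardVerts G att mode)

open Classical in
/-- The contracted graph with edge set `X`: the vertices of `W` are kept, and all the others are
identified to one auxiliary vertex `none`. -/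
def contracted (G : Graph V E) (X : Set E) (W : Set V) : Graph (Option V) E :=
  (G.restrict X).map (fun v => if v ∈ W then some v else none)

/-- The contracted jet graph `J̃_i`. -/
def contractedJet (G : Graph V E) (att : Leg K L → V) (mode : E → Mode K) (i : Fin K) :
    Graph (Option V) E :=
  contracted G (edgesOf mode (Mode.jet i)) (jetVerts G att mode i)

/-- The contracted soft graph `S̃`. -/
def contractedSoft (G : Graph V E) (att : Leg K L → V) (mode : E → Mode K) : Graph (Option V) E :=
  contracted G (edgesOf mode Mode.soft) (softVerts G att mode)

/-- `C` is the edge set of a connected component of `S`; soft edges are connected to each other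
through soft vertices only. -/
def IsSoftComponent (G : Graph V E) (att : Leg K L → V) (mode : E → Mode K) (C : Set E) : Prop :=
  ∃ e, mode e = Mode.soft ∧
    C = {f | EdgeLinked G (edgesOf mode Mode.soft) (softVerts G att mode) e f}

/-- The basic requirements on the subgraphs `H`, `J_1, …, J_K`, `S`. A jet `J_i` may be empty, in
which case `p_i` is attached to `H`. -/
structure IsConfiguration (G : Graph V E) (att : Leg K L → V) (mode : E → Mode K) : Prop where
  hard_connected : IsConn (hardGraph G att mode)
  hard_external : ∀ j : Fin L, att (Sum.inr j) ∈ hardVerts G att mode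
  jet_connected : ∀ i, ∀ e ∈ edgesOf mode (Mode.jet i), ∀ f ∈ edgesOf mode (Mode.jet i),
    EdgeLinked G (edgesOf mode (Mode.jet i)) (jetVerts G att mode i) e f
  jet_attached : ∀ i, (edgesOf mode (Mode.jet i)).Nonempty →
    ∃ e ∈ edgesOf mode (Mode.jet i), ∃ v ∈ hardVerts G att mode, G.Inc e v
  jet_external : ∀ i, (edgesOf mode (Mode.jet i)).Nonempty →
    ∀ l, att l ∈ jetVerts G att mode i ↔ l = Sum.inl i
  jet_empty : ∀ i, edgesOf mode (Mode.jet i) = ∅ → att (Sum.inl i) ∈ hardVerts G att mode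
  soft_external : ∀ l, att l ∉ softVerts G att mode
  soft_attached : ∀ C, IsSoftComponent G att mode C →
    ∃ e ∈ C, ∃ v, G.Inc e v ∧ v ∉ softVerts G att mode

/-! ### The three requirements -/

/-- The momentum of the external line `l` (for `p_i`: possibly carried by the jet `J_i`) enters the
hard subgraph at the vertex `v`. -/
def Enters (G : Graph V E) (att : Leg K L → V) (mode : E → Mode K) (l : Leg K L) (v : V) : Prop :=
  v ∈ hardVerts G att mode ∧
    (att l = v ∨ ∃ i, l = Sum.inl i ∧ ∃ e, mode e = Mode.jet i ∧ G.Inc e v)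

/-- The hard vertices at which at least two different momenta enter. -/
def multiEntry (G : Graph V E) (att : Leg K L → V) (mode : E → Mode K) : Set V :=
  {v | ∃ l l', l ≠ l' ∧ Enters G att mode l v ∧ Enters G att mode l' v}

/-- A distribution of each `p_i` over the lines through which it enters `H`, as collinear
fractions `ξ i v`. -/
def IsSplitting [Fintype V] (G : Graph V E) (att : Leg K L → V) (mode : E → Mode K)
    (ξ : Fin K → V → ℝ) : Prop :=
  ∀ i, (∀ v, 0 ≤ ξ i v) ∧ ∑ v, ξ i v = 1 ∧ ∀ v, ¬ Enters G att mode (Sum.inl i) v → ξ i v = 0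

open Classical in
/-- The momentum that enters `H` at the vertex `v`. -/
def hardInflow (att : Leg K L → V) (p : Leg K L → Momentum d) (ξ : Fin K → V → ℝ) (v : V) :
    Momentum d :=
  (∑ j : Fin L, if att (Sum.inr j) = v then p (Sum.inr j) else 0) +
    ∑ i : Fin K, ξ i v • p (Sum.inl i)

/-- Requirement of `H`: all the internal propagators of `H_red` are off-shell. A propagator is
off-shell if its virtuality is of order one for some distribution of the jet momenta over the
jet lines attached to `H`; otherwise its momentum is always `0` or a multiple of a single `p_i`. -/
def RequirementH [Fintype V] (G : Graph V E) (att : Leg K L → V) (mode : E → Mode K)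
    (P : ℝ → Leg K L → Momentum d) : Prop :=
  ∀ f ∈ E(reducedForm (hardGraph G att mode) (multiEntry G att mode)),
    ∃ ξ, IsSplitting G att mode ξ ∧
      ∃ x, (reducedForm (hardGraph G att mode) (multiEntry G att mode)).Inc f x ∧
        (fun t =>
          mdot (carried (hardGraph G att mode) (multiEntry G att mode)
              (hardInflow att (P t) ξ) f x)
            (carried (hardGraph G att mode) (multiEntry G att mode)
              (hardInflow att (P t) ξ) f x))
          =Θ[𝓝[>] (0 : ℝ)] (fun _ => (1 : ℝ))

open Classical in
/-- The external momenta of `J̃_i`: `p_i` enters at its vertex and leaves at the auxiliary vertex. -/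
def jetInflow (att : Leg K L → V) (p : Leg K L → Momentum d) (i : Fin K) : Option V → Momentum d
  | none => - p (Sum.inl i)
  | some v => if att (Sum.inl i) = v then p (Sum.inl i) else 0

/-- Requirement of `J`: all the internal propagators of each `J̃_{i,red}` carry exactly the momentum
`p_i` (directed from one end of the propagator to the other). -/
def RequirementJ [Fintype V] (G : Graph V E) (att : Leg K L → V) (mode : E → Mode K)
    (P : ℝ → Leg K L → Momentum d) : Prop :=
  ∀ i : Fin K, ∀ f ∈ E(reducedForm (contractedJet G att mode i) ∅),
    ∃ x, (reducedForm (contractedJet G att mode i) ∅).Inc f x ∧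
      ∀ t, carried (contractedJet G att mode i) ∅ (jetInflow att (P t) i) f x = P t (Sum.inl i)

/-- Requirement of `S`: every connected component of `S` connects at least two different jets. -/
def RequirementS (G : Graph V E) (att : Leg K L → V) (mode : E → Mode K) : Prop :=
  ∀ C, IsSoftComponent G att mode C → ∃ i j : Fin K, i ≠ j ∧
    (∃ e ∈ C, ∃ v ∈ jetVerts G att mode i, G.Inc e v) ∧
    (∃ e ∈ C, ∃ v ∈ jetVerts G att mode j, G.Inc e v)

/-- The contracted graph `S̃_k` of every connected component `S_k` of `S` is 1VI. -/
def SoftComponentsOneVI (G : Graph V E) (att : Leg K L → V) (mode : E → Mode K) : Prop :=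
  ∀ C, IsSoftComponent G att mode C → IsOneVI (contractedSoft G att mode) C

end Configuration

end OnShell

end

/-! Over the field with two elements, an edge with ends x, y becomes the vector δ_x + δ_y. Edges of
X join x to y exactly when δ_x + δ_y lies in the span of X (`reach_restrict_iff`). Spanning trees
are then the bases of the cycle matroid, spanning 2-trees are bases with one element removed, and
the 1VI components are the connected components of the matroid: minimal separators, across which no
relation between edges extends (`exists_isOneVIComponent`, `IsOneVIComponent.isSep`). Connectivity
arguments become linear algebra.

Every monomial of U + F belongs to a single tree or 2-tree, so (u; 1) is normal to a lower facet if
and only if minimal terms exist and no nonzero linear form a is constant on them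
(`isNormalToLowerFacet_newtonPolytope_iff`). Up to a constant, a term T of order t^n has weight 2|T|
- |T ∩ H| - |T ∩ (H ∪ J)| + n. The minimal trees, called optimal, are those containing bases of H
and of H ∪ J. Since an invariant is of order one only if neither side of the 2-tree carries just the
empty set or a single p_i (an exceptional set), a minimal 2-tree has one of three shapes: n = 1,
full rank in H and one edge missing in H ∪ J; n = 0, one edge missing in both; n = 0, full rank in H
and two edges missing in H ∪ J (`Setup.minTerms_cases`).

Necessity. Let B be a 1VI component of H or of a contracted jet, or a component of S. It is a
separator relative to the subgraphs below it, so all trees adapted to these subgraphs have equally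
many edges in B (`Indep.ncard_inter_separator`). The facet condition supplies a minimal term with a
different number, since otherwise the indicator of B would be a constant form. For H this term is a
2-tree splitting B and nothing else of H, which shows that enough momentum enters on both sides of
the propagator. For J and S its existence contradicts the failure of the requirement.

Sufficiency. Exchanging edges of one type in optimal trees shows that a constant form takes a single
value on each 1VI component (`Setup.eq_of_isOneVI`). One further minimal 2-tree per component shows
that the value is zero: cut p_i off its jet (`Setup.jet_eq_zero`); cut H into two connected parts
with off-shell momentum flowing between them (`Setup.hard_eq_zero`); join two jets by a soft path
and cut both off H together (`Setup.soft_eq_zero`). -/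

noncomputable section

set_option linter.unusedSectionVars false

namespace OnShell

/-! ### Linear algebra of edge vectors over the field with two elements -/

section LinearAlgebra

variable {β M : Type*} [AddCommGroup M] [Module (ZMod 2) M]

/-- The span of the vectors indexed by `X`. -/
abbrev spn (v : β → M) (X : Set β) : Submodule (ZMod 2) M := Submodule.span (ZMod 2) (v '' X)

/-- Linear independence of the vectors indexed by `T`. -/
abbrev Indep (v : β → M) (T : Set β) : Prop := LinearIndepOn (ZMod 2) v T

theorem spn_mono (v : β → M) {X Y : Set β} (h : X ⊆ Y) : spn v X ≤ spn v Y :=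
  Submodule.span_mono (Set.image_mono h)

theorem mem_spn (v : β → M) {X : Set β} {e : β} (h : e ∈ X) : v e ∈ spn v X :=
  Submodule.subset_span (Set.mem_image_of_mem v h)

theorem spn_le (v : β → M) {X : Set β} {N : Submodule (ZMod 2) M} (h : ∀ e ∈ X, v e ∈ N) :
    spn v X ≤ N := by
  rw [spn, Submodule.span_le]
  rintro _ ⟨e, he, rfl⟩
  exact h e he

theorem spn_union (v : β → M) (X Y : Set β) : spn v (X ∪ Y) = spn v X ⊔ spn v Y := by
  rw [spn, Set.image_union, Submodule.span_union]

theorem zmod_two_cases (c : ZMod 2) : c = 0 ∨ c = 1 := by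
  revert c
  decide

theorem Indep.mono {v : β → M} {T T' : Set β} (hT : Indep v T) (h : T' ⊆ T) : Indep v T' :=
  LinearIndepOn.mono hT h

/-- Coefficients are indexed by edges rather than by vectors, so parallel edges (equal vectors) and
self-loops (zero vectors) remain distinct. -/
theorem mem_spn_iff [Fintype β] (v : β → M) (X : Set β) (z : M) :
    z ∈ spn v X ↔ ∃ c : β → ZMod 2, (∀ e, e ∉ X → c e = 0) ∧ ∑ e, c e • v e = z := by
  classical
  constructor
  · intro h
    induction h using Submodule.span_induction with
    | mem x hx =>
      obtain ⟨e, he, rfl⟩ := hx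
      refine ⟨Pi.single e 1, fun f hf => ?_, ?_⟩
      · rw [Pi.single_eq_of_ne]
        rintro rfl
        exact hf he
      · simp [Pi.single_apply, ite_smul]
    | zero => exact ⟨0, by simp, by simp⟩
    | add x y _ _ hx hy =>
      obtain ⟨c, hc, rfl⟩ := hx
      obtain ⟨d, hd, rfl⟩ := hy
      refine ⟨c + d, fun e he => by simp [hc e he, hd e he], ?_⟩
      simp [add_smul, Finset.sum_add_distrib]
    | smul a x _ hx =>
      obtain ⟨c, hc, rfl⟩ := hx
      refine ⟨a • c, fun e he => by simp [hc e he], ?_⟩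
      simp [Finset.smul_sum, mul_smul]
  · rintro ⟨c, hc, rfl⟩
    refine Submodule.sum_mem _ fun e _ => ?_
    by_cases he : e ∈ X
    · exact Submodule.smul_mem _ _ (mem_spn v he)
    · simp [hc e he]

theorem Indep.eq_zero [Fintype β] {v : β → M} {T : Set β} (hT : Indep v T) {c : β → ZMod 2}
    (hc : ∀ e, e ∉ T → c e = 0) (h : ∑ e, c e • v e = 0) : c = 0 := by
  classical
  funext e
  by_cases he : e ∈ T
  · refine linearIndepOn_iff'.1 hT (Finset.univ.filter (· ∈ T)) c (by intro x; simp) ?_ e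
      (by simp [he])
    rw [Finset.sum_filter]
    refine Eq.trans (Finset.sum_congr rfl fun f _ => ?_) h
    split_ifs with hf
    · rfl
    · simp [hc f hf]
  · exact hc e he

theorem indep_of_eq_zero [Fintype β] {v : β → M} {T : Set β}
    (h : ∀ c : β → ZMod 2, (∀ e, e ∉ T → c e = 0) → ∑ e, c e • v e = 0 → c = 0) :
    Indep v T := by
  classical
  refine linearIndepOn_iff'.2 fun t g ht hg e he => ?_
  have := h (fun f => if f ∈ t then g f else 0)
    (fun f hf => if_neg fun hft => hf (ht hft)) (by simpa [ite_smul, Finset.sum_ite_mem] using hg)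
  simpa [he] using congrFun this e

theorem Indep.coeff_eq [Fintype β] {v : β → M} {T : Set β} (hT : Indep v T) {c d : β → ZMod 2}
    (hc : ∀ e, e ∉ T → c e = 0) (hd : ∀ e, e ∉ T → d e = 0)
    (h : ∑ e, c e • v e = ∑ e, d e • v e) : c = d := by
  refine sub_eq_zero.1 (hT.eq_zero (c := c - d) (fun e he => by simp [hc e he, hd e he]) ?_)
  simp [sub_smul, h]

/-- In an independent family, spans of subfamilies intersect in the span of the intersection. -/
theorem Indep.mem_spn_inter [Fintype β] {v : β → M} {T X Y : Set β} (hT : Indep v T)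
    (hX : X ⊆ T) (hY : Y ⊆ T) {z : M} (h1 : z ∈ spn v X) (h2 : z ∈ spn v Y) :
    z ∈ spn v (X ∩ Y) := by
  obtain ⟨c, hc, rfl⟩ := (mem_spn_iff v X z).1 h1
  obtain ⟨d, hd, hcd⟩ := (mem_spn_iff v Y _).1 h2
  have : c = d := hT.coeff_eq (fun e he => hc e fun h => he (hX h))
    (fun e he => hd e fun h => he (hY h)) hcd.symm
  subst this
  refine (mem_spn_iff v _ _).2 ⟨c, fun e he => ?_, rfl⟩
  by_cases h : e ∈ X
  · exact hd e fun h' => he ⟨h, h'⟩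
  · exact hc e h

/-- An element `f` with a nonzero coefficient can be exchanged. -/
theorem Indep.not_mem_spn_diff [Fintype β] {v : β → M} {T : Set β} (hT : Indep v T)
    {c : β → ZMod 2} (hc : ∀ e, e ∉ T → c e = 0) {f : β} (hf : c f ≠ 0) :
    ∑ e, c e • v e ∉ spn v (T \ {f}) := by
  intro h
  obtain ⟨d, hd, hcd⟩ := (mem_spn_iff v _ _).1 h
  have : c = d := hT.coeff_eq hc (fun e he => hd e fun h => he h.1) hcd.symm
  subst this
  exact hf (hd f (by simp))

theorem indep_insert {v : β → M} {T : Set β} {e : β} (hT : Indep v T)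
    (he : v e ∉ spn v T) : Indep v (insert e T) := LinearIndepOn.insert hT he

/-- Steinitz exchange: the expression of `e` must use `f`, so it can be solved for `f`. -/
theorem spn_le_exchange {v : β → M} {D : Set β} {e f : β} (h1 : v e ∈ spn v D)
    (h2 : v e ∉ spn v (D \ {f})) : spn v D ≤ spn v (insert e (D \ {f})) := by
  have hf : f ∈ D := by
    by_contra hf
    rw [Set.sdiff_singleton_eq_self hf] at h2
    exact h2 h1
  have h3 : v f ∈ spn v (insert e (D \ {f})) := by
    rw [spn, Set.image_insert_eq]
    refine mem_span_insert_exchange ?_ h2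
    rw [← Set.image_insert_eq, Set.insert_sdiff_singleton, Set.insert_eq_of_mem hf]
    exact h1
  refine spn_le v fun g hg => ?_
  by_cases hgf : g = f
  · exact hgf ▸ h3
  · exact mem_spn v (Set.mem_insert_of_mem _ ⟨hg, hgf⟩)

theorem exists_indep_extension (v : β → M) {S X : Set β} (hS : Indep v S) (hSX : S ⊆ X) :
    ∃ T ⊆ X, S ⊆ T ∧ spn v X ≤ spn v T ∧ Indep v T := by
  obtain ⟨b, h1, h2, h3, h4⟩ := exists_linearIndepOn_extension hS hSX
  exact ⟨b, h1, h2, Submodule.span_le.2 h3, h4⟩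

/-! ### Ranks, and counting the edges of a basis in a separator. -/

variable [Fintype β]

/-- The rank of a set of vectors. -/
def rk (v : β → M) (X : Set β) : ℕ := Module.finrank (ZMod 2) (spn v X)

instance finite_spn (v : β → M) (X : Set β) : Module.Finite (ZMod 2) (spn v X) :=
  FiniteDimensional.span_of_finite _ (Set.toFinite _)

theorem rk_mono (v : β → M) {X Y : Set β} (h : spn v X ≤ spn v Y) : rk v X ≤ rk v Y :=
  Submodule.finrank_mono h

theorem Indep.rk_eq {v : β → M} {T : Set β} (hT : Indep v T) : rk v T = T.ncard := by
  classical
  have := finrank_span_eq_card (R := ZMod 2) (b := fun x : T => v x) hT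
  rw [← Set.image_eq_range] at this
  rw [rk, spn, this, Set.ncard_eq_toFinset_card', Set.toFinset_card]

theorem Indep.ncard_le {v : β → M} {T X : Set β} (hT : Indep v T) (h : spn v T ≤ spn v X) :
    T.ncard ≤ rk v X := hT.rk_eq ▸ rk_mono v h

theorem Indep.ncard_inter_le {v : β → M} {T : Set β} (hT : Indep v T) (X : Set β) :
    (T ∩ X).ncard ≤ rk v X :=
  (hT.mono Set.inter_subset_left).ncard_le (spn_mono v Set.inter_subset_right)

theorem Indep.ncard_eq {v : β → M} {T X : Set β} (hT : Indep v T) (h : spn v T ≤ spn v X)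
    (h' : spn v X ≤ spn v T) : T.ncard = rk v X :=
  hT.rk_eq ▸ le_antisymm (rk_mono v h) (rk_mono v h')

theorem Indep.spn_le_of_ncard {v : β → M} {T X : Set β} (hT : Indep v T)
    (h : spn v T ≤ spn v X) (h' : rk v X ≤ T.ncard) : spn v X ≤ spn v T := by
  refine (Submodule.eq_of_le_of_finrank_le h ?_).ge
  rw [← hT.rk_eq] at h'
  exact h'

theorem rk_le_ncard (v : β → M) (X : Set β) : rk v X ≤ X.ncard := by
  classical
  rw [rk, spn, Set.ncard_eq_toFinset_card', Set.image_eq_range]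
  refine (finrank_range_le_card (R := ZMod 2) (fun x : X => v x)).trans_eq ?_
  rw [Set.toFinset_card]

theorem indep_of_ncard_le {v : β → M} {X : Set β} (h : X.ncard ≤ rk v X) : Indep v X := by
  obtain ⟨T, hTX, -, h1, h2⟩ := exists_indep_extension v (S := ∅) (X := X)
    (linearIndepOn_empty (ZMod 2) v) (Set.empty_subset _)
  have h3 := h2.ncard_eq (spn_mono v hTX) h1
  have : T = X := Set.eq_of_subset_of_ncard_le hTX (by omega)
  exact this ▸ h2

/-- The reverse of submodularity, by the dimension formula for a sum of subspaces. It is what makes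
the counting across a separator sharp. -/
theorem rk_add_rk_le (v : β → M) {X Y Z : Set β} (h : spn v X ⊓ spn v Y ≤ spn v Z) :
    rk v X + rk v Y ≤ rk v (X ∪ Y) + rk v Z := by
  have h1 := Submodule.finrank_sup_add_finrank_inf_eq (spn v X) (spn v Y)
  have h2 := Submodule.finrank_mono h
  rw [← spn_union] at h1
  unfold rk
  omega

/-- If `B` is a separator of `X` relative to `Y`, all the bases of `X` adapted to `Y` have the same
number of elements in `B`. -/
theorem Indep.ncard_inter_separator {v : β → M} {T X Y B : Set β} (hT : Indep v T)
    (hYX : Y ⊆ X) (hBX : B ⊆ X) (hBY : Disjoint B Y)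
    (hX : spn v X ≤ spn v (T ∩ X)) (hY : spn v Y ≤ spn v (T ∩ Y))
    (hsep : spn v (Y ∪ B) ⊓ spn v (X \ B) ≤ spn v Y) :
    (T ∩ B).ncard + rk v Y = rk v (Y ∪ B) ∧ spn v (X \ B) ≤ spn v (T ∩ (X \ B)) := by
  have h1 := rk_add_rk_le v hsep
  have hYB : Y ∪ B ∪ X \ B = X := by
    ext e
    have := @hYX e
    have := @hBX e
    simp only [Set.mem_union, Set.mem_sdiff]
    tauto
  rw [hYB] at h1
  have hTX := (hT.mono Set.inter_subset_left).ncard_eq (spn_mono v Set.inter_subset_right) hX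
  have hTY := (hT.mono Set.inter_subset_left).ncard_eq (spn_mono v Set.inter_subset_right) hY
  have h2 := hT.ncard_inter_le (Y ∪ B)
  have h3 := hT.ncard_inter_le (X \ B)
  have h4 : (T ∩ (Y ∪ B)).ncard = (T ∩ Y).ncard + (T ∩ B).ncard := by
    rw [Set.inter_union_distrib_left]
    exact Set.ncard_union_eq (hBY.symm.mono Set.inter_subset_right Set.inter_subset_right)
  have h5 : (T ∩ X).ncard = (T ∩ B).ncard + (T ∩ (X \ B)).ncard := by
    rw [← Set.ncard_union_eq (Set.disjoint_sdiff_right.mono Set.inter_subset_right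
      Set.inter_subset_right), ← Set.inter_union_distrib_left, Set.union_sdiff_cancel hBX]
  -- The numbers of edges of `T` in `Y ∪ B` and in `X \ B` add up to `rk X + rk Y`, and are bounded
  -- by ranks whose sum is at most that by `h1`. Both bounds are therefore attained.
  refine ⟨by omega, ?_⟩
  exact (hT.mono Set.inter_subset_left).spn_le_of_ncard (spn_mono v Set.inter_subset_right)
    (by omega)

end LinearAlgebra

/-! ### Edge vectors of a multigraph -/

section EdgeVectors

variable {α β : Type*}

/-- The vector `δ_x + δ_y`. -/
def dl (x y : α) : α →₀ ZMod 2 := Finsupp.single x 1 + Finsupp.single y 1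

theorem add_self_eq_zero_zmod_two {M : Type*} [AddCommGroup M] [Module (ZMod 2) M] (z : M) :
    z + z = 0 := by
  rw [← two_smul (ZMod 2) z, show (2 : ZMod 2) = 0 from rfl, zero_smul]

theorem add_eq_iff_zmod_two {M : Type*} [AddCommGroup M] [Module (ZMod 2) M] {x y z : M} :
    x + y = z ↔ x = z + y := by
  constructor
  · rintro rfl
    rw [add_assoc, add_self_eq_zero_zmod_two, add_zero]
  · rintro rfl
    rw [add_assoc, add_self_eq_zero_zmod_two, add_zero]

theorem dl_self (x : α) : dl x x = 0 := add_self_eq_zero_zmod_two _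

theorem dl_comm (x y : α) : dl x y = dl y x := add_comm _ _

theorem dl_add_dl (x y z : α) : dl x y + dl y z = dl x z := by
  have := add_self_eq_zero_zmod_two (Finsupp.single y (1 : ZMod 2))
  have h : dl x y + dl y z = dl x z + (Finsupp.single y 1 + Finsupp.single y 1) := by
    unfold dl
    abel
  rw [h, this, add_zero]

theorem dl_mem_symm {N : Submodule (ZMod 2) (α →₀ ZMod 2)} {x y : α} (h : dl x y ∈ N) :
    dl y x ∈ N := dl_comm x y ▸ h

theorem dl_mem_trans {N : Submodule (ZMod 2) (α →₀ ZMod 2)} {x y z : α} (h : dl x y ∈ N)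
    (h' : dl y z ∈ N) : dl x z ∈ N := dl_add_dl x y z ▸ N.add_mem h h'

theorem dl_self_mem (N : Submodule (ZMod 2) (α →₀ ZMod 2)) (x : α) : dl x x ∈ N := by
  rw [dl_self]
  exact N.zero_mem

open Classical in
/-- The sum of the coordinates in `Z`. -/
def sumOn (Z : Set α) : (α →₀ ZMod 2) →ₗ[ZMod 2] ZMod 2 :=
  Finsupp.linearCombination (ZMod 2) (fun x => if x ∈ Z then 1 else 0)

open Classical in
theorem sumOn_single (Z : Set α) (x : α) :
    sumOn Z (Finsupp.single x 1) = if x ∈ Z then 1 else 0 := by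
  simp [sumOn]

theorem sumOn_dl (Z : Set α) (x y : α) : sumOn Z (dl x y) = 0 ↔ (x ∈ Z ↔ y ∈ Z) := by
  classical
  rw [dl, map_add, sumOn_single, sumOn_single]
  by_cases hx : x ∈ Z <;> by_cases hy : y ∈ Z <;> simp [hx, hy, show (1 + 1 : ZMod 2) = 0 from rfl]

/-- A vector supported on `Z` with vanishing total is a combination of the `δ_x + δ_y`,
`x, y ∈ Z`. -/
theorem mem_of_forall_dl_mem {N : Submodule (ZMod 2) (α →₀ ZMod 2)} {Z : Set α}
    (hN : ∀ x ∈ Z, ∀ y ∈ Z, dl x y ∈ N) {z : α →₀ ZMod 2} (hz : ∀ x, x ∉ Z → z x = 0)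
    (h0 : sumOn Set.univ z = 0) : z ∈ N := by
  classical
  by_cases hZ : Z.Nonempty
  · obtain ⟨x0, hx0⟩ := hZ
    -- Every vertex of the support is joined to `x0`. The contributions at `x0` add up to the total
    -- of `z`, which vanishes.
    have h1 : z = ∑ x ∈ z.support, z x • dl x x0 := by
      have h2 : ∑ x ∈ z.support, z x • dl x x0 =
          ∑ x ∈ z.support, Finsupp.single x (z x) +
            (∑ x ∈ z.support, z x) • Finsupp.single x0 1 := by
        rw [Finset.sum_smul, ← Finset.sum_add_distrib]
        refine Finset.sum_congr rfl fun x _ => ?_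
        simp [dl, smul_add]
      have h3 : ∑ x ∈ z.support, z x = 0 := by
        simpa [sumOn, Finsupp.linearCombination_apply, Finsupp.sum] using h0
      rw [h2, h3, zero_smul, add_zero]
      exact (Finsupp.sum_single z).symm
    rw [h1]
    refine N.sum_mem fun x hx => N.smul_mem _ (hN x ?_ x0 hx0)
    by_contra h
    exact (Finsupp.mem_support_iff.1 hx) (hz x h)
  · have : z = 0 := by
      ext x
      exact hz x fun h => hZ ⟨x, h⟩
    exact this ▸ N.zero_mem

open Classical in
/-- The vector of an edge: the sum of its ends, with coefficients in the field of two elements. -/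
def bvec (Γ : Graph α β) (e : β) : α →₀ ZMod 2 :=
  if h : ∃ p : α × α, Γ.IsLink e p.1 p.2 then dl h.choose.1 h.choose.2 else 0

theorem bvec_eq {Γ : Graph α β} {e : β} {x y : α} (h : Γ.IsLink e x y) : bvec Γ e = dl x y := by
  have h' : ∃ p : α × α, Γ.IsLink e p.1 p.2 := ⟨(x, y), h⟩
  rw [bvec, dif_pos h']
  obtain ⟨h1, h2⟩ | ⟨h1, h2⟩ := h'.choose_spec.eq_and_eq_or_eq_and_eq h
  · rw [h1, h2]
  · rw [h1, h2, dl_comm]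

theorem bvec_of_notMem {Γ : Graph α β} {e : β} (h : e ∉ E(Γ)) : bvec Γ e = 0 := by
  rw [bvec, dif_neg]
  rintro ⟨p, hp⟩
  exact h hp.edge_mem

/-- `Z` is a union of components of the edges in `X`. -/
def IsClosedUnder (Γ : Graph α β) (X : Set β) (Z : Set α) : Prop :=
  ∀ e ∈ X, ∀ x y, Γ.IsLink e x y → x ∈ Z → y ∈ Z

theorem IsClosedUnder.iff {Γ : Graph α β} {X : Set β} {Z : Set α} (h : IsClosedUnder Γ X Z)
    {e : β} (he : e ∈ X) {x y : α} (hxy : Γ.IsLink e x y) : x ∈ Z ↔ y ∈ Z :=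
  ⟨h e he x y hxy, h e he y x hxy.symm⟩

/-- An edge of `X` has both ends in `Z` or none, so summing over `Z` modulo 2 kills it. These cut
functionals are how vertices are shown not to be connected. -/
theorem IsClosedUnder.sumOn_eq_zero {Γ : Graph α β} {X : Set β} {Z : Set α}
    (h : IsClosedUnder Γ X Z) {z : α →₀ ZMod 2} (hz : z ∈ spn (bvec Γ) X) : sumOn Z z = 0 := by
  suffices spn (bvec Γ) X ≤ LinearMap.ker (sumOn Z) from this hz
  refine spn_le _ fun e he => ?_
  by_cases hE : e ∈ E(Γ)
  · obtain ⟨x, y, hxy⟩ := Γ.exists_isLink_of_mem_edgeSet hE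
    rw [LinearMap.mem_ker, bvec_eq hxy, sumOn_dl]
    exact h.iff he hxy
  · rw [bvec_of_notMem hE]
    exact Submodule.zero_mem _

theorem IsClosedUnder.mem_iff {Γ : Graph α β} {X : Set β} {Z : Set α} (h : IsClosedUnder Γ X Z)
    {x y : α} (hxy : dl x y ∈ spn (bvec Γ) X) : x ∈ Z ↔ y ∈ Z :=
  (sumOn_dl Z x y).1 (h.sumOn_eq_zero hxy)

theorem dl_mem_of_isLink {Γ : Graph α β} {X : Set β} {e : β} (he : e ∈ X) {x y : α}
    (h : Γ.IsLink e x y) : dl x y ∈ spn (bvec Γ) X := bvec_eq h ▸ mem_spn _ he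

/-- The component of `x`. -/
theorem isClosedUnder_component (Γ : Graph α β) (X : Set β) (x : α) :
    IsClosedUnder Γ X {y | dl x y ∈ spn (bvec Γ) X} :=
  fun _ he _ _ hyz hy => dl_mem_trans hy (dl_mem_of_isLink he hyz)

theorem reach_of_isLink {Γ : Graph α β} {X : Set β} {e : β} (he : e ∈ X) {x y : α}
    (h : Γ.IsLink e x y) : Reach (Γ.restrict X) x y :=
  Relation.ReflTransGen.single ⟨e, by simp [he, h]⟩

/-- Along a path the vectors telescope modulo 2. Conversely, the vertices reachable from `x` are
closed under `X`, and the cut functional of this set detects a `y` outside it. -/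
theorem reach_restrict_iff (Γ : Graph α β) (X : Set β) (x y : α) :
    Reach (Γ.restrict X) x y ↔ dl x y ∈ spn (bvec Γ) X := by
  constructor
  · intro h
    induction h with
    | refl => exact dl_self_mem _ _
    | tail _ h ih =>
      obtain ⟨e, he⟩ := h
      simp only [Graph.restrict_isLink] at he
      exact dl_mem_trans ih (dl_mem_of_isLink (by tauto) (by tauto))
  · intro h
    refine (IsClosedUnder.mem_iff (Z := {y | Reach (Γ.restrict X) x y}) ?_ h).1
      Relation.ReflTransGen.refl
    exact fun e he a b hab ha => Relation.ReflTransGen.trans ha (reach_of_isLink he hab)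

theorem reach_iff (Γ : Graph α β) (x y : α) : Reach Γ x y ↔ dl x y ∈ spn (bvec Γ) Set.univ := by
  rw [← reach_restrict_iff]
  have : Γ.restrict Set.univ = Γ := Graph.ext (by simp) (by simp)
  rw [this]

theorem isConn_iff (Γ : Graph α β) : IsConn Γ ↔ V(Γ).Nonempty ∧
    ∀ x ∈ V(Γ), ∀ y ∈ V(Γ), dl x y ∈ spn (bvec Γ) Set.univ := by
  simp only [IsConn, reach_iff]

/-- An edge lies on no cycle of `T` when its vector is not in the span of the others; for all edges
at once this is linear independence. A self-loop is excluded on both sides. -/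
theorem isForest_iff (Γ : Graph α β) (T : Set β) :
    IsForest Γ T ↔ T ⊆ E(Γ) ∧ Indep (bvec Γ) T := by
  refine and_congr_right fun hT => ?_
  rw [Indep, linearIndepOn_iff_notMem_span]
  refine forall₂_congr fun e he => ?_
  obtain ⟨x, y, hxy⟩ := Γ.exists_isLink_of_mem_edgeSet (hT he)
  rw [bvec_eq hxy, ← reach_restrict_iff]
  refine ⟨fun h => h x y hxy, fun h a b hab => ?_⟩
  rw [reach_restrict_iff, ← bvec_eq hab, bvec_eq hxy, ← reach_restrict_iff]
  exact h

theorem isSpanningTree_iff (Γ : Graph α β) (T : Set β) (hΓ : IsConn Γ) :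
    IsSpanningTree Γ T ↔
      T ⊆ E(Γ) ∧ Indep (bvec Γ) T ∧ spn (bvec Γ) Set.univ ≤ spn (bvec Γ) T := by
  rw [IsSpanningTree, isForest_iff, and_assoc]
  refine and_congr_right fun hT => and_congr_right fun _ => ?_
  constructor
  · rintro ⟨-, h⟩
    refine spn_le _ fun e _ => ?_
    by_cases hE : e ∈ E(Γ)
    · obtain ⟨x, y, hxy⟩ := Γ.exists_isLink_of_mem_edgeSet hE
      rw [bvec_eq hxy, ← reach_restrict_iff]
      exact h x hxy.left_mem y hxy.right_mem
    · rw [bvec_of_notMem hE]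
      exact Submodule.zero_mem _
  · intro h
    rw [isConn_iff] at hΓ
    refine ⟨hΓ.1, fun x hx y hy => ?_⟩
    rw [reach_restrict_iff]
    exact h (hΓ.2 x hx y hy)

/-- In a spanning 2-tree any two of three vertices are connected. -/
theorem IsSpanningTwoTree.connected {Γ : Graph α β} {T : Set β} (h : IsSpanningTwoTree Γ T)
    {x y z : α} (hx : x ∈ V(Γ)) (hy : y ∈ V(Γ)) (hz : z ∈ V(Γ)) :
    dl x y ∈ spn (bvec Γ) T ∨ dl x z ∈ spn (bvec Γ) T ∨ dl y z ∈ spn (bvec Γ) T := by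
  obtain ⟨-, a, -, b, -, -, hab⟩ := h
  simp only [reach_restrict_iff] at hab
  obtain h1 | h1 := hab x hx <;> obtain h2 | h2 := hab y hy <;> obtain h3 | h3 := hab z hz
  all_goals
    first
    | exact Or.inl (dl_mem_trans (dl_mem_symm h1) h2)
    | exact Or.inr (Or.inl (dl_mem_trans (dl_mem_symm h1) h3))
    | exact Or.inr (Or.inr (dl_mem_trans (dl_mem_symm h2) h3))

theorem IsSpanningTwoTree.indep {Γ : Graph α β} {T : Set β} (h : IsSpanningTwoTree Γ T) :
    Indep (bvec Γ) T := ((isForest_iff Γ T).1 h.1).2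

/-- The coefficient of `v e` is 0 or 1: a path either avoids the new edge or uses it once. -/
theorem dl_mem_insert_iff {v : β → α →₀ ZMod 2} {T : Set β} {e : β} {z : α →₀ ZMod 2} :
    z ∈ spn v (insert e T) ↔ z ∈ spn v T ∨ z + v e ∈ spn v T := by
  rw [spn, Set.image_insert_eq, Submodule.mem_span_insert]
  constructor
  · rintro ⟨a, y, hy, rfl⟩
    obtain rfl | rfl := zmod_two_cases a
    · left
      simpa using hy
    · right
      rw [one_smul, add_right_comm, add_self_eq_zero_zmod_two, zero_add]
      exact hy
  · rintro (h | h)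
    · exact ⟨0, z, h, by simp⟩
    · refine ⟨1, z + v e, h, ?_⟩
      rw [one_smul, add_comm z, ← add_assoc, add_self_eq_zero_zmod_two, zero_add]

theorem isSpanningTwoTree_of_insert {Γ : Graph α β} {T : Set β} {e : β} (hΓ : IsConn Γ)
    (hT : T ⊆ E(Γ)) (he : e ∈ E(Γ)) (hi : Indep (bvec Γ) T) (he' : bvec Γ e ∉ spn (bvec Γ) T)
    (hs : spn (bvec Γ) Set.univ ≤ spn (bvec Γ) (insert e T)) : IsSpanningTwoTree Γ T := by
  obtain ⟨x, y, hxy⟩ := Γ.exists_isLink_of_mem_edgeSet he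
  refine ⟨(isForest_iff Γ T).2 ⟨hT, hi⟩, x, hxy.left_mem, y, hxy.right_mem, ?_, fun z hz => ?_⟩
  · rw [reach_restrict_iff, ← bvec_eq hxy]
    exact he'
  · simp only [reach_restrict_iff]
    have := hs (((isConn_iff Γ).1 hΓ).2 x hxy.left_mem z hz)
    rw [dl_mem_insert_iff] at this
    refine this.imp id fun h => ?_
    rwa [bvec_eq hxy, add_comm, dl_comm x y, dl_add_dl] at h

/-- Adding to a spanning 2-tree an edge which joins its components gives a spanning tree. -/
theorem IsSpanningTwoTree.spn_insert {Γ : Graph α β} {T : Set β} (h : IsSpanningTwoTree Γ T)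
    {e : β} (he : bvec Γ e ∉ spn (bvec Γ) T) :
    spn (bvec Γ) Set.univ ≤ spn (bvec Γ) (insert e T) := by
  have hE : e ∈ E(Γ) := by
    by_contra hE
    exact he (bvec_of_notMem hE ▸ Submodule.zero_mem _)
  obtain ⟨x, y, hxy⟩ := Γ.exists_isLink_of_mem_edgeSet hE
  rw [bvec_eq hxy] at he
  have hx : ∀ z ∈ V(Γ), dl x z ∈ spn (bvec Γ) (insert e T) := by
    intro z hz
    obtain h1 | h1 | h1 := h.connected hxy.left_mem hxy.right_mem hz
    · exact absurd h1 he
    · exact spn_mono _ (Set.subset_insert e T) h1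
    · exact dl_mem_trans (dl_mem_of_isLink (Set.mem_insert e T) hxy)
        (spn_mono _ (Set.subset_insert e T) h1)
  refine spn_le _ fun f _ => ?_
  by_cases hF : f ∈ E(Γ)
  · obtain ⟨a, b, hab⟩ := Γ.exists_isLink_of_mem_edgeSet hF
    rw [bvec_eq hab]
    exact dl_mem_trans (dl_mem_symm (hx a hab.left_mem)) (hx b hab.right_mem)
  · rw [bvec_of_notMem hF]
    exact Submodule.zero_mem _

end EdgeVectors

/-! ### Separators and one-vertex irreducible components -/

section Separators

variable {α β : Type*}

theorem isLink_of_inc_of_inc {Γ : Graph α β} {e : β} {x y : α} (hx : Γ.Inc e x) (hy : Γ.Inc e y)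
    (h : x ≠ y) : Γ.IsLink e x y := by
  obtain ⟨z, hz⟩ := hx
  obtain rfl | rfl := hy.eq_or_eq_of_isLink hz
  · exact absurd rfl h
  · exact hz

/-- A chain of edges linked through `W` contains a path between given ends of its first and last
edge. -/
theorem EdgeLinked.dl_mem {Γ : Graph α β} {X : Set β} {W W' : Set α} (hW : W ⊆ W') {e f : β}
    (he : e ∈ X) (h : EdgeLinked Γ X W e f) {x y : α} (hx : Γ.Inc e x) (hxW : x ∈ W')
    (hy : Γ.Inc f y) (hyW : y ∈ W') :
    dl x y ∈ spn (bvec Γ) {g | g ∈ X ∧ EdgeLinked Γ X W e g ∧ ∀ z, Γ.Inc g z → z ∈ W'} := by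
  have key : ∀ g, g ∈ X → EdgeLinked Γ X W e g → ∀ u w, Γ.Inc g u → Γ.Inc g w → u ∈ W' → w ∈ W' →
      dl u w ∈ spn (bvec Γ) {g | g ∈ X ∧ EdgeLinked Γ X W e g ∧ ∀ z, Γ.Inc g z → z ∈ W'} := by
    intro g hg heg u w hu hw huW hwW
    by_cases huw : u = w
    · rw [huw]
      exact dl_self_mem _ _
    · have hl := isLink_of_inc_of_inc hu hw huw
      refine dl_mem_of_isLink (e := g) ?_ hl
      refine ⟨hg, heg, fun z hz => ?_⟩
      obtain rfl | rfl := hz.eq_or_eq_of_isLink hl <;> assumption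
  induction h generalizing y with
  | refl => exact key e he Relation.ReflTransGen.refl x y hx hy hxW hyW
  | tail hb hbc ih =>
    obtain ⟨hb', hc, u, hu, hbu, hcu⟩ := hbc
    exact dl_mem_trans (ih hbu (hW hu)) (key _ hc (Relation.ReflTransGen.tail hb
      ⟨hb', hc, u, hu, hbu, hcu⟩) u y hcu hy (hW hu) hyW)

theorem edgeLinked_symm {Γ : Graph α β} {X : Set β} {W : Set α} {e f : β}
    (h : EdgeLinked Γ X W e f) : EdgeLinked Γ X W f e := by
  induction h with
  | refl => exact Relation.ReflTransGen.refl
  | tail _ h ih =>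
    obtain ⟨h1, h2, v, hv, h3, h4⟩ := h
    exact Relation.ReflTransGen.head ⟨h2, h1, v, hv, h4, h3⟩ ih

/-- Two vertices of a 1VI graph different from `v` are connected without using `v`. -/
theorem IsOneVI.dl_mem_avoid {Γ : Graph α β} {B : Set β} (hB : IsOneVI Γ B) {v x y : α}
    (hx : x ∈ endsOf Γ B) (hy : y ∈ endsOf Γ B) (hxv : x ≠ v) (hyv : y ≠ v) :
    dl x y ∈ spn (bvec Γ) {g | g ∈ B ∧ ∀ z, Γ.Inc g z → z ≠ v} := by
  obtain ⟨e, he, hex⟩ := hx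
  obtain ⟨f, hf, hfy⟩ := hy
  refine spn_mono _ ?_ (EdgeLinked.dl_mem (W := {x | x ≠ v}) subset_rfl he
    (hB.2.2 v e he f hf) hex hxv hfy hyv)
  exact fun g hg => ⟨hg.1, hg.2.2⟩

theorem IsOneVI.dl_mem {Γ : Graph α β} {B : Set β} (hB : IsOneVI Γ B) {x y : α}
    (hx : x ∈ endsOf Γ B) (hy : y ∈ endsOf Γ B) : dl x y ∈ spn (bvec Γ) B := by
  obtain ⟨e, he, hex⟩ := hx
  obtain ⟨f, hf, hfy⟩ := hy
  refine spn_mono _ ?_ (EdgeLinked.dl_mem (W' := Set.univ) (Set.subset_univ _) he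
    (hB.2.2 x e he f hf) hex trivial hfy trivial)
  exact fun g hg => hg.1

theorem endsOf_nonempty {Γ : Graph α β} {B : Set β} (hB : IsOneVI Γ B) :
    (endsOf Γ B).Nonempty := by
  obtain ⟨e, he⟩ := hB.1
  obtain ⟨x, y, hxy⟩ := Γ.exists_isLink_of_mem_edgeSet (hB.2.1 he)
  exact ⟨x, e, he, y, hxy⟩

/-- In a connected graph every vertex is connected to a 1VI component outside it. -/
theorem exists_end_connected {Γ : Graph α β} (hΓ : IsConn Γ) {B : Set β} (hB : IsOneVI Γ B)
    {w : α} (hw : w ∈ V(Γ)) : ∃ u ∈ endsOf Γ B, dl u w ∈ spn (bvec Γ) Bᶜ := by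
  obtain ⟨u₀, hu₀⟩ := endsOf_nonempty hB
  have hu₀V : u₀ ∈ V(Γ) := by
    obtain ⟨e, -, h⟩ := hu₀
    exact h.vertex_mem
  refine (IsClosedUnder.mem_iff (Γ := Γ) (X := Set.univ)
    (Z := {z | ∃ u ∈ endsOf Γ B, dl u z ∈ spn (bvec Γ) Bᶜ}) ?_
    (((isConn_iff Γ).1 hΓ).2 u₀ hu₀V w hw)).1 ⟨u₀, hu₀, dl_self_mem _ _⟩
  rintro e - a b hab ⟨u, hu, hua⟩
  by_cases he : e ∈ B
  · exact ⟨b, ⟨e, he, hab.inc_right⟩, dl_self_mem _ _⟩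
  · exact ⟨u, hu, dl_mem_trans hua (dl_mem_of_isLink he hab)⟩

variable [Fintype β]

/-- The relations among the edges of `B` can be restricted to `X`. -/
def Splits (Γ : Graph α β) (B X : Set β) : Prop :=
  ∀ c : β → ZMod 2, (∀ e, e ∉ B → c e = 0) → ∑ e, c e • bvec Γ e = 0 →
    ∑ e, X.indicator c e • bvec Γ e = 0

/-- A separator of the cycle matroid. -/
def IsSep (Γ : Graph α β) (X : Set β) : Prop := Splits Γ Set.univ X

theorem IsSep.splits {Γ : Graph α β} {X : Set β} (h : IsSep Γ X) (B : Set β) : Splits Γ B X :=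
  fun c _ hc => h c (fun _ he => absurd trivial he) hc

/-- A 1VI subgraph is not cut by a separator. -/
theorem IsOneVI.subset_of_splits {Γ : Graph α β} {B X : Set β} (hB : IsOneVI Γ B)
    (hX : Splits Γ B X) {e₀ : β} (he₀ : e₀ ∈ B) (heX₀ : e₀ ∈ X) : B ⊆ X := by
  classical
  by_contra hBX
  obtain ⟨f₀, hf₀, hfX₀⟩ := Set.not_subset.1 hBX
  -- Since `B` is connected and meets both `X` and its complement, some edge of `X` touches, at a
  -- vertex `v`, an edge outside `X`.
  obtain ⟨e, he, heX, f, hf, hfX, v, hev, hfv⟩ : ∃ e ∈ B, e ∈ X ∧ ∃ f ∈ B, f ∉ X ∧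
      ∃ v, Γ.Inc e v ∧ Γ.Inc f v := by
    by_contra hcon
    push Not at hcon
    obtain ⟨w, -⟩ := Γ.exists_isLink_of_mem_edgeSet (hB.2.1 he₀)
    have h := hB.2.2 w e₀ he₀ f₀ hf₀
    refine hfX₀ ?_
    clear hfX₀ hf₀
    induction h with
    | refl => exact heX₀
    | tail _ h ih =>
      obtain ⟨h1, h2, u, -, h3, h4⟩ := h
      by_contra h5
      exact hcon _ h1 ih _ h2 h5 u h3 h4
  have hef : e ≠ f := fun h => hfX (h ▸ heX)
  have hlink := hB.2.2 v e he f hf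
  obtain ⟨x, hx, hex⟩ : ∃ x, x ≠ v ∧ Γ.Inc e x := by
    obtain h | ⟨g, ⟨-, -, u, hu, h1, -⟩, -⟩ := Relation.ReflTransGen.cases_head hlink
    · exact absurd h hef
    · exact ⟨u, hu, h1⟩
  obtain ⟨y, hy, hfy⟩ : ∃ y, y ≠ v ∧ Γ.Inc f y := by
    obtain h | ⟨g, -, ⟨-, -, u, hu, -, h1⟩⟩ := Relation.ReflTransGen.cases_tail hlink
    · exact absurd h.symm hef
    · exact ⟨u, hu, h1⟩
  have hp := hB.dl_mem_avoid (v := v) ⟨e, he, hex⟩ ⟨f, hf, hfy⟩ hx hy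
  obtain ⟨c, hc, hcs⟩ := (mem_spn_iff _ _ _).1 hp
  have hce : bvec Γ e = dl v x := bvec_eq (isLink_of_inc_of_inc hev hex hx.symm)
  have hcf : bvec Γ f = dl v y := bvec_eq (isLink_of_inc_of_inc hfv hfy hy.symm)
  -- The other ends of `e` and `f` are joined inside `B` without touching `v`. Together with `e` and
  -- `f` this path closes up to a relation.
  have h0 : ∑ g, (c + Pi.single e 1 + Pi.single f 1 : β → ZMod 2) g • bvec Γ g = 0 := by
    simp only [Pi.add_apply, add_smul, Finset.sum_add_distrib, hcs, Pi.single_apply, ite_smul,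
      one_smul, zero_smul, Finset.sum_ite_eq', Finset.mem_univ, if_true]
    rw [hce, hcf, dl_comm v x, add_assoc, dl_add_dl, add_self_eq_zero_zmod_two]
  have h1 := hX _ ?_ h0
  · have h2 : ∑ g, X.indicator (c + Pi.single e 1 + Pi.single f 1 : β → ZMod 2) g • bvec Γ g =
        ∑ g, X.indicator c g • bvec Γ g + bvec Γ e := by
      simp only [Set.indicator_add', Pi.add_apply, add_smul, Finset.sum_add_distrib]
      have h3 : ∑ g, X.indicator (Pi.single e (1 : ZMod 2)) g • bvec Γ g = bvec Γ e := by
        rw [Finset.sum_eq_single e]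
        · simp [heX]
        · intro g _ hg
          simp [Set.indicator_apply, hg]
        · simp
      have h4 : ∑ g, X.indicator (Pi.single f (1 : ZMod 2)) g • bvec Γ g = 0 := by
        refine Finset.sum_eq_zero fun g _ => ?_
        by_cases hg : g = f
        · simp [hg, hfX]
        · simp [Set.indicator_apply, hg]
      rw [h3, h4, add_zero]
    rw [h2] at h1
    -- In the restriction of this relation to `X` only `e` touches `v`, so the coefficient at `v` is
    -- odd: it cannot be a relation.
    have h3 : sumOn {v} (∑ g, X.indicator c g • bvec Γ g) = 0 := by
      refine IsClosedUnder.sumOn_eq_zero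
        (X := {g | g ∈ B ∧ ∀ z, Γ.Inc g z → z ≠ v}) (Γ := Γ) ?_
        ((mem_spn_iff _ _ _).2 ⟨X.indicator c, fun g hg => ?_, rfl⟩)
      · rintro g hg a b hab rfl
        exact absurd rfl (hg.2 a hab.inc_left)
      · simp [Set.indicator_apply, hc g hg]
    have h4 := congrArg (sumOn {v}) h1
    rw [map_add, h3, zero_add, map_zero, hce, sumOn_dl] at h4
    exact hx (h4.1 rfl)
  · intro g hg
    have hge : g ≠ e := fun h => hg (h ▸ he)
    have hgf : g ≠ f := fun h => hg (h ▸ hf)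
    simp [hc g fun h => hg h.1, hge, hgf]

theorem IsSep.compl {Γ : Graph α β} {X : Set β} (h : IsSep Γ X) : IsSep Γ Xᶜ := by
  intro c h1 hc
  have h2 := h c h1 hc
  have h3 : ∑ e, X.indicator c e • bvec Γ e + ∑ e, Xᶜ.indicator c e • bvec Γ e = 0 := by
    rw [← hc, ← Finset.sum_add_distrib]
    refine Finset.sum_congr rfl fun e _ => ?_
    rw [← add_smul, ← Pi.add_apply, Set.indicator_self_add_compl]
  rwa [h2, zero_add] at h3

theorem IsSep.inter {Γ : Graph α β} {X Y : Set β} (hX : IsSep Γ X) (hY : IsSep Γ Y) :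
    IsSep Γ (X ∩ Y) := by
  intro c h1 hc
  rw [← Set.indicator_indicator]
  exact hX _ (fun _ he => absurd trivial he) (hY c h1 hc)

theorem isSep_edgeSet (Γ : Graph α β) : IsSep Γ E(Γ) := by
  intro c h1 hc
  rw [← hc]
  refine Finset.sum_congr rfl fun e _ => ?_
  by_cases he : e ∈ E(Γ)
  · rw [Set.indicator_of_mem he]
  · rw [bvec_of_notMem he, smul_zero, smul_zero]

/-- The two expressions of `z` form one relation, and its restriction to `X` is the first
expression. Thus the spans of a separator and of its complement form a direct sum. -/
theorem IsSep.eq_zero {Γ : Graph α β} {X : Set β} (h : IsSep Γ X) {z : α →₀ ZMod 2}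
    (h1 : z ∈ spn (bvec Γ) X) (h2 : z ∈ spn (bvec Γ) Xᶜ) : z = 0 := by
  obtain ⟨c, hc, rfl⟩ := (mem_spn_iff _ _ _).1 h1
  obtain ⟨d, hd, hcd⟩ := (mem_spn_iff _ _ _).1 h2
  have h3 := h (c + d) (fun _ he => absurd trivial he) (by
    simp only [Pi.add_apply, add_smul, Finset.sum_add_distrib, hcd, add_self_eq_zero_zmod_two])
  rw [← h3]
  refine Finset.sum_congr rfl fun e _ => ?_
  by_cases he : e ∈ X
  · simp [he, hd e (by simpa using he)]
  · simp [he, hc e he]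

/-- A part of `N` which shares at most the vertex `v` with the rest of `N`. -/
theorem isSep_of_isSep_of_one_vertex {Γ : Graph α β} {N Q : Set β} (hN : IsSep Γ N) (hQ : Q ⊆ N)
    {v : α} (h : ∀ e ∈ Q, ∀ f ∈ N \ Q, ∀ u, Γ.Inc e u → Γ.Inc f u → u = v) : IsSep Γ Q := by
  intro c h1 hc
  have h2 := hN c h1 hc
  have h3 : ∑ e, Q.indicator c e • bvec Γ e = ∑ e, (N \ Q).indicator c e • bvec Γ e := by
    have h4 : ∑ e, Q.indicator c e • bvec Γ e + ∑ e, (N \ Q).indicator c e • bvec Γ e = 0 := by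
      rw [← h2, ← Finset.sum_add_distrib]
      refine Finset.sum_congr rfl fun e _ => ?_
      have := @hQ e
      by_cases he : e ∈ Q <;> by_cases he' : e ∈ N <;> simp_all
    rw [add_eq_iff_zmod_two, zero_add] at h4
    exact h4
  have hm : ∀ X : Set β, ∑ e, X.indicator c e • bvec Γ e ∈ spn (bvec Γ) X := fun X =>
    (mem_spn_iff _ _ _).2 ⟨X.indicator c, fun e he => Set.indicator_of_notMem he c, rfl⟩
  have hv : ∀ X : Set β, ∀ u, (∀ e ∈ X, ¬ Γ.Inc e u) →
      (∑ e, X.indicator c e • bvec Γ e) u = 0 := by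
    intro X u hu
    rw [Finsupp.finsetSum_apply]
    refine Finset.sum_eq_zero fun e _ => ?_
    by_cases he : e ∈ X
    · by_cases hE : e ∈ E(Γ)
      · obtain ⟨x, y, hxy⟩ := Γ.exists_isLink_of_mem_edgeSet hE
        have hx : x ≠ u := by
          rintro rfl
          exact hu e he hxy.inc_left
        have hy : y ≠ u := by
          rintro rfl
          exact hu e he hxy.inc_right
        rw [bvec_eq hxy]
        simp [dl, hx, hy]
      · simp [bvec_of_notMem hE]
    · simp [he]
  -- The boundary of the part in `Q` equals that of the part in `N \ Q`, so it is supported at the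
  -- common vertex `v`. Its total is even, hence it vanishes.
  have := mem_of_forall_dl_mem (N := ⊥) (Z := {v}) (z := ∑ e, Q.indicator c e • bvec Γ e)
    (by rintro x rfl y rfl; exact dl_self_mem _ _) ?_ ?_
  · simpa using this
  · intro u hu
    by_cases hQu : ∃ e ∈ Q, Γ.Inc e u
    · obtain ⟨e, he, heu⟩ := hQu
      rw [h3]
      exact hv _ u fun f hf hfu => hu (h e he f hf u heu hfu)
    · exact hv _ u fun e he heu => hQu ⟨e, he, heu⟩
  · exact IsClosedUnder.sumOn_eq_zero (Γ := Γ) (X := Q) (fun _ _ _ _ _ _ => trivial) (hm Q)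

/-- Every edge lies in a 1VI component, which is a separator. -/
theorem exists_isOneVIComponent {Γ : Graph α β} {e : β} (he : e ∈ E(Γ)) :
    ∃ B, IsOneVIComponent Γ B ∧ e ∈ B ∧ IsSep Γ B := by
  -- The smallest separator containing `e` will turn out to be its 1VI component.
  obtain ⟨N, hN⟩ := (Set.toFinite {X : Set β | IsSep Γ X ∧ e ∈ X}).exists_minimal
    ⟨E(Γ), isSep_edgeSet Γ, he⟩
  have hmin : ∀ X, IsSep Γ X → e ∈ X → N ⊆ X := fun X hX heX =>
    (hN.2 ⟨hN.1.1.inter hX, hN.1.2, heX⟩ Set.inter_subset_left).trans Set.inter_subset_right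
  have hone : IsOneVI Γ N := by
    refine ⟨⟨e, hN.1.2⟩, hmin _ (isSep_edgeSet Γ) he, fun v f hf g hg => ?_⟩
    by_contra hfg
    -- If removing `v` disconnected `N`, the piece linked to `f` would be a separator by itself.
    -- Either it or its complement contains `e`, against minimality.
    have hQ : IsSep Γ {h | h ∈ N ∧ EdgeLinked Γ N {x | x ≠ v} f h} := by
      refine isSep_of_isSep_of_one_vertex (v := v) hN.1.1 (fun _ h => h.1) ?_
      rintro a ⟨ha, hfa⟩ b ⟨hb, hfb⟩ u hau hbu
      by_contra huv
      exact hfb ⟨hb, Relation.ReflTransGen.tail hfa ⟨ha, hb, u, huv, hau, hbu⟩⟩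
    by_cases heQ : e ∈ {h | h ∈ N ∧ EdgeLinked Γ N {x | x ≠ v} f h}
    · exact hfg (hmin _ hQ heQ hg).2
    · exact hmin _ hQ.compl heQ hf ⟨hf, Relation.ReflTransGen.refl⟩
  refine ⟨N, ⟨hone, fun B hB hNB => ?_⟩, hN.1.2, hN.1.1⟩
  exact hB.subset_of_splits (hN.1.1.splits B) (hNB hN.1.2) hN.1.2

theorem IsOneVIComponent.isSep {Γ : Graph α β} {B : Set β} (hB : IsOneVIComponent Γ B) :
    IsSep Γ B := by
  obtain ⟨e, he⟩ := hB.1.1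
  obtain ⟨N, hN, heN, hs⟩ := exists_isOneVIComponent (hB.1.2.1 he)
  have h1 : B ⊆ N := hB.1.subset_of_splits (hs.splits B) he heN
  have h2 : N ⊆ B := hB.2 hN.1 h1
  exact (h1.antisymm h2) ▸ hs

theorem IsOneVIComponent.eq_of_mem {Γ : Graph α β} {B B' : Set β} (hB : IsOneVIComponent Γ B)
    (hB' : IsOneVIComponent Γ B') {e : β} (he : e ∈ B) (he' : e ∈ B') : B = B' :=
  (hB.1.subset_of_splits (hB'.isSep.splits B) he he').antisymm
    (hB'.1.subset_of_splits (hB.isSep.splits B') he' he)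

/-- The vertices of a 1VI component are disconnected from each other outside it. -/
theorem IsOneVIComponent.eq_of_dl_mem {Γ : Graph α β} {B : Set β} (hB : IsOneVIComponent Γ B)
    {x y : α} (hx : x ∈ endsOf Γ B) (hy : y ∈ endsOf Γ B) (h : dl x y ∈ spn (bvec Γ) Bᶜ) :
    x = y := by
  have h0 := hB.isSep.eq_zero (hB.1.dl_mem hx hy) h
  have := (sumOn_dl {x} x y).1 (by rw [h0, map_zero])
  exact (this.1 rfl).symm

/-- A 1VI graph without loops is a single edge. -/
theorem IsOneVI.eq_singleton [Finite α] {Γ : Graph α β} {B : Set β} (hB : IsOneVI Γ B)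
    (h : ¬ (endsOf Γ B).ncard ≤ B.ncard) :
    ∃ e x y, x ≠ y ∧ Γ.IsLink e x y ∧ B = {e} := by
  classical
  have := Fintype.ofFinite α
  obtain ⟨e, he⟩ := hB.1
  obtain ⟨x, y, hxy⟩ := Γ.exists_isLink_of_mem_edgeSet (hB.2.1 he)
  have hx : x ∈ endsOf Γ B := ⟨e, he, y, hxy⟩
  -- The star of vectors from `x` to the other ends is independent and lies in the span of `B`. As
  -- `B` has fewer edges than ends, this forces `B` to be independent.
  have hind : Indep (fun u : α => dl x u) (endsOf Γ B \ {x}) := by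
    refine indep_of_eq_zero fun c hc h0 => funext fun u => ?_
    by_cases hu : u = x
    · exact hc u (by simp [hu])
    · have h1 := congrArg (sumOn {u}) h0
      rw [map_sum, Finset.sum_eq_single u] at h1
      · rw [map_smul, dl, map_add, sumOn_single, sumOn_single] at h1
        simpa [Ne.symm hu] using h1
      · intro w _ hwu
        rw [map_smul, (sumOn_dl {u} x w).2 (by simp [Ne.symm hu, hwu]), smul_zero]
      · simp
  have hle : spn (fun u : α => dl x u) (endsOf Γ B \ {x}) ≤ spn (bvec Γ) B :=
    spn_le _ fun u hu => hB.dl_mem hx hu.1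
  have h1 : (endsOf Γ B \ {x}).ncard ≤ rk (bvec Γ) B := by
    rw [← hind.rk_eq]
    exact Submodule.finrank_mono hle
  have h2 := Set.ncard_sdiff_singleton_add_one hx
  have hBi : Indep (bvec Γ) B := indep_of_ncard_le (by omega)
  have hBe : B = {e} := by
    -- Without relations every subset splits off, so the irreducible `B` is just `{e}`.
    refine Set.Subset.antisymm (hB.subset_of_splits (X := {e}) ?_ he rfl) (by simpa using he)
    intro c hc h0
    rw [hBi.eq_zero hc h0]
    simp
  refine ⟨e, x, y, ?_, hxy, hBe⟩
  rintro rfl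
  refine h ?_
  have : endsOf Γ B ⊆ {x} := by
    rintro u ⟨f, hf, hu⟩
    rw [hBe] at hf
    obtain rfl : f = e := hf
    simpa using hu.eq_or_eq_of_isLink hxy
  rw [hBe, Set.ncard_singleton]
  exact (Set.ncard_le_ncard (hBe ▸ this)).trans (by simp)

/-- If `B'` hangs on the vertex `v` of `B`, all the vertices outside the branch at `v` are connected
to `v` without using `B'`. -/
theorem connected_avoiding_branch {Γ : Graph α β} (hΓ : IsConn Γ) {B B' : Set β}
    (hB : IsOneVIComponent Γ B) (hB' : IsOneVIComponent Γ B') (hne : B ≠ B') {v w : α}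
    (hv : v ∈ endsOf Γ B) (hv' : v ∈ endsOf Γ B') (hw : w ∈ V(Γ))
    (h : dl v w ∉ spn (bvec Γ) Bᶜ) : dl v w ∈ spn (bvec Γ) B'ᶜ := by
  have hBB' : B' ⊆ Bᶜ := fun e he he' => hne (hB.eq_of_mem hB' he' he)
  obtain ⟨u, hu, huw⟩ := exists_end_connected hΓ hB.1 hw
  have h1 : dl u w ∈ spn (bvec Γ) B'ᶜ := by
    -- Travel from the end `u` of `B` to `w` outside `B`. An edge of `B'` met on the way would lead
    -- to `v` within `B'`, hence without using `B`, and so place `w` in the branch at `v`.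
    refine (IsClosedUnder.mem_iff (Γ := Γ) (X := Bᶜ)
      (Z := {z | dl u z ∈ spn (bvec Γ) B'ᶜ ∧ dl v z ∉ spn (bvec Γ) Bᶜ}) ?_ huw).1
      ⟨dl_self_mem _ _, fun h' => h (dl_mem_trans h' huw)⟩ |>.1
    rintro e he a b hab ⟨h2, h3⟩
    have h4 : dl v b ∉ spn (bvec Γ) Bᶜ := fun h4 =>
      h3 (dl_mem_trans h4 (dl_mem_symm (dl_mem_of_isLink he hab)))
    refine ⟨?_, h4⟩
    by_cases heB' : e ∈ B'
    · refine absurd ?_ h3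
      exact spn_mono _ hBB' (hB'.1.dl_mem hv' ⟨e, heB', hab.inc_left⟩)
    · exact dl_mem_trans h2 (dl_mem_of_isLink heB' hab)
  refine dl_mem_trans (spn_mono _ (fun e he he' => ?_) (hB.1.dl_mem hv hu)) h1
  exact hBB' he' he

end Separators

/-! ### The reduced form -/

section Reduced

variable {α β : Type*}

theorem Reach.symm {Γ : Graph α β} {x y : α} (h : Reach Γ x y) : Reach Γ y x := by
  induction h with
  | refl => exact Relation.ReflTransGen.refl
  | tail _ h ih => exact Relation.ReflTransGen.head h.symm ih

theorem Reach.trans {Γ : Graph α β} {x y z : α} (h : Reach Γ x y) (h' : Reach Γ y z) :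
    Reach Γ x z := Relation.ReflTransGen.trans h h'

/-- The propagator `f` of the reduced form belongs to the 1VI component `B`, and ends at its vertex
`v`. -/
structure BelongsTo (Γ : Graph α β) (M : Set α) (f : β ⊕ (Set β × α)) (B : Set β) (v : α) :
    Prop where
  component : IsOneVIComponent Γ B
  mem_ends : v ∈ endsOf Γ B
  kind : (∃ e, f = Sum.inl e ∧ B = {e} ∧ ¬ IsNontrivial Γ B) ∨
    (f = Sum.inr (B, v) ∧ IsNontrivial Γ B ∧ IsShared Γ M v)

theorem place_of_shared {Γ : Graph α β} {M : Set α} {v : α} (h : IsShared Γ M v) :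
    place Γ M v = Sum.inl v := by
  rw [place, if_neg]
  exact fun h' => h'.2 h

theorem place_of_not_shared {Γ : Graph α β} {M : Set α} {v : α} (h : ¬ IsShared Γ M v)
    {B : Set β} (hB : IsNontrivial Γ B) (hv : v ∈ endsOf Γ B) : place Γ M v = Sum.inr B := by
  rw [place, if_pos ⟨⟨B, hB, hv⟩, h⟩]
  have : {B | IsNontrivial Γ B ∧ v ∈ endsOf Γ B} = {B} := by
    refine Set.Subset.antisymm ?_ (by simpa using ⟨hB, hv⟩)
    rintro B' ⟨hB', hv'⟩
    by_contra hne
    exact h (Or.inl ⟨B', B, hB'.1, hB.1, hne, hv', hv⟩)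
  rw [this, Set.sUnion_singleton]

/-- The side of `v` of the reduced form, after deletion of a propagator that belongs to `B` and ends
at `v`. -/
def side (Γ : Graph α β) (B : Set β) (v : α) : α ⊕ Set β → Prop
  | Sum.inl w => dl v w ∈ spn (bvec Γ) Bᶜ
  | Sum.inr γ => γ ≠ B ∧ ∃ w ∈ endsOf Γ γ, dl v w ∈ spn (bvec Γ) Bᶜ

theorem deleteEdges_adj {Γ : Graph α β} {M : Set α} {f : β ⊕ (Set β × α)} {x y : α ⊕ Set β} :
    ((reducedForm Γ M).deleteEdges {f}).Adj x y ↔ ∃ f', f' ≠ f ∧ reducedLink Γ M f' x y := by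
  simp only [Graph.Adj, Graph.deleteEdges_isLink, Set.mem_singleton_iff]
  exact exists_congr fun f' => and_comm

theorem reach_place_inr {Γ : Graph α β} {M : Set α} {f : β ⊕ (Set β × α)} {γ : Set β} {a : α}
    (hγ : IsNontrivial Γ γ) (ha : a ∈ endsOf Γ γ) (hf : Sum.inr (γ, a) ≠ f) :
    Reach ((reducedForm Γ M).deleteEdges {f}) (place Γ M a) (Sum.inr γ) := by
  by_cases hs : IsShared Γ M a
  · rw [place_of_shared hs]
    exact Relation.ReflTransGen.single
      (deleteEdges_adj.2 ⟨Sum.inr (γ, a), hf, ⟨hγ, ha, hs⟩, Or.inr ⟨rfl, rfl⟩⟩)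
  · rw [place_of_not_shared hs hγ ha]
    exact Relation.ReflTransGen.refl

variable [Fintype β]

theorem IsOneVIComponent.subset_compl {Γ : Graph α β} {B B' : Set β}
    (hB : IsOneVIComponent Γ B) (hB' : IsOneVIComponent Γ B') (h : B' ≠ B) : B' ⊆ Bᶜ :=
  fun _ he he' => h (hB'.eq_of_mem hB he he')

/-- Any vertex of `γ` may serve as representative, because `γ` is connected and shares no edge with
`B`. -/
theorem side_inr_iff {Γ : Graph α β} {B γ : Set β} {v w : α}
    (hB : IsOneVIComponent Γ B) (hγ : IsOneVIComponent Γ γ) (hw : w ∈ endsOf Γ γ) (hne : γ ≠ B) :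
    side Γ B v (Sum.inr γ) ↔ dl v w ∈ spn (bvec Γ) Bᶜ := by
  constructor
  · rintro ⟨-, u, hu, h⟩
    exact dl_mem_trans h (spn_mono _ (hB.subset_compl hγ hne) (hγ.1.dl_mem hu hw))
  · exact fun h => ⟨hne, w, hw, h⟩

namespace BelongsTo

variable {Γ : Graph α β} {M : Set α} {f : β ⊕ (Set β × α)} {B : Set β} {v : α}

theorem side_place (h : BelongsTo Γ M f B v) (w : α) :
    side Γ B v (place Γ M w) ↔ dl v w ∈ spn (bvec Γ) Bᶜ := by
  by_cases hw : (∃ B, IsNontrivial Γ B ∧ w ∈ endsOf Γ B) ∧ ¬ IsShared Γ M w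
  · obtain ⟨⟨γ, hγ, hwγ⟩, hs⟩ := hw
    rw [place_of_not_shared hs hγ hwγ]
    by_cases hne : γ = B
    · subst hne
      -- The contracted `B` is on the far side by definition. If `w` were on the near side it would
      -- be `v`, but `v` is not absorbed into `B`: either `B` is trivial or `v` is shared.
      refine iff_of_false (fun h' => h'.1 rfl) fun h' => ?_
      have hvw := h.component.eq_of_dl_mem h.mem_ends hwγ h'
      subst hvw
      obtain ⟨-, -, -, h1⟩ | ⟨-, -, h1⟩ := h.kind
      · exact h1 hγ
      · exact hs h1
    · exact side_inr_iff h.component hγ.1 hwγ hne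
  · rw [place, if_neg hw]
    rfl

/-- Of all propagators only `f` crosses from the near to the far side. An auxiliary propagator of
`B` ending at another vertex has both ends on the far side. -/
theorem side_iff_of_link (h : BelongsTo Γ M f B v) {f' : β ⊕ (Set β × α)} (hf : f' ≠ f)
    {x y : α ⊕ Set β} (hxy : reducedLink Γ M f' x y) : side Γ B v x ↔ side Γ B v y := by
  rcases f' with e | ⟨γ, w⟩
  · obtain ⟨h1, a, b, hab, rfl, rfl⟩ := hxy
    rw [h.side_place, h.side_place]
    have he : e ∈ Bᶜ := by
      obtain ⟨e', h2, h3, -⟩ | ⟨-, h2, -⟩ := h.kind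
      · rw [h3]
        rintro rfl
        exact hf h2.symm
      · exact h1 B h2
    have hd := dl_mem_of_isLink he hab
    exact ⟨fun h' => dl_mem_trans h' hd, fun h' => dl_mem_trans h' (dl_mem_symm hd)⟩
  · have key : side Γ B v (Sum.inr γ) ↔ side Γ B v (Sum.inl w) := by
      obtain ⟨⟨h1, h2, h3⟩, -⟩ := hxy
      by_cases hne : γ = B
      · subst hne
        refine iff_of_false (fun h' => h'.1 rfl) fun h' => ?_
        obtain rfl := h.component.eq_of_dl_mem h.mem_ends h2 h'
        obtain ⟨-, -, -, h4⟩ | ⟨h4, -⟩ := h.kind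
        · exact h4 h1
        · exact hf h4.symm
      · exact side_inr_iff h.component h1.1 h2 hne
    obtain ⟨-, ⟨rfl, rfl⟩ | ⟨rfl, rfl⟩⟩ := hxy
    · exact key
    · exact key.symm

theorem side_iff_of_reach (h : BelongsTo Γ M f B v) {x y : α ⊕ Set β}
    (hxy : Reach ((reducedForm Γ M).deleteEdges {f}) x y) : side Γ B v x ↔ side Γ B v y := by
  induction hxy with
  | refl => rfl
  | tail _ h1 ih =>
    obtain ⟨f', hf, h2⟩ := deleteEdges_adj.1 h1
    exact ih.trans (h.side_iff_of_link hf h2)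

/-- An edge outside `B` either survives as a propagator different from `f`, or lies in another
contracted component, whose auxiliary propagators are all still present. -/
theorem reach_place (h : BelongsTo Γ M f B v) {a b : α} (hab : dl a b ∈ spn (bvec Γ) Bᶜ) :
    Reach ((reducedForm Γ M).deleteEdges {f}) (place Γ M a) (place Γ M b) := by
  refine (IsClosedUnder.mem_iff (Z := {z | Reach ((reducedForm Γ M).deleteEdges {f})
    (place Γ M a) (place Γ M z)}) ?_ hab).1 Relation.ReflTransGen.refl
  rintro e he x y hxy hx
  refine Reach.trans hx ?_
  by_cases hn : ∃ γ, IsNontrivial Γ γ ∧ e ∈ γ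
  · obtain ⟨γ, hγ, heγ⟩ := hn
    have hf : ∀ u, Sum.inr (γ, u) ≠ f := by
      rintro u rfl
      obtain ⟨e', h1, -⟩ | ⟨h1, -⟩ := h.kind
      · simp at h1
      · simp only [Sum.inr.injEq, Prod.mk.injEq] at h1
        exact he (h1.1 ▸ heγ)
    exact Reach.trans (reach_place_inr hγ ⟨e, heγ, hxy.inc_left⟩ (hf x))
      (Reach.symm (reach_place_inr hγ ⟨e, heγ, hxy.inc_right⟩ (hf y)))
  · push Not at hn
    refine Relation.ReflTransGen.single (deleteEdges_adj.2
      ⟨Sum.inl e, ?_, hn, x, y, hxy, rfl, rfl⟩)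
    rintro rfl
    obtain ⟨e', h1, h2, -⟩ | ⟨h1, -⟩ := h.kind
    · simp only [Sum.inl.injEq] at h1
      exact he (by simp [h2, h1])
    · simp at h1

/-- Deleting a propagator of the reduced form amounts to deleting its 1VI component from `Γ`. This
translation replaces any proof that the reduced form is a tree. -/
theorem reach_place_iff (h : BelongsTo Γ M f B v) (w : α) :
    Reach ((reducedForm Γ M).deleteEdges {f}) (place Γ M v) (place Γ M w) ↔
      dl v w ∈ spn (bvec Γ) Bᶜ := by
  refine ⟨fun hr => ?_, h.reach_place⟩
  rw [← h.side_place w, ← h.side_iff_of_reach hr, h.side_place]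
  exact dl_self_mem _ _

/-- The end of `f` opposite to `v`. -/
theorem exists_opposite [Finite α] (h : BelongsTo Γ M f B v) (hΓ : IsConn Γ) :
    ∃ y, reducedLink Γ M f (place Γ M v) y ∧ ∀ w ∈ V(Γ),
      (Reach ((reducedForm Γ M).deleteEdges {f}) y (place Γ M w) ↔
        dl v w ∉ spn (bvec Γ) Bᶜ) := by
  obtain ⟨e, rfl, hBe, hn⟩ | ⟨rfl, hn, hs⟩ := h.kind
  · obtain ⟨e', a, b, hab, hl, hBe'⟩ := h.component.1.eq_singleton
      fun h' => hn ⟨h.component, h'⟩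
    obtain rfl : e = e' := by simpa [hBe] using hBe'
    obtain ⟨c, hvc, hl⟩ : ∃ c, v ≠ c ∧ Γ.IsLink e v c := by
      obtain ⟨g, hg, hgv⟩ := h.mem_ends
      obtain rfl : g = e := by simpa [hBe] using hg
      obtain rfl | rfl := hgv.eq_or_eq_of_isLink hl
      · exact ⟨b, hab, hl⟩
      · exact ⟨a, hab.symm, hl.symm⟩
    have heB : e ∈ B := by simp [hBe]
    have hcB : c ∈ endsOf Γ B := ⟨e, heB, hl.inc_right⟩
    refine ⟨place Γ M c, ⟨?_, v, c, hl, rfl, rfl⟩, fun w hw => ⟨fun hr => ?_, fun hw' => ?_⟩⟩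
    · intro γ hγ heγ
      exact hn (hγ.1.eq_of_mem h.component heγ heB ▸ hγ)
    · rw [← h.side_place w, ← h.side_iff_of_reach hr, h.side_place]
      exact fun h' => hvc (h.component.eq_of_dl_mem h.mem_ends hcB h')
    · obtain ⟨u, ⟨g, hg, hgu⟩, huw⟩ := exists_end_connected hΓ h.component.1 hw
      obtain rfl : g = e := by simpa [hBe] using hg
      obtain rfl | rfl := hgu.eq_or_eq_of_isLink hl
      · exact absurd huw hw'
      · exact h.reach_place huw
  · refine ⟨Sum.inr B, ⟨⟨hn, h.mem_ends, hs⟩, Or.inr ⟨place_of_shared hs, rfl⟩⟩,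
      fun w hw => ⟨fun hr => ?_, fun hw' => ?_⟩⟩
    · rw [← h.side_place w, ← h.side_iff_of_reach hr]
      exact fun h' => h'.1 rfl
    · obtain ⟨u, hu, huw⟩ := exists_end_connected hΓ h.component.1 hw
      refine Reach.trans (Reach.symm (reach_place_inr hn hu ?_)) (h.reach_place huw)
      intro h'
      simp only [Sum.inr.injEq, Prod.mk.injEq, true_and] at h'
      exact hw' (h' ▸ huw)

open Classical in
/-- The total of `m` over the branch at `v` of the component `B`. -/
def branchSum [Fintype α] {P : Type} [AddCommMonoid P] (Γ : Graph α β) (B : Set β) (m : α → P)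
    (v : α) : P :=
  ∑ w : α, if w ∈ V(Γ) ∧ dl v w ∈ spn (bvec Γ) Bᶜ then m w else 0

open Classical in
/-- The momenta carried out of the two ends of a propagator of the reduced form. -/
theorem carried_cases [Fintype α] (h : BelongsTo Γ M f B v) (hΓ : IsConn Γ) {P : Type}
    [AddCommGroup P] :
    ∃ x y, (reducedForm Γ M).IsLink f x y ∧
      (∀ m : α → P, carried Γ M m f x = branchSum Γ B m v) ∧
      ∀ m : α → P, ∑ w, (if w ∈ V(Γ) then m w else 0) = 0 →
        carried Γ M m f y = - branchSum Γ B m v := by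
  obtain ⟨y, hy, hyw⟩ := h.exists_opposite hΓ
  refine ⟨place Γ M v, y, hy, fun m => ?_, fun m hm => ?_⟩
  · simp only [carried, h.reach_place_iff, branchSum]
  · rw [eq_neg_iff_add_eq_zero, ← hm, carried, branchSum, ← Finset.sum_add_distrib]
    refine Finset.sum_congr rfl fun w _ => ?_
    by_cases hw : w ∈ V(Γ)
    · by_cases hd : dl v w ∈ spn (bvec Γ) Bᶜ <;> simp [hw, hyw w hw, hd]
    · simp [hw]

end BelongsTo

theorem exists_belongsTo [Finite α] {Γ : Graph α β} {M : Set α} {f : β ⊕ (Set β × α)}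
    (hf : f ∈ E(reducedForm Γ M)) : ∃ B v, BelongsTo Γ M f B v := by
  obtain ⟨x, y, hxy⟩ := Graph.exists_isLink_of_mem_edgeSet hf
  change reducedLink Γ M f x y at hxy
  rcases f with e | ⟨γ, w⟩
  · obtain ⟨h1, a, b, hab, -, -⟩ := hxy
    obtain ⟨B, hB, heB, -⟩ := exists_isOneVIComponent hab.edge_mem
    have hn : ¬ IsNontrivial Γ B := fun h => h1 B h heB
    obtain ⟨e', c, d, -, hl, hBe⟩ := hB.1.eq_singleton fun h' => hn ⟨hB, h'⟩
    obtain rfl : e = e' := by simpa [hBe] using heB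
    exact ⟨B, c, hB, ⟨e, heB, hl.inc_left⟩, Or.inl ⟨e, rfl, hBe, hn⟩⟩
  · obtain ⟨⟨h1, h2, h3⟩, -⟩ := hxy
    exact ⟨γ, w, h1.1, h2, Or.inr ⟨rfl, h1, h3⟩⟩

end Reduced

/-! ### Facets of the Newton polytope -/

section Facets

variable {E : Type} [Fintype E]

/-- The points of `S` which minimise `v · r`. -/
def minPoints (S : Set ((E → ℝ) × ℝ)) (v : (E → ℝ) × ℝ) : Set ((E → ℝ) × ℝ) :=
  {p ∈ S | ∀ p' ∈ S, pairing v p ≤ pairing v p'}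

/-- The scalar product with `v` as a linear map. -/
def pairingLin (v : (E → ℝ) × ℝ) : ((E → ℝ) × ℝ) →ₗ[ℝ] ℝ where
  toFun := pairing v
  map_add' x y := by
    simp only [pairing, Prod.fst_add, Prod.snd_add, Pi.add_apply, mul_add, Finset.sum_add_distrib]
    ring
  map_smul' c x := by
    simp only [pairing, Prod.smul_fst, Prod.smul_snd, Pi.smul_apply, smul_eq_mul, RingHom.id_apply,
      mul_add, Finset.mul_sum]
    congr 1
    · exact Finset.sum_congr rfl fun e _ => by ring
    · ring

theorem pairingLin_apply (v r : (E → ℝ) × ℝ) : pairingLin v r = pairing v r := rfl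

theorem minPoints_subset_minFace (S : Set ((E → ℝ) × ℝ)) (v : (E → ℝ) × ℝ) :
    minPoints S v ⊆ minFace (convexHull ℝ S) v := by
  rintro p ⟨hp, hmin⟩
  refine ⟨subset_convexHull ℝ S hp, fun r hr => ?_⟩
  have h : convexHull ℝ S ⊆ {r | pairing v p ≤ pairingLin v r} :=
    convexHull_min hmin (convex_halfSpace_ge (pairingLin v).isLinear _)
  exact h hr

/-- A convex combination attains the minimum only if each point of nonzero weight does. -/
theorem minFace_subset_convexHull (S : Set ((E → ℝ) × ℝ)) (v : (E → ℝ) × ℝ) :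
    minFace (convexHull ℝ S) v ⊆ convexHull ℝ (minPoints S v) := by
  classical
  rintro r ⟨hr, hmin⟩
  rw [convexHull_eq] at hr
  obtain ⟨ι, t, w, z, hw, hw1, hz, rfl⟩ := hr
  set r := t.centerMass w z with hrdef
  have hr : r = ∑ i ∈ t, w i • z i := Finset.centerMass_eq_of_sum_1 _ _ hw1
  have h0 : ∑ i ∈ t, w i * (pairing v (z i) - pairing v r) = 0 := by
    have : pairing v r = ∑ i ∈ t, w i * pairing v (z i) := by
      rw [← pairingLin_apply v r, hr, map_sum]
      simp [pairingLin_apply]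
    simp only [mul_sub, Finset.sum_sub_distrib, ← Finset.sum_mul, hw1, one_mul]
    rw [← this, sub_self]
  have hS : ∀ i ∈ t, pairing v r ≤ pairing v (z i) := fun i hi =>
    hmin _ (subset_convexHull ℝ S (hz i hi))
  have h1 := (Finset.sum_eq_zero_iff_of_nonneg fun i hi =>
    mul_nonneg (hw i hi) (sub_nonneg.2 (hS i hi))).1 h0
  have h2 : (t.filter (w · ≠ 0)).centerMass w z = r := t.centerMass_filter_ne_zero z
  rw [← h2]
  refine Finset.centerMass_mem_convexHull _ (fun i hi => hw i (Finset.mem_filter.1 hi).1) ?_ ?_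
  · rw [Finset.sum_filter_ne_zero, hw1]
    exact one_pos
  · intro i hi
    obtain ⟨hi, hwi⟩ := Finset.mem_filter.1 hi
    have h3 : pairing v (z i) = pairing v r :=
      sub_eq_zero.1 ((mul_eq_zero.1 (h1 i hi)).resolve_left hwi)
    exact ⟨hz i hi, fun p' hp' => h3 ▸ hmin _ (subset_convexHull ℝ S hp')⟩

theorem finrank_ker_pairingLin (u : E → ℝ) :
    Module.finrank ℝ (LinearMap.ker (pairingLin (u, 1))) = Fintype.card E := by
  have h := (pairingLin (u, (1 : ℝ))).finrank_range_add_finrank_ker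
  have hs : LinearMap.range (pairingLin (u, (1 : ℝ))) = ⊤ := by
    rw [LinearMap.range_eq_top]
    intro c
    exact ⟨(0, c), by simp [pairingLin_apply, pairing]⟩
  rw [hs, finrank_top, Module.finrank_self, Module.finrank_prod, Module.finrank_self,
    Module.finrank_fintype_fun_eq_card] at h
  omega

/-- `(u; 1)` is normal to a lower facet if and only if no nonzero `(a; 0)` is constant on the points
that minimise the product with `(u; 1)`. -/
theorem isNormalToLowerFacet_iff (S : Set ((E → ℝ) × ℝ)) (u : E → ℝ) :
    IsNormalToLowerFacet (convexHull ℝ S) (u, 1) ↔ (minPoints S (u, 1)).Nonempty ∧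
      ∀ a : E → ℝ, (∀ p ∈ minPoints S (u, 1), ∀ q ∈ minPoints S (u, 1),
        ∑ e, a e * p.1 e = ∑ e, a e * q.1 e) → a = 0 := by
  classical
  have hle : vectorSpan ℝ (minFace (convexHull ℝ S) (u, 1)) ≤
      LinearMap.ker (pairingLin (u, (1 : ℝ))) := by
    rw [vectorSpan_def, Submodule.span_le]
    rintro _ ⟨p, hp, q, hq, rfl⟩
    simp only [vsub_eq_sub, SetLike.mem_coe, LinearMap.mem_ker, map_sub, pairingLin_apply]
    exact sub_eq_zero.2 (le_antisymm (hp.2 q hq.1) (hq.2 p hp.1))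
  have hconst : ∀ f : ((E → ℝ) × ℝ) →ₗ[ℝ] ℝ,
      (∀ p ∈ minPoints S (u, 1), ∀ q ∈ minPoints S (u, 1), f p = f q) →
      vectorSpan ℝ (minFace (convexHull ℝ S) (u, 1)) ≤ LinearMap.ker f := by
    intro f hf
    rw [vectorSpan_def, Submodule.span_le]
    rintro _ ⟨p, hp, q, hq, rfl⟩
    simp only [vsub_eq_sub, SetLike.mem_coe, LinearMap.mem_ker, map_sub]
    have hp' := minFace_subset_convexHull S _ hp
    have hq' := minFace_subset_convexHull S _ hq
    obtain ⟨p₀, hp₀⟩ := convexHull_nonempty_iff.1 ⟨p, hp'⟩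
    have h : convexHull ℝ (minPoints S (u, 1)) ⊆ {r | f r = f p₀} :=
      convexHull_min (fun q hq => hf q hq p₀ hp₀) (convex_hyperplane f.isLinear _)
    rw [h hp', h hq', sub_self]
  constructor
  · rintro ⟨-, hne, hfin⟩
    refine ⟨?_, fun a ha => ?_⟩
    · obtain ⟨p, hp⟩ := hne
      exact convexHull_nonempty_iff.1 ⟨p, minFace_subset_convexHull S _ hp⟩
    · have heq := Submodule.eq_of_le_of_finrank_eq hle (hfin.trans (finrank_ker_pairingLin u).symm)
      have h1 := hconst (pairingLin (a, 0)) (by simpa [pairingLin_apply, pairing] using ha)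
      rw [heq] at h1
      funext e
      -- This vector is orthogonal to `(u; 1)` and its product with `(a; 0)` is `a e`.
      have h2 : (Pi.single e 1, - u e) ∈ LinearMap.ker (pairingLin (u, (1 : ℝ))) := by
        simp [LinearMap.mem_ker, pairingLin_apply, pairing, Pi.single_apply]
      simpa [LinearMap.mem_ker, pairingLin_apply, pairing, Pi.single_apply] using h1 h2
  · rintro ⟨hne, ha⟩
    refine ⟨one_pos, hne.mono (minPoints_subset_minFace S _), ?_⟩
    rw [← finrank_ker_pairingLin u]
    refine congrArg (fun W : Submodule ℝ ((E → ℝ) × ℝ) => Module.finrank ℝ W) ?_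
    by_contra hlt
    obtain ⟨x, hx, hxW⟩ := SetLike.exists_of_lt (lt_of_le_of_ne hle hlt)
    -- Otherwise a functional `f` vanishes on the directions of the face but not at `x`. Subtracting
    -- `f (0, 1)` times `(u; 1)` removes its last component without affecting these properties.
    obtain ⟨f, hfx, hfW⟩ := Submodule.exists_le_ker_of_notMem hxW
    have hf : ∀ p : (E → ℝ) × ℝ, f p = ∑ e, (f (Pi.single e 1, 0) - f (0, 1) * u e) * p.1 e +
        f (0, 1) * pairing (u, 1) p := by
      intro p
      have h1 : p = ∑ e, p.1 e • (Pi.single e (1 : ℝ), (0 : ℝ)) + p.2 • ((0 : E → ℝ), (1 : ℝ)) := by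
        ext e
        · simp [Prod.fst_sum, Finset.sum_apply, Pi.single_apply]
        · simp [Prod.snd_sum]
      conv_lhs => rw [h1]
      simp only [map_add, map_sum, map_smul, smul_eq_mul, pairing, sub_mul, Finset.sum_sub_distrib,
        mul_add, Finset.mul_sum]
      rw [show ∑ e, f (0, 1) * (u e * p.1 e) = ∑ e, f (0, 1) * u e * p.1 e from
        Finset.sum_congr rfl fun e _ => by ring, Finset.sum_congr rfl fun e _ => mul_comm (p.1 e) _]
      ring
    have h0 := ha (fun e => f (Pi.single e 1, 0) - f (0, 1) * u e) fun p hp q hq => by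
      have h1 : f p = f q := by
        have := hfW (vsub_mem_vectorSpan ℝ (minPoints_subset_minFace S _ hp)
          (minPoints_subset_minFace S _ hq))
        rw [LinearMap.mem_ker, vsub_eq_sub, map_sub] at this
        exact sub_eq_zero.1 this
      have h2 : pairing (u, 1) p = pairing (u, 1) q := le_antisymm (hp.2 q hq.1) (hq.2 p hp.1)
      rw [hf p, hf q, h2] at h1
      exact add_right_cancel h1
    refine hfx ?_
    rw [hf x]
    have h3 : pairing (u, 1) x = 0 := hx
    have h4 : ∀ e, f (Pi.single e 1, 0) - f (0, 1) * u e = 0 := fun e => congrFun h0 e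
    simp [h3, h4]

end Facets

/-! ### The terms of the Lee-Pomeransky polynomial -/

section Terms

open Classical in
theorem prod_X_eq {E : Type} (s : Finset E) : ∏ e ∈ s, (MvPolynomial.X e : MvPolynomial E ℝ) =
    MvPolynomial.monomial (∑ e ∈ s, Finsupp.single e 1) 1 := by
  rw [MvPolynomial.monomial_sum_one]
  rfl

open Classical in
theorem sum_single_apply {E : Type} (s : Finset E) (e : E) :
    (∑ e ∈ s, Finsupp.single e 1 : E →₀ ℕ) e = if e ∈ s then 1 else 0 := by
  simp [Finsupp.finsetSum_apply, Finsupp.single_apply]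

open Classical in
theorem sum_single_injective {E : Type} {s s' : Finset E}
    (h : (∑ e ∈ s, Finsupp.single e 1 : E →₀ ℕ) = ∑ e ∈ s', Finsupp.single e 1) : s = s' := by
  ext e
  have := DFunLike.congr_fun h e
  rw [sum_single_apply, sum_single_apply] at this
  by_cases h1 : e ∈ s <;> by_cases h2 : e ∈ s' <;> simp_all

theorem not_isSpanningTwoTree {V E : Type} {G : Graph V E} {T : Set E} (h : IsSpanningTree G T) :
    ¬ IsSpanningTwoTree G T := by
  rintro ⟨-, x, hx, y, hy, hxy, -⟩
  exact hxy (h.2.2 x hx y hy)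

variable {V E : Type} [Fintype E] [Nonempty V] {d K L : ℕ}

/-- The terms of the Lee-Pomeransky polynomial: a spanning tree or a spanning 2-tree, with the
exponent of the scaling variable. -/
def terms (G : Graph V E) (att : Leg K L → V) (P : ℝ → Leg K L → Momentum d) :
    Set (Set E × ℕ) :=
  {x | (IsSpanningTree G x.1 ∧ x.2 = 0) ∨ (IsSpanningTwoTree G x.1 ∧
    (fun t => invariant G att (P t) x.1) =Θ[𝓝[>] (0 : ℝ)] (fun t => t ^ x.2))}

/-- The sum of `a` over the complement of `T`. -/
def cosum (a : E → ℝ) (T : Set E) : ℝ := ∑ e, Tᶜ.indicator a e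

theorem not_zero_isTheta (n : ℕ) :
    ¬ (fun _ : ℝ => (0 : ℝ)) =Θ[𝓝[>] (0 : ℝ)] (fun t => t ^ n) := by
  intro h
  have h1 := isTheta_zero_left.1 h
  obtain ⟨t, ht, ht0⟩ := (h1.and self_mem_nhdsWithin).exists
  exact pow_ne_zero n (ne_of_gt ht0) ht

theorem isTheta_neg {f : ℝ → ℝ} {n : ℕ} (h : f =Θ[𝓝[>] (0 : ℝ)] (fun t => t ^ n)) :
    (fun t => - f t) =Θ[𝓝[>] (0 : ℝ)] (fun t => t ^ n) :=
  ⟨h.1.neg_left, h.2.neg_right⟩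

theorem pow_isTheta_pow {m n : ℕ}
    (h : (fun t : ℝ => t ^ m) =Θ[𝓝[>] (0 : ℝ)] (fun t => t ^ n)) : m = n := by
  have key : ∀ m n : ℕ, m < n → ¬ (fun t : ℝ => t ^ m) =Θ[𝓝[>] (0 : ℝ)] (fun t => t ^ n) := by
    intro m n hmn h
    have h1 : (fun t : ℝ => t ^ n) =o[𝓝[>] (0 : ℝ)] fun t => t ^ m :=
      (isLittleO_pow_pow hmn).mono nhdsWithin_le_nhds
    have h2 := h.1.trans_isLittleO h1
    refine isLittleO_irrefl (Eventually.frequently ?_) h2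
    filter_upwards [self_mem_nhdsWithin] with t ht
    exact pow_ne_zero m (ne_of_gt ht)
  rcases lt_trichotomy m n with h1 | h1 | h1
  · exact absurd h (key m n h1)
  · exact h1
  · exact absurd h.symm (key n m h1)

open Classical in
theorem coeff_leePomeransky (G : Graph V E) (att : Leg K L → V) (p : Leg K L → Momentum d)
    (m : E →₀ ℕ) : MvPolynomial.coeff m (leePomeransky G att p) =
      ∑ T : Finset E, if ∑ e ∈ Tᶜ, Finsupp.single e 1 = m then
        ((if IsSpanningTree G (T : Set E) then 1 else 0) -
          if IsSpanningTwoTree G (T : Set E) then invariant G att p (T : Set E) else 0) else 0 := by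
  rw [leePomeransky, symanzikU, symanzikF, MvPolynomial.coeff_add, MvPolynomial.coeff_neg,
    MvPolynomial.coeff_sum, MvPolynomial.coeff_sum, ← sub_eq_add_neg, ← Finset.sum_sub_distrib]
  refine Finset.sum_congr rfl fun T _ => ?_
  by_cases h1 : IsSpanningTree G (T : Set E) <;> by_cases h2 : IsSpanningTwoTree G (T : Set E) <;>
    by_cases h3 : ∑ e ∈ Tᶜ, Finsupp.single e 1 = m <;>
    simp [h1, h2, h3, prod_X_eq, MvPolynomial.coeff_monomial, MvPolynomial.coeff_C_mul]

-- Different edge sets have different square-free monomials, and no set is both a spanning tree and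
-- a spanning 2-tree. So coefficients never combine, and each is `1`, minus an invariant, or `0`.
open Classical in
theorem exponentVectors_eq (G : Graph V E) (att : Leg K L → V) (P : ℝ → Leg K L → Momentum d) :
    exponentVectors (fun t => leePomeransky G att (P t)) =
      (fun x : Set E × ℕ => (((x.1)ᶜ.indicator 1 : E → ℝ), (x.2 : ℝ))) '' terms G att P := by
  have hcoeff : ∀ T : Finset E, ∀ t,
      MvPolynomial.coeff (∑ e ∈ Tᶜ, Finsupp.single e 1) (leePomeransky G att (P t)) =
      ((if IsSpanningTree G (T : Set E) then 1 else 0) -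
          if IsSpanningTwoTree G (T : Set E) then invariant G att (P t) (T : Set E) else 0) := by
    intro T t
    rw [coeff_leePomeransky, Finset.sum_eq_single T]
    · rw [if_pos rfl]
    · intro T' _ hT'
      exact if_neg fun h => hT' (compl_injective (sum_single_injective h))
    · simp
  have hvec : ∀ T : Finset E, (fun e => (((∑ e ∈ Tᶜ, Finsupp.single e 1 : E →₀ ℕ) e : ℕ) : ℝ)) =
      ((T : Set E)ᶜ.indicator 1 : E → ℝ) := by
    intro T
    funext e
    rw [sum_single_apply]
    by_cases he : e ∈ T <;> simp [he]
  ext r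
  constructor
  · rintro ⟨m, n, hmn, rfl⟩
    by_cases hm : ∃ T : Finset E, ∑ e ∈ Tᶜ, Finsupp.single e 1 = m
    · obtain ⟨T, rfl⟩ := hm
      refine ⟨((T : Set E), n), ?_, by simp only [hvec]⟩
      simp only [hcoeff] at hmn
      by_cases h1 : IsSpanningTree G (T : Set E)
      · left
        refine ⟨h1, ?_⟩
        simp only [h1, not_isSpanningTwoTree h1, if_true, if_false, sub_zero] at hmn
        exact (pow_isTheta_pow (m := 0) (by simpa using hmn)).symm
      · by_cases h2 : IsSpanningTwoTree G (T : Set E)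
        · right
          simp only [h1, h2, if_true, if_false, zero_sub] at hmn
          exact ⟨h2, by simpa only [neg_neg] using isTheta_neg hmn⟩
        · simp only [h1, h2, if_false, sub_zero] at hmn
          exact absurd hmn (not_zero_isTheta n)
    · refine absurd ?_ (not_zero_isTheta n)
      convert hmn using 2 with t
      rw [coeff_leePomeransky, Finset.sum_eq_zero]
      exact fun T _ => if_neg fun h => hm ⟨T, h⟩
  · rintro ⟨⟨T, n⟩, hT, rfl⟩
    obtain ⟨T, rfl⟩ : ∃ T' : Finset E, (T' : Set E) = T := ⟨(Set.toFinite T).toFinset, by simp⟩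
    refine ⟨∑ e ∈ Tᶜ, Finsupp.single e 1, n, ?_, by rw [hvec]⟩
    simp only [hcoeff]
    obtain ⟨h1, h2⟩ | ⟨h1, h2⟩ := hT
    · simp only at h1 h2
      simp only [h1, not_isSpanningTwoTree h1, h2, if_true, if_false, sub_zero, pow_zero]
      exact isTheta_rfl
    · simp only at h1 h2
      have h3 : ¬ IsSpanningTree G (T : Set E) := fun h => not_isSpanningTwoTree h h1
      simp only [h1, h3, if_true, if_false, zero_sub]
      exact isTheta_neg h2

/-- The terms of minimal weight. -/
def minTerms (G : Graph V E) (att : Leg K L → V) (P : ℝ → Leg K L → Momentum d) (u : E → ℝ) :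
    Set (Set E × ℕ) :=
  {x ∈ terms G att P | ∀ y ∈ terms G att P, cosum u x.1 + x.2 ≤ cosum u y.1 + y.2}

/-- The geometry of the polytope is thereby replaced by a uniqueness statement about linear forms on
edges. Only forms with last component `0` need testing, because `(u; 1)` itself takes one value on
the minimal points. -/
theorem isNormalToLowerFacet_newtonPolytope_iff (G : Graph V E) (att : Leg K L → V)
    (P : ℝ → Leg K L → Momentum d) (u : E → ℝ) :
    IsNormalToLowerFacet (newtonPolytope fun t => leePomeransky G att (P t)) (u, 1) ↔
      (minTerms G att P u).Nonempty ∧ ∀ a : E → ℝ, (∀ x ∈ minTerms G att P u,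
        ∀ y ∈ minTerms G att P u, cosum a x.1 = cosum a y.1) → a = 0 := by
  have hsum : ∀ (a : E → ℝ) (T : Set E), ∑ e, a e * (Tᶜ.indicator 1 e : ℝ) = cosum a T := by
    intro a T
    refine Finset.sum_congr rfl fun e _ => ?_
    by_cases he : e ∈ T <;> simp [he]
  have hmin : minPoints (exponentVectors fun t => leePomeransky G att (P t)) (u, 1) =
      (fun x : Set E × ℕ => (((x.1)ᶜ.indicator 1 : E → ℝ), (x.2 : ℝ))) '' minTerms G att P u := by
    rw [exponentVectors_eq]
    ext r
    constructor
    · rintro ⟨⟨x, hx, rfl⟩, h⟩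
      refine ⟨x, ⟨hx, fun y hy => ?_⟩, rfl⟩
      simpa [pairing, hsum] using h _ ⟨y, hy, rfl⟩
    · rintro ⟨x, ⟨hx, h⟩, rfl⟩
      refine ⟨⟨x, hx, rfl⟩, ?_⟩
      rintro _ ⟨y, hy, rfl⟩
      simpa [pairing, hsum] using h y hy
  rw [newtonPolytope, isNormalToLowerFacet_iff, hmin, Set.image_nonempty]
  refine and_congr_right fun _ => forall_congr' fun a => imp_congr_left ?_
  simp only [Set.forall_mem_image, hsum]

end Terms

/-! ### Kinematics -/

section Kinematics

variable {d K L : ℕ}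

theorem mdot_add_left (k l m : Momentum d) : mdot (k + l) m = mdot k m + mdot l m := by
  simp only [mdot, Pi.add_apply, add_mul, Finset.sum_add_distrib]
  ring

theorem mdot_comm (k l : Momentum d) : mdot k l = mdot l k := by
  simp only [mdot, mul_comm]

theorem mdot_smul_left (c : ℝ) (k l : Momentum d) : mdot (c • k) l = c * mdot k l := by
  simp only [mdot, Pi.smul_apply, smul_eq_mul, mul_sub, Finset.mul_sum, mul_assoc]

theorem mdot_smul_right (c : ℝ) (k l : Momentum d) : mdot k (c • l) = c * mdot k l := by
  rw [mdot_comm, mdot_smul_left, mdot_comm]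

theorem mdot_add_right (k l m : Momentum d) : mdot k (l + m) = mdot k l + mdot k m := by
  rw [mdot_comm, mdot_add_left, mdot_comm l, mdot_comm m]

theorem mdot_neg_neg (k : Momentum d) : mdot (-k) (-k) = mdot k k := by
  simp [mdot]

theorem mdot_zero_left (k : Momentum d) : mdot 0 k = 0 := by
  simp [mdot]

theorem not_isBigO_id {f : ℝ → ℝ} (h : f =Θ[𝓝[>] (0 : ℝ)] (fun _ => (1 : ℝ))) :
    ¬ f =O[𝓝[>] (0 : ℝ)] (fun t => t) := by
  intro h'
  have h1 : (fun _ : ℝ => (1 : ℝ)) =O[𝓝[>] (0 : ℝ)] (fun t : ℝ => t) := h.2.trans h'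
  have h2 : (fun t : ℝ => t) =o[𝓝[>] (0 : ℝ)] (fun _ : ℝ => (1 : ℝ)) := by
    rw [isLittleO_one_iff]
    exact tendsto_id.mono_left nhdsWithin_le_nhds
  refine isLittleO_irrefl (Eventually.frequently ?_) (h1.trans_isLittleO h2)
  exact Eventually.of_forall fun _ => one_ne_zero

/-- The sets of external lines whose total momentum is zero or nearly on-shell. -/
def Exceptional (A : Set (Leg K L)) : Prop := A = ∅ ∨ ∃ i : Fin K, A = {Sum.inl i}

theorem not_exceptional_of_inr {A : Set (Leg K L)} {j : Fin L} (h : Sum.inr j ∈ A) :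
    ¬ Exceptional A := by
  rintro (rfl | ⟨i, rfl⟩)
  · exact h
  · simp at h

theorem not_exceptional_of_ne {A : Set (Leg K L)} {l l' : Leg K L} (h : l ∈ A) (h' : l' ∈ A)
    (hne : l ≠ l') : ¬ Exceptional A := by
  rintro (rfl | ⟨i, rfl⟩)
  · exact h
  · exact hne (h.trans h'.symm)

/-- The usable form of non-exceptionality: a witness consisting of one off-shell line or two nearly
on-shell ones. It makes monotonicity evident. -/
theorem not_exceptional_cases {A : Set (Leg K L)} (h : ¬ Exceptional A) :
    (∃ j, Sum.inr j ∈ A) ∨ ∃ i i' : Fin K, i ≠ i' ∧ Sum.inl i ∈ A ∧ Sum.inl i' ∈ A := by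
  rw [Exceptional, not_or, ← Ne, ← Set.nonempty_iff_ne_empty] at h
  obtain ⟨⟨l, hl⟩, h2⟩ := h
  by_contra hcon
  push Not at hcon
  rcases l with i | j
  · refine h2 ⟨i, Set.Subset.antisymm ?_ (by simpa using hl)⟩
    rintro (i' | j) h'
    · by_contra hne
      exact hcon.2 i i' (fun h => hne (by simp [h])) hl h'
    · exact absurd h' (hcon.1 j)
  · exact hcon.1 j hl

theorem not_exceptional_mono {A B : Set (Leg K L)} (h : ¬ Exceptional A) (hAB : A ⊆ B) :
    ¬ Exceptional B := by
  obtain ⟨j, hj⟩ | ⟨i, i', hne, hi, hi'⟩ := not_exceptional_cases h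
  · exact not_exceptional_of_inr (hAB hj)
  · exact not_exceptional_of_ne (hAB hi) (hAB hi') (by simpa using hne)

open Classical in
/-- The total momentum of a set of external lines. -/
def legSum (p : Leg K L → Momentum d) (A : Set (Leg K L)) : Momentum d :=
  ∑ l, if l ∈ A then p l else 0

theorem legSum_empty (p : Leg K L → Momentum d) : legSum p ∅ = 0 := by
  simp [legSum]

theorem legSum_singleton (p : Leg K L → Momentum d) (l : Leg K L) : legSum p {l} = p l := by
  simp [legSum]

theorem legSum_compl {P : ℝ → Leg K L → Momentum d} (hP : IsWideAngle P) (t : ℝ)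
    (A : Set (Leg K L)) : legSum (P t) Aᶜ = - legSum (P t) A := by
  rw [eq_neg_iff_add_eq_zero, ← hP.conservation t, legSum, legSum, ← Finset.sum_add_distrib]
  refine Finset.sum_congr rfl fun l _ => ?_
  by_cases h : l ∈ A <;> simp [h]

namespace IsWideAngle

variable {P : ℝ → Leg K L → Momentum d} (hP : IsWideAngle P)

include hP

theorem sq_compl (A : Set (Leg K L)) (t : ℝ) : mdot (legSum (P t) Aᶜ) (legSum (P t) Aᶜ) =
    mdot (legSum (P t) A) (legSum (P t) A) := by
  rw [legSum_compl hP, mdot_neg_neg]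

/-- In the remaining cases momentum conservation contradicts the scaling: the only line has zero
momentum; `q = -p`; `p_1·p_2 = -p_1²`; or, for three on-shell lines, `2 p_1·p_2 = p_3² - p_1² -
p_2²`, which would be of order `t`. -/
theorem card_cases : 2 ≤ L ∨ (L = 1 ∧ 2 ≤ K) ∨ (L = 0 ∧ 4 ≤ K) := by
  by_contra hcon
  have hL : L = 0 ∨ L = 1 := by omega
  rcases hL with rfl | rfl
  · have hK : K = 1 ∨ K = 2 ∨ K = 3 := by
      have := hP.legs
      omega
    rcases hK with rfl | rfl | rfl
    · refine not_zero_isTheta 1 ?_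
      convert hP.on_shell 0 using 2 with t
      · have h0 := hP.conservation t
        simp only [Fintype.sum_sum_type, Finset.univ_unique, Finset.sum_singleton,
          Finset.univ_eq_empty, Finset.sum_empty, add_zero] at h0
        rw [show P t (Sum.inl 0) = 0 from h0, mdot_zero_left]
      · simp
    · refine not_isBigO_id (hP.wide_angle 0 1 (by simp)) ?_
      refine IsBigO.congr_left (hP.on_shell 0).1.neg_left fun t => ?_
      have h0 := hP.conservation t
      simp only [Fintype.sum_sum_type, Fin.sum_univ_two, Finset.univ_eq_empty, Finset.sum_empty,
        add_zero] at h0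
      have h1 := congrArg (fun k => mdot (P t (Sum.inl 0)) k) h0
      simp only [mdot_add_right] at h1
      rw [mdot_comm _ 0, mdot_zero_left] at h1
      linarith
    · refine not_isBigO_id (hP.wide_angle 0 1 (by simp)) ?_
      refine IsBigO.congr_left ((((hP.on_shell 2).1.sub (hP.on_shell 0).1).sub
        (hP.on_shell 1).1).const_mul_left (1 / 2)) fun t => ?_
      have h0 := hP.conservation t
      simp only [Fintype.sum_sum_type, Fin.sum_univ_three, Finset.univ_eq_empty, Finset.sum_empty,
        add_zero] at h0
      have h2 : P t (Sum.inl 2) = - (P t (Sum.inl 0) + P t (Sum.inl 1)) :=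
        (neg_eq_of_add_eq_zero_right h0).symm
      rw [h2, mdot_neg_neg]
      simp only [mdot_add_right, mdot_add_left]
      rw [mdot_comm (P t (Sum.inl 1)) (P t (Sum.inl 0))]
      ring
  · have hK : K = 0 ∨ K = 1 := by omega
    rcases hK with rfl | rfl
    · refine not_zero_isTheta 0 ?_
      convert hP.off_shell 0 using 2 with t
      · have h0 := hP.conservation t
        simp only [Fintype.sum_sum_type, Finset.univ_unique, Finset.sum_singleton,
          Finset.univ_eq_empty, Finset.sum_empty, zero_add] at h0
        rw [show P t (Sum.inr 0) = 0 from h0, mdot_zero_left]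
      · simp
    · refine not_isBigO_id (hP.off_shell 0) ?_
      refine IsBigO.congr_left (hP.on_shell 0).1 fun t => ?_
      have h0 := hP.conservation t
      simp only [Fintype.sum_sum_type, Finset.univ_unique, Finset.sum_singleton] at h0
      have h2 : P t (Sum.inr 0) = - P t (Sum.inl 0) := (neg_eq_of_add_eq_zero_right h0).symm
      rw [h2, mdot_neg_neg]

theorem sq_isTheta_one {A : Set (Leg K L)} (h : ¬ Exceptional A) (h' : ¬ Exceptional Aᶜ) :
    (fun t => mdot (legSum (P t) A) (legSum (P t) A)) =Θ[𝓝[>] (0 : ℝ)] (fun _ => (1 : ℝ)) := by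
  classical
  have key : ∀ t, legSum (P t) A = ∑ l ∈ A.toFinset, P t l := by
    intro t
    rw [legSum, ← Finset.sum_filter]
    refine Finset.sum_congr ?_ fun _ _ => rfl
    ext l
    simp
  simp only [key]
  simp only [Exceptional, not_or, not_exists] at h h'
  refine hP.non_exceptional A.toFinset ?_ ?_ ?_ ?_
  · rw [Set.toFinset_nonempty]
    exact Set.nonempty_iff_ne_empty.2 h.1
  · rw [← Set.toFinset_compl, Set.toFinset_nonempty]
    exact Set.nonempty_iff_ne_empty.2 h'.1
  · intro i hi
    exact h.2 i (by rw [← Set.coe_toFinset A, hi, Finset.coe_singleton])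
  · intro i hi
    rw [← Set.toFinset_compl] at hi
    exact h'.2 i (by rw [← Set.coe_toFinset Aᶜ, hi, Finset.coe_singleton])

theorem sq_isTheta_id {A : Set (Leg K L)} {i : Fin K} (h : A = {Sum.inl i} ∨ Aᶜ = {Sum.inl i}) :
    (fun t => mdot (legSum (P t) A) (legSum (P t) A)) =Θ[𝓝[>] (0 : ℝ)] (fun t => t) := by
  obtain rfl | h := h
  · simp only [legSum_singleton]
    exact hP.on_shell i
  · simp only [← hP.sq_compl A, h, legSum_singleton]
    exact hP.on_shell i

theorem nonempty_of_isTheta {A : Set (Leg K L)} {n : ℕ}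
    (h : (fun t => mdot (legSum (P t) A) (legSum (P t) A)) =Θ[𝓝[>] (0 : ℝ)] (fun t => t ^ n)) :
    A.Nonempty ∧ Aᶜ.Nonempty := by
  constructor
  · by_contra hA
    rw [Set.not_nonempty_iff_eq_empty] at hA
    refine not_zero_isTheta n ?_
    simpa only [hA, legSum_empty, mdot_zero_left] using h
  · by_contra hA
    rw [Set.not_nonempty_iff_eq_empty] at hA
    refine not_zero_isTheta n ?_
    simpa only [← hP.sq_compl A, hA, legSum_empty, mdot_zero_left] using h

/-- The empty sum has square zero and a single `p_i` has square of order `t`, so neither side can be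
exceptional; with `sq_isTheta_one` this characterises the invariants of order one. -/
theorem not_exceptional_of_isTheta {A : Set (Leg K L)}
    (h : (fun t => mdot (legSum (P t) A) (legSum (P t) A)) =Θ[𝓝[>] (0 : ℝ)]
      (fun _ => (1 : ℝ))) : ¬ Exceptional A ∧ ¬ Exceptional Aᶜ := by
  have h1 := hP.nonempty_of_isTheta (n := 0) (by simpa using h)
  constructor
  · rintro (hA | ⟨i, hA⟩)
    · exact h1.1.ne_empty hA
    · exact not_isBigO_id h (hP.sq_isTheta_id (Or.inl hA)).1
  · rintro (hA | ⟨i, hA⟩)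
    · exact h1.2.ne_empty hA
    · exact not_isBigO_id h (hP.sq_isTheta_id (Or.inr hA)).1

/-- The complement of one off-shell line is not exceptional. -/
theorem not_exceptional_compl_inr (j : Fin L) :
    ¬ Exceptional ({Sum.inr j}ᶜ : Set (Leg K L)) := by
  obtain h | ⟨h, h2⟩ | ⟨h, -⟩ := hP.card_cases
  · have : Nontrivial (Fin L) := Fin.nontrivial_iff_two_le.2 h
    obtain ⟨j', hj'⟩ := exists_ne j
    exact not_exceptional_of_inr (j := j') (by simpa using hj')
  · have : Nontrivial (Fin K) := Fin.nontrivial_iff_two_le.2 h2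
    obtain ⟨i, i', hii'⟩ := exists_pair_ne (Fin K)
    exact not_exceptional_of_ne (l := Sum.inl i) (l' := Sum.inl i') (by simp) (by simp)
      (by simpa using hii')
  · subst h
    exact j.elim0

/-- The complement of two nearly on-shell lines is not exceptional. -/
theorem not_exceptional_compl_pair (i j : Fin K) :
    ¬ Exceptional ({Sum.inl i, Sum.inl j}ᶜ : Set (Leg K L)) := by
  by_cases hL : 0 < L
  · exact not_exceptional_of_inr (j := ⟨0, hL⟩) (by simp)
  · have hK : 4 ≤ K := by
      have := hP.card_cases
      omega
    obtain ⟨k, hk⟩ : ∃ k, k ∉ ({i, j} : Finset (Fin K)) := by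
      by_contra hcon
      push Not at hcon
      have h1 := Finset.card_le_card (Finset.subset_iff.2 fun k (_ : k ∈ Finset.univ) => hcon k)
      have h2 := Finset.card_le_two (a := i) (b := j)
      rw [Finset.card_univ, Fintype.card_fin] at h1
      omega
    obtain ⟨l, hl⟩ : ∃ l, l ∉ ({i, j, k} : Finset (Fin K)) := by
      by_contra hcon
      push Not at hcon
      have h1 := Finset.card_le_card (Finset.subset_iff.2 fun k (_ : k ∈ Finset.univ) => hcon k)
      have h2 := Finset.card_le_three (a := i) (b := j) (c := k)
      rw [Finset.card_univ, Fintype.card_fin] at h1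
      omega
    simp only [Finset.mem_insert, Finset.mem_singleton, not_or] at hk hl
    exact not_exceptional_of_ne (l := Sum.inl k) (l' := Sum.inl l) (by simpa using hk)
      (by simpa using ⟨hl.1, hl.2.1⟩) (by simpa using Ne.symm hl.2.2)

/-- If the lines that may be on either side are not exceptional, they can be distributed such that
the invariant is of order one. -/
theorem exists_distribution {A B : Set (Leg K L)} (hA : ¬ Exceptional A) (hB : ¬ Exceptional B)
    (hAB : ∀ l, l ∈ A ∨ l ∈ B) (hq₀ : ∀ j : Fin L, Sum.inr j ∈ A → Sum.inr j ∉ B) :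
    ∃ C ⊆ A, Cᶜ ⊆ B ∧ ¬ Exceptional C ∧ ¬ Exceptional Cᶜ := by
  classical
  -- When all off-shell lines lie in `A`, that side keeps one of them, while the complement receives
  -- two on-shell lines that `B` must possess.
  have key : ∀ A B : Set (Leg K L), ¬ Exceptional B → (∀ l, l ∈ A ∨ l ∈ B) →
      (∀ j : Fin L, Sum.inr j ∉ B) → (∃ j : Fin L, Sum.inr j ∈ A) →
      ∃ C ⊆ A, Cᶜ ⊆ B ∧ ¬ Exceptional C ∧ ¬ Exceptional Cᶜ := by
    rintro A B hB hAB hBq ⟨q, hq⟩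
    obtain ⟨j, hj⟩ | ⟨i, i', hne, hi, hi'⟩ := not_exceptional_cases hB
    · exact absurd hj (hBq j)
    · refine ⟨A \ {Sum.inl i, Sum.inl i'}, Set.sdiff_subset, ?_,
        not_exceptional_of_inr (j := q) (by simp [hq]),
        not_exceptional_of_ne (l := Sum.inl i) (l' := Sum.inl i') (by simp) (by simp)
          (by simpa using hne)⟩
      intro l hl
      by_contra hlB
      refine hl ⟨(hAB l).resolve_right hlB, ?_⟩
      rintro (rfl | rfl)
      · exact hlB hi
      · exact hlB hi'
  by_cases hAq : ∃ j : Fin L, Sum.inr j ∈ A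
  · by_cases hBq : ∃ j : Fin L, Sum.inr j ∈ B
    · obtain ⟨q, hq⟩ := hAq
      obtain ⟨q', hq'⟩ := hBq
      by_cases hqq : q = q'
      · subst hqq
        exact absurd hq' (hq₀ q hq)
      · refine ⟨A \ {Sum.inr q'}, Set.sdiff_subset, ?_,
          not_exceptional_of_inr (j := q) (by simp [hq, hqq]),
          not_exceptional_of_inr (j := q') (by simp)⟩
        intro l hl
        by_contra hlB
        refine hl ⟨(hAB l).resolve_right hlB, ?_⟩
        rintro rfl
        exact hlB hq'
    · push Not at hBq
      exact key A B hB hAB hBq hAq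
  · push Not at hAq
    by_cases hBq : ∃ j : Fin L, Sum.inr j ∈ B
    · obtain ⟨C, h1, h2, h3, h4⟩ := key B A hA (fun l => (hAB l).symm) hAq hBq
      exact ⟨Cᶜ, h2, by rwa [compl_compl], h4, by rwa [compl_compl]⟩
    · push Not at hBq
      have hL : ∀ j : Fin L, False := fun j => (hAB (Sum.inr j)).elim (hAq j) (hBq j)
      have hL0 : L = 0 := by
        by_contra h
        exact hL ⟨0, Nat.pos_of_ne_zero h⟩
      have hK : 4 ≤ K := by
        have := hP.card_cases
        omega
      have hcard : ∀ X : Set (Leg K L), 2 ≤ X.toFinset.card → ¬ Exceptional X := by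
        intro X hX
        obtain ⟨l, hl, l', hl', hne⟩ := Finset.one_lt_card.1 (show 1 < X.toFinset.card by omega)
        exact not_exceptional_of_ne (by simpa using hl) (by simpa using hl') hne
      have hcard' : ∀ X : Set (Leg K L), ¬ Exceptional X → 2 ≤ X.toFinset.card := by
        intro X hX
        obtain ⟨j, -⟩ | ⟨i, i', hne, hi, hi'⟩ := not_exceptional_cases hX
        · exact (hL j).elim
        · exact Finset.one_lt_card.2 ⟨Sum.inl i, by simpa using hi, Sum.inl i', by simpa using hi',
            by simpa using hne⟩
      have htot : Fintype.card (Leg K L) = K := by simp [hL0]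
      have hcompl : ∀ X : Finset (Leg K L), X.card + Xᶜ.card = K := fun X => by
        rw [Finset.card_add_card_compl, htot]
      have hA2 := hcard' A hA
      have hB2 := hcard' B hB
      have hsub : B.toFinsetᶜ ⊆ A.toFinset := by
        intro l hl
        simp only [Finset.mem_compl, Set.mem_toFinset] at hl ⊢
        exact (hAB l).resolve_right hl
      have h1 := hcompl B.toFinset
      -- With on-shell lines only, non-exceptional means at least two elements. The complement of
      -- this `C` has `min (K - 2) |B|` elements, which is at least 2 because `K ≥ 4`.
      obtain ⟨C, hC1, hC2, hC3⟩ := Finset.exists_subsuperset_card_eq (n := max 2 (B.toFinsetᶜ).card)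
        hsub (le_max_right _ _) (max_le hA2 (Finset.card_le_card hsub))
      have h2 := hcompl C
      refine ⟨C, ?_, ?_, hcard _ ?_, hcard _ ?_⟩
      · intro l hl
        simpa using hC2 hl
      · intro l hl
        by_contra hlB
        exact hl (hC1 (by simpa using hlB))
      · rw [Finset.toFinset_coe]
        omega
      · rw [Set.toFinset_compl, Finset.toFinset_coe]
        omega

end IsWideAngle

end Kinematics

/-! ### Hard, jet and soft subgraphs -/

section Setup

variable {V E : Type} {d K L : ℕ}

/-- The hypotheses of the main theorem. -/
structure Setup (G : Graph V E) (att : Leg K L → V) (P : ℝ → Leg K L → Momentum d)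
    (mode : E → Mode K) : Prop where
  vertexSet : V(G) = Set.univ
  edgeSet : E(G) = Set.univ
  conn : IsConn G
  wide : IsWideAngle P
  config : IsConfiguration G att mode

/-- The hard edges. -/
abbrev hardE (mode : E → Mode K) : Set E := edgesOf mode Mode.hard

/-- The edges of the jet `i`. -/
abbrev jetE (mode : E → Mode K) (i : Fin K) : Set E := edgesOf mode (Mode.jet i)

/-- The hard and the jet edges. -/
def nonsoftE (mode : E → Mode K) : Set E := {e | mode e ≠ Mode.soft}

/-- The edges of the jet `i` that end at vertices of the jet only. -/
def innerJetE (G : Graph V E) (att : Leg K L → V) (mode : E → Mode K) (i : Fin K) : Set E :=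
  {g | mode g = Mode.jet i ∧ ∀ z, G.Inc g z → z ∈ jetVerts G att mode i}

theorem hardE_subset (mode : E → Mode K) : hardE mode ⊆ nonsoftE mode := by
  intro e he
  simp only [edgesOf, Set.mem_ofPred_eq, nonsoftE] at he ⊢
  simp [he]

theorem jetE_subset (mode : E → Mode K) (i : Fin K) : jetE mode i ⊆ nonsoftE mode := by
  intro e he
  simp only [edgesOf, Set.mem_ofPred_eq, nonsoftE] at he ⊢
  simp [he]

theorem mem_nonsoftE_cases {mode : E → Mode K} {e : E} (h : e ∈ nonsoftE mode) :
    e ∈ hardE mode ∨ ∃ i, e ∈ jetE mode i := by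
  simp only [edgesOf, Set.mem_ofPred_eq, nonsoftE] at h ⊢
  rcases hm : mode e with _ | i | _
  · exact Or.inl rfl
  · exact Or.inr ⟨i, rfl⟩
  · exact absurd hm h

theorem not_mem_hardE_of_jet {mode : E → Mode K} {e : E} {i : Fin K} (h : e ∈ jetE mode i) :
    e ∉ hardE mode := by
  simp only [edgesOf, Set.mem_ofPred_eq] at h ⊢
  simp [h]

theorem jetE_inj {mode : E → Mode K} {e : E} {i j : Fin K} (h : e ∈ jetE mode i)
    (h' : e ∈ jetE mode j) : i = j := by
  simp only [edgesOf, Set.mem_ofPred_eq] at h h'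
  simpa [h] using h'

namespace Setup

variable {G : Graph V E} {att : Leg K L → V} {P : ℝ → Leg K L → Momentum d} {mode : E → Mode K}
variable (S : Setup G att P mode)

include S

theorem mem_vertexSet (x : V) : x ∈ V(G) := by
  rw [S.vertexSet]
  trivial

theorem mem_edgeSet (e : E) : e ∈ E(G) := by
  rw [S.edgeSet]
  trivial

theorem exists_isLink (e : E) : ∃ x y, G.IsLink e x y :=
  G.exists_isLink_of_mem_edgeSet (S.mem_edgeSet e)

theorem dl_mem (x y : V) : dl x y ∈ spn (bvec G) Set.univ :=
  ((isConn_iff G).1 S.conn).2 x (S.mem_vertexSet x) y (S.mem_vertexSet y)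

omit S in
theorem not_mem_soft_of_inc {e : E} {x : V} (he : e ∈ nonsoftE mode) (h : G.Inc e x) :
    x ∉ softVerts G att mode := fun hx => he (hx.2.1 e h)

theorem mem_hard_of_inc {e : E} {x : V} (he : e ∈ hardE mode) (h : G.Inc e x) :
    x ∈ hardVerts G att mode := by
  have he' : mode e = Mode.hard := he
  refine ⟨S.mem_vertexSet x, not_mem_soft_of_inc (hardE_subset mode he) h, fun i hi => ?_⟩
  have := hi.2.2.1 e h
  simp [he'] at this

theorem mem_of_inc_jet {e : E} {x : V} {i : Fin K} (he : e ∈ jetE mode i) (h : G.Inc e x) :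
    x ∈ hardVerts G att mode ∨ x ∈ jetVerts G att mode i := by
  by_cases hx : x ∈ jetVerts G att mode i
  · exact Or.inr hx
  · refine Or.inl ⟨S.mem_vertexSet x, not_mem_soft_of_inc (jetE_subset mode i he) h,
      fun k hk => ?_⟩
    have he' : mode e = Mode.jet i := he
    have := hk.2.2.1 e h
    simp only [he', Mode.jet.injEq, reduceCtorEq, or_false] at this
    exact hx (this ▸ hk)

omit S in
theorem jetVerts_inj {x : V} {i j : Fin K} (hi : x ∈ jetVerts G att mode i)
    (hj : x ∈ jetVerts G att mode j) : i = j := by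
  obtain ⟨e, he, hei⟩ := hi.2.1
  have := hj.2.2.1 e he
  simpa [hei] using this

omit S in
theorem not_mem_hard_of_jet {x : V} {i : Fin K} (hi : x ∈ jetVerts G att mode i) :
    x ∉ hardVerts G att mode := fun h => h.2.2 i hi

theorem not_mem_soft_cases {x : V} (hx : x ∉ softVerts G att mode) :
    x ∈ hardVerts G att mode ∨ ∃ i, x ∈ jetVerts G att mode i := by
  by_contra hcon
  push Not at hcon
  exact hcon.1 ⟨S.mem_vertexSet x, hx, hcon.2⟩

omit S in
theorem jetE_of_inc_jetVerts {e : E} {x : V} {i : Fin K} (he : e ∈ nonsoftE mode)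
    (h : G.Inc e x) (hx : x ∈ jetVerts G att mode i) : e ∈ jetE mode i :=
  (hx.2.2.1 e h).resolve_right he

theorem bvec_hardGraph {e : E} (he : e ∈ hardE mode) :
    bvec (hardGraph G att mode) e = bvec G e := by
  obtain ⟨x, y, hxy⟩ := S.exists_isLink e
  rw [bvec_eq hxy]
  refine bvec_eq ?_
  simp only [hardGraph, Graph.induce_isLink, Graph.restrict_isLink]
  exact ⟨by simp [he, hxy], S.mem_hard_of_inc he hxy.inc_left, S.mem_hard_of_inc he hxy.inc_right⟩

theorem edgeSet_hardGraph : E(hardGraph G att mode) = hardE mode := by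
  ext e
  simp only [hardGraph, Graph.edgeSet_induce, Graph.restrict_isLink, Set.mem_ofPred_eq]
  constructor
  · rintro ⟨x, y, h, -, -⟩
    tauto
  · intro he
    obtain ⟨x, y, hxy⟩ := S.exists_isLink e
    exact ⟨x, y, by simp [he, hxy], S.mem_hard_of_inc he hxy.inc_left,
      S.mem_hard_of_inc he hxy.inc_right⟩

/-- The span of hard edges in `H` is their span in `G`. -/
theorem spn_hardGraph (X : Set E) :
    spn (bvec (hardGraph G att mode)) X = spn (bvec G) (X ∩ hardE mode) := by
  apply le_antisymm
  · refine spn_le _ fun e he => ?_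
    by_cases h : e ∈ hardE mode
    · rw [S.bvec_hardGraph h]
      exact mem_spn _ ⟨he, h⟩
    · rw [bvec_of_notMem (by rwa [S.edgeSet_hardGraph])]
      exact Submodule.zero_mem _
  · refine spn_le _ fun e he => ?_
    rw [← S.bvec_hardGraph he.2]
    exact mem_spn _ he.1

theorem dl_mem_hard {x y : V} (hx : x ∈ hardVerts G att mode) (hy : y ∈ hardVerts G att mode) :
    dl x y ∈ spn (bvec G) (hardE mode) := by
  have := ((isConn_iff _).1 S.config.hard_connected).2 x hx y hy
  rwa [S.spn_hardGraph, Set.univ_inter] at this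

/-- A jet is connected through its own vertices, so the path can be chosen without any edge reaching
`H`. Cutting the links between a jet and `H` thus leaves the jet in one piece. -/
theorem dl_mem_innerJet {x y : V} {i : Fin K} (hx : x ∈ jetVerts G att mode i)
    (hy : y ∈ jetVerts G att mode i) : dl x y ∈ spn (bvec G) (innerJetE G att mode i) := by
  obtain ⟨e, hex, he⟩ := hx.2.1
  obtain ⟨f, hfy, hf⟩ := hy.2.1
  refine spn_mono _ ?_ (EdgeLinked.dl_mem (X := jetE mode i) subset_rfl he
    (S.config.jet_connected i e he f hf) hex hx hfy hy)
  exact fun g hg => ⟨hg.1, hg.2.2⟩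

omit S in
theorem innerJetE_subset (i : Fin K) : innerJetE G att mode i ⊆ jetE mode i := fun _ h => h.1

theorem att_mem_jet {i : Fin K} (h : (jetE mode i).Nonempty) :
    att (Sum.inl i) ∈ jetVerts G att mode i := (S.config.jet_external i h _).2 rfl

omit S in
theorem eq_of_att_mem_jet {i : Fin K} {l : Leg K L} (h : att l ∈ jetVerts G att mode i) :
    l = Sum.inl i := h.2.2.2 l rfl

/-- A jet edge that ends at a hard vertex has its other end in the jet. -/
theorem jet_isLink_of_inc_hard {e : E} {i : Fin K} (he : e ∈ jetE mode i) {w : V}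
    (hw : w ∈ hardVerts G att mode) (hew : G.Inc e w) :
    ∃ x ∈ jetVerts G att mode i, G.IsLink e x w := by
  obtain ⟨y, hy⟩ := hew
  have hp := S.att_mem_jet ⟨e, he⟩
  obtain ⟨f, hfp, hf⟩ := hp.2.1
  obtain ⟨u, hu, heu⟩ : ∃ u ∈ jetVerts G att mode i, G.Inc e u := by
    obtain rfl | ⟨g, ⟨-, -, u, hu, h1, -⟩, -⟩ :=
      Relation.ReflTransGen.cases_head (S.config.jet_connected i e he f hf)
    · exact ⟨_, hp, hfp⟩
    · exact ⟨u, hu, h1⟩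
  obtain rfl | rfl := heu.eq_or_eq_of_isLink hy
  · exact absurd hw (not_mem_hard_of_jet hu)
  · exact ⟨u, hu, hy.symm⟩

theorem exists_jet_isLink_hard {i : Fin K} (h : (jetE mode i).Nonempty) :
    ∃ e ∈ jetE mode i, ∃ x ∈ jetVerts G att mode i, ∃ w ∈ hardVerts G att mode,
      G.IsLink e x w := by
  obtain ⟨e, he, w, hw, hew⟩ := S.config.jet_attached i h
  obtain ⟨x, hx, hxw⟩ := S.jet_isLink_of_inc_hard he hw hew
  exact ⟨e, he, x, hx, w, hw, hxw⟩

omit S in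
theorem jetE_nonempty_of_mem {x : V} {i : Fin K} (h : x ∈ jetVerts G att mode i) :
    (jetE mode i).Nonempty := by
  obtain ⟨e, -, he⟩ := h.2.1
  exact ⟨e, he⟩

theorem dl_mem_jet_hard {x w : V} {i : Fin K} (hx : x ∈ jetVerts G att mode i)
    (hw : w ∈ hardVerts G att mode) : dl x w ∈ spn (bvec G) (hardE mode ∪ jetE mode i) := by
  obtain ⟨e, he, x', hx', w', hw', hl⟩ := S.exists_jet_isLink_hard (jetE_nonempty_of_mem hx)
  have h1 : dl x x' ∈ spn (bvec G) (hardE mode ∪ jetE mode i) :=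
    spn_mono (bvec G) ((innerJetE_subset i).trans Set.subset_union_right)
      (S.dl_mem_innerJet hx hx')
  have h2 := dl_mem_of_isLink (X := hardE mode ∪ jetE mode i) (Or.inr he) hl
  have h3 : dl w' w ∈ spn (bvec G) (hardE mode ∪ jetE mode i) :=
    spn_mono (bvec G) Set.subset_union_left (S.dl_mem_hard hw' hw)
  exact dl_mem_trans h1 (dl_mem_trans h2 h3)

theorem dl_mem_nonsoft {x y : V} (hx : x ∉ softVerts G att mode)
    (hy : y ∉ softVerts G att mode) : dl x y ∈ spn (bvec G) (nonsoftE mode) := by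
  obtain ⟨w, hw⟩ : (hardVerts G att mode).Nonempty := S.config.hard_connected.1
  have key : ∀ z, z ∉ softVerts G att mode → dl z w ∈ spn (bvec G) (nonsoftE mode) := by
    intro z hz
    obtain hz | ⟨i, hz⟩ := S.not_mem_soft_cases hz
    · exact spn_mono _ (hardE_subset mode) (S.dl_mem_hard hz hw)
    · exact spn_mono _ (Set.union_subset (hardE_subset mode) (jetE_subset mode i))
        (S.dl_mem_jet_hard hz hw)
  exact dl_mem_trans (key x hx) (dl_mem_symm (key y hy))

theorem dl_att_mem (l l' : Leg K L) : dl (att l) (att l') ∈ spn (bvec G) (nonsoftE mode) :=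
  S.dl_mem_nonsoft (S.config.soft_external l) (S.config.soft_external l')

/-- A line which is not attached to its jet is attached to `H`. -/
theorem att_cases (l : Leg K L) : att l ∈ hardVerts G att mode ∨
    ∃ i, l = Sum.inl i ∧ att l ∈ jetVerts G att mode i := by
  rcases l with i | j
  · by_cases h : (jetE mode i).Nonempty
    · exact Or.inr ⟨i, rfl, S.att_mem_jet h⟩
    · exact Or.inl (S.config.jet_empty i (Set.not_nonempty_iff_eq_empty.1 h))
  · exact Or.inl (S.config.hard_external j)

variable [Nonempty V]

/-! ### Components of spanning 2-trees -/

/-- The external lines that are connected to `x` by the edges in `T`. -/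
def conLegs (G : Graph V E) (att : Leg K L → V) (T : Set E) (x : V) : Set (Leg K L) :=
  {l | dl x (att l) ∈ spn (bvec G) T}

-- By momentum conservation both components of a 2-tree give the same square, so the arbitrary base
-- vertex in `invariant` may be replaced by any `x`.
open Classical in
theorem invariant_eq {T : Set E} (hT : IsSpanningTwoTree G T) (x : V) (t : ℝ) :
    invariant G att (P t) T =
      mdot (legSum (P t) (conLegs G att T x)) (legSum (P t) (conLegs G att T x)) := by
  have h1 : invariant G att (P t) T =
      mdot (legSum (P t) (conLegs G att T (Classical.arbitrary V)))
        (legSum (P t) (conLegs G att T (Classical.arbitrary V))) := by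
    have h : ∀ l, Reach (G.restrict T) (Classical.arbitrary V) (att l) ↔
        l ∈ conLegs G att T (Classical.arbitrary V) := fun l => reach_restrict_iff _ _ _ _
    have h' : ∀ l, (if Reach (G.restrict T) (Classical.arbitrary V) (att l) then P t l else 0) =
        if l ∈ conLegs G att T (Classical.arbitrary V) then P t l else 0 :=
      fun l => if_congr (h l) rfl rfl
    rw [invariant, legSum]
    simp only [h']
  rw [h1]
  by_cases h : dl (Classical.arbitrary V) x ∈ spn (bvec G) T
  · have : conLegs G att T (Classical.arbitrary V) = conLegs G att T x := by
      ext l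
      exact ⟨fun h' => dl_mem_trans (dl_mem_symm h) h', fun h' => dl_mem_trans h h'⟩
    rw [this]
  · have : conLegs G att T (Classical.arbitrary V) = (conLegs G att T x)ᶜ := by
      ext l
      refine ⟨fun h' h'' => h (dl_mem_trans h' (dl_mem_symm h'')), fun h' => ?_⟩
      exact ((hT.connected (S.mem_vertexSet (Classical.arbitrary V)) (S.mem_vertexSet x)
        (S.mem_vertexSet (att l))).resolve_left h).resolve_right h'
    rw [this, S.wide.sq_compl]

theorem term_nonempty {T : Set E} {n : ℕ} (hT : IsSpanningTwoTree G T)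
    (h : (fun t => invariant G att (P t) T) =Θ[𝓝[>] (0 : ℝ)] (fun t => t ^ n)) (x : V) :
    (conLegs G att T x).Nonempty ∧ (conLegs G att T x)ᶜ.Nonempty := by
  simp only [S.invariant_eq hT x] at h
  exact S.wide.nonempty_of_isTheta h

theorem term_not_exceptional {T : Set E} (hT : IsSpanningTwoTree G T)
    (h : (fun t => invariant G att (P t) T) =Θ[𝓝[>] (0 : ℝ)] (fun t => t ^ 0)) (x : V) :
    ¬ Exceptional (conLegs G att T x) ∧ ¬ Exceptional (conLegs G att T x)ᶜ := by
  simp only [S.invariant_eq hT x, pow_zero] at h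
  exact S.wide.not_exceptional_of_isTheta h

/-- The invariant of a term of order one is not that of a single nearly on-shell line. -/
theorem term_exists_not_connected {T : Set E} (hT : IsSpanningTwoTree G T)
    (h : (fun t => invariant G att (P t) T) =Θ[𝓝[>] (0 : ℝ)] (fun t => t ^ 0)) (i : Fin K) :
    ∃ l l', l ≠ Sum.inl i ∧ l' ≠ Sum.inl i ∧ dl (att l) (att l') ∉ spn (bvec G) T := by
  obtain ⟨h1, h2⟩ := S.term_not_exceptional hT h (att (Sum.inl i))
  by_contra hcon
  push Not at hcon
  by_cases hA : ∃ l, l ≠ Sum.inl i ∧ l ∈ conLegs G att T (att (Sum.inl i))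
  · obtain ⟨l, hl, hlA⟩ := hA
    refine h2 (Or.inl (Set.eq_empty_of_forall_notMem fun l' hl' => hl' ?_))
    by_cases hl'' : l' = Sum.inl i
    · subst hl''
      exact dl_self_mem (spn (bvec G) T) (att (Sum.inl i))
    · exact dl_mem_trans hlA (hcon l l' hl hl'')
  · push Not at hA
    refine h1 (Or.inr ⟨i, Set.Subset.antisymm (fun l hl => ?_) ?_⟩)
    · by_contra hne
      exact hA l hne hl
    · rintro _ rfl
      exact dl_self_mem (spn (bvec G) T) (att (Sum.inl i))

/-- All external lines end at nonsoft vertices. Were these all connected in `T`, one component would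
receive no line and the invariant would vanish. -/
theorem not_spn_le_of_term {T : Set E} {n : ℕ} (hT : IsSpanningTwoTree G T)
    (h : (fun t => invariant G att (P t) T) =Θ[𝓝[>] (0 : ℝ)] (fun t => t ^ n)) :
    ¬ spn (bvec G) (nonsoftE mode) ≤ spn (bvec G) T := by
  intro hle
  obtain ⟨⟨l, hl⟩, -⟩ := S.term_nonempty hT h (Classical.arbitrary V)
  obtain ⟨-, ⟨l', hl'⟩⟩ := S.term_nonempty hT h (Classical.arbitrary V)
  exact hl' (dl_mem_trans hl (hle (S.dl_att_mem l l')))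

end Setup

end Setup

/-! ### Minimal terms -/

section MinTerms

variable {V E : Type} [Fintype E] {d K L : ℕ}

theorem sum_indicator_one (T : Set E) : ∑ e, (T.indicator 1 e : ℝ) = T.ncard := by
  classical
  rw [Set.ncard_eq_toFinset_card', Finset.card_eq_sum_ones, Nat.cast_sum, Nat.cast_one,
    ← Finset.sum_filter_add_sum_filter_not Finset.univ (· ∈ T)]
  have h1 : ∑ e with e ∉ T, (T.indicator 1 e : ℝ) = 0 :=
    Finset.sum_eq_zero fun e he => Set.indicator_of_notMem (Finset.mem_filter.1 he).2 _
  have h2 : ∑ e with e ∈ T, (T.indicator 1 e : ℝ) = ∑ e with e ∈ T, (1 : ℝ) :=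
    Finset.sum_congr rfl fun e he => Set.indicator_of_mem (Finset.mem_filter.1 he).2 _
  rw [h1, h2, add_zero]
  refine Finset.sum_congr ?_ fun _ _ => rfl
  ext e
  simp

/-- The weight of a term in terms of the numbers of hard and nonsoft edges of its tree. -/
theorem cosum_weight (mode : E → Mode K) (T : Set E) :
    cosum (fun e => (mode e).weight) T = ∑ e, (mode e).weight + 2 * T.ncard -
      (T ∩ hardE mode).ncard - (T ∩ nonsoftE mode).ncard := by
  rw [← sum_indicator_one, ← sum_indicator_one, ← sum_indicator_one, cosum, Finset.mul_sum,
    ← Finset.sum_add_distrib, ← Finset.sum_sub_distrib, ← Finset.sum_sub_distrib]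
  refine Finset.sum_congr rfl fun e _ => ?_
  by_cases he : e ∈ T
  · rcases hm : mode e with _ | i | _ <;>
      simp [he, edgesOf, nonsoftE, hm, Mode.weight] <;> norm_num
  · simp [he]

theorem cosum_insert (a : E → ℝ) {T : Set E} {e : E} (he : e ∉ T) :
    cosum a (insert e T) + a e = cosum a T := by
  classical
  rw [cosum, cosum, ← Finset.add_sum_erase _ _ (Finset.mem_univ e),
    ← Finset.add_sum_erase (a := e) _ (fun f => Tᶜ.indicator a f) (Finset.mem_univ e)]
  have h1 : (insert e T)ᶜ.indicator a e = 0 := by simp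
  have h2 : Tᶜ.indicator a e = a e := by simp [he]
  rw [h1, h2, zero_add, add_comm]
  congr 1
  refine Finset.sum_congr rfl fun f hf => ?_
  have hfe : f ≠ e := (Finset.mem_erase.1 hf).1
  by_cases hfT : f ∈ T <;> simp [hfT, hfe]

/-- A spanning tree of minimal weight: it contains spanning trees of `H` and of the nonsoft
subgraph. -/
structure IsOptimal (G : Graph V E) (mode : E → Mode K) (T : Set E) : Prop where
  indep : Indep (bvec G) T
  span : spn (bvec G) Set.univ ≤ spn (bvec G) T
  hard : spn (bvec G) (hardE mode) ≤ spn (bvec G) (T ∩ hardE mode)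
  nonsoft : spn (bvec G) (nonsoftE mode) ≤ spn (bvec G) (T ∩ nonsoftE mode)

omit [Fintype E] in
theorem exists_isOptimal_of_subset {G : Graph V E} {mode : E → Mode K} {D : Set E}
    (hD : Indep (bvec G) D) (h1 : spn (bvec G) (hardE mode) ≤ spn (bvec G) (D ∩ hardE mode))
    (h2 : spn (bvec G) (nonsoftE mode) ≤ spn (bvec G) (D ∩ nonsoftE mode)) :
    ∃ T, D ⊆ T ∧ IsOptimal G mode T := by
  obtain ⟨T, -, hDT, h3, h4⟩ := exists_indep_extension (bvec G) hD (Set.subset_univ D)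
  exact ⟨T, hDT, h4, h3, h1.trans (spn_mono _ (Set.inter_subset_inter_left _ hDT)),
    h2.trans (spn_mono _ (Set.inter_subset_inter_left _ hDT))⟩

omit [Fintype E] in
theorem exists_isOptimal (G : Graph V E) (mode : E → Mode K) : ∃ T, IsOptimal G mode T := by
  obtain ⟨T₁, h1, -, h2, h3⟩ := exists_indep_extension (bvec G) (S := ∅) (X := hardE mode)
    (linearIndepOn_empty (ZMod 2) _) (Set.empty_subset _)
  obtain ⟨T₂, h4, h5, h6, h7⟩ := exists_indep_extension (bvec G) h3 (h1.trans (hardE_subset mode))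
  obtain ⟨T, -, h⟩ := exists_isOptimal_of_subset h7
    (h2.trans (spn_mono _ (Set.subset_inter h5 h1))) (h6.trans (spn_mono _ (Set.subset_inter
      subset_rfl h4)))
  exact ⟨T, h⟩

theorem IsOptimal.ncard {G : Graph V E} {mode : E → Mode K} {T : Set E} (h : IsOptimal G mode T) :
    T.ncard = rk (bvec G) Set.univ ∧ (T ∩ hardE mode).ncard = rk (bvec G) (hardE mode) ∧
      (T ∩ nonsoftE mode).ncard = rk (bvec G) (nonsoftE mode) :=
  ⟨h.indep.ncard_eq (spn_mono _ (Set.subset_univ T)) h.span,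
    (h.indep.mono Set.inter_subset_left).ncard_eq (spn_mono _ Set.inter_subset_right) h.hard,
    (h.indep.mono Set.inter_subset_left).ncard_eq (spn_mono _ Set.inter_subset_right) h.nonsoft⟩

theorem isOptimal_of_ncard {G : Graph V E} {mode : E → Mode K} {T : Set E}
    (hT : Indep (bvec G) T) (h : rk (bvec G) Set.univ ≤ T.ncard)
    (h1 : rk (bvec G) (hardE mode) ≤ (T ∩ hardE mode).ncard)
    (h2 : rk (bvec G) (nonsoftE mode) ≤ (T ∩ nonsoftE mode).ncard) : IsOptimal G mode T :=
  ⟨hT, hT.spn_le_of_ncard (spn_mono _ (Set.subset_univ T)) h,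
    (hT.mono Set.inter_subset_left).spn_le_of_ncard (spn_mono _ Set.inter_subset_right) h1,
    (hT.mono Set.inter_subset_left).spn_le_of_ncard (spn_mono _ Set.inter_subset_right) h2⟩

omit [Fintype E] in
theorem exists_not_mem_spn {v : E → V →₀ ZMod 2} {X : Set E} {N : Submodule (ZMod 2) (V →₀ ZMod 2)}
    (h : ¬ spn v X ≤ N) : ∃ e ∈ X, v e ∉ N := by
  by_contra hcon
  push Not at hcon
  exact h (spn_le v hcon)

namespace Setup

variable {G : Graph V E} {att : Leg K L → V} {P : ℝ → Leg K L → Momentum d} {mode : E → Mode K}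
variable (S : Setup G att P mode)

include S

omit [Fintype E] in
theorem isSpanningTree_iff {T : Set E} : IsSpanningTree G T ↔
    Indep (bvec G) T ∧ spn (bvec G) Set.univ ≤ spn (bvec G) T := by
  rw [OnShell.isSpanningTree_iff G T S.conn]
  exact and_iff_right fun e _ => S.mem_edgeSet e

theorem ncard_of_isSpanningTwoTree {T : Set E} (hT : IsSpanningTwoTree G T) :
    T.ncard + 1 = rk (bvec G) Set.univ := by
  obtain ⟨-, x, hx, y, hy, hxy, -⟩ := id hT
  obtain ⟨e, -, he⟩ := exists_not_mem_spn (v := bvec G) (X := Set.univ)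
    (N := spn (bvec G) T) fun h => hxy ((reach_restrict_iff _ _ _ _).2 (h (S.dl_mem x y)))
  have heT : e ∉ T := fun h => he (mem_spn _ h)
  rw [← Set.ncard_insert_of_notMem heT]
  exact (indep_insert hT.indep he).ncard_eq (spn_mono _ (Set.subset_univ _)) (hT.spn_insert he)

variable [Nonempty V]

/-- If `T` has two nonsoft components and the invariant is of order one, every external momentum
enters a hard vertex within `T`. -/
theorem exists_enters_of_term {T : Set E} (hT : IsSpanningTwoTree G T)
    (h : (fun t => invariant G att (P t) T) =Θ[𝓝[>] (0 : ℝ)] (fun t => t ^ 0))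
    (h2 : (T ∩ nonsoftE mode).ncard + 1 = rk (bvec G) (nonsoftE mode)) (l : Leg K L) :
    ∃ w, Enters G att mode l w ∧ dl w (att l) ∈ spn (bvec G) (T ∩ nonsoftE mode) := by
  obtain hl | ⟨i, rfl, hl⟩ := S.att_cases l
  · exact ⟨att l, ⟨hl, Or.inl rfl⟩, dl_self_mem _ _⟩
  set Z : Set V := {z | dl (att (Sum.inl i)) z ∈ spn (bvec G) (T ∩ jetE mode i)} with hZ
  have hZc : IsClosedUnder G (T ∩ jetE mode i) Z := isClosedUnder_component _ _ _
  have hinc : ∀ z ∈ Z, ∃ e, mode e = Mode.jet i ∧ G.Inc e z := by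
    intro z hz
    have hc : IsClosedUnder G (T ∩ jetE mode i) {z | ∃ e, mode e = Mode.jet i ∧ G.Inc e z} :=
      fun e he x y hxy _ => ⟨e, he.2, hxy.inc_right⟩
    obtain ⟨e, h1, h2⟩ := hl.2.1
    exact (hc.mem_iff hz).1 ⟨e, h2, h1⟩
  by_cases hw : ∃ w ∈ Z, w ∈ hardVerts G att mode
  · obtain ⟨w, hwZ, hw⟩ := hw
    obtain ⟨e, he, hew⟩ := hinc w hwZ
    refine ⟨w, ⟨hw, Or.inr ⟨i, rfl, e, he, hew⟩⟩, dl_mem_symm (spn_mono _ ?_ hwZ)⟩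
    exact Set.inter_subset_inter_right _ (jetE_subset mode i)
  -- If `p_i` does not reach `H`, then `Z` is a component of the nonsoft part of `T` whose only
  -- external line is `p_i`. One edge `e` restores the nonsoft graph, and it must be the one joining
  -- `Z` to the rest.
  · exfalso
    push Not at hw
    have hZJ : ∀ z ∈ Z, z ∈ jetVerts G att mode i := by
      intro z hz
      obtain ⟨e, he, hez⟩ := hinc z hz
      exact (S.mem_of_inc_jet he hez).resolve_left (hw z hz)
    have hZc' : IsClosedUnder G (T ∩ nonsoftE mode) Z := fun e he x y hxy hx =>
      hZc e ⟨he.1, jetE_of_inc_jetVerts he.2 hxy.inc_left (hZJ x hx)⟩ x y hxy hx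
    have hi : Indep (bvec G) (T ∩ nonsoftE mode) := hT.indep.mono Set.inter_subset_left
    obtain ⟨e, he, heT⟩ := exists_not_mem_spn (v := bvec G) (X := nonsoftE mode)
      (N := spn (bvec G) (T ∩ nonsoftE mode)) fun hle => by
        have := hi.ncard_eq (spn_mono _ Set.inter_subset_right) hle
        omega
    have hi' : Indep (bvec G) (insert e (T ∩ nonsoftE mode)) := indep_insert hi heT
    have hspan := hi'.spn_le_of_ncard (X := nonsoftE mode)
      (spn_mono _ (Set.insert_subset he Set.inter_subset_right)) (by
        rw [Set.ncard_insert_of_notMem fun h => heT (mem_spn _ h)]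
        omega)
    obtain ⟨w, hwH⟩ : (hardVerts G att mode).Nonempty := S.config.hard_connected.1
    have hw' : dl (att (Sum.inl i)) w ∈ spn (bvec G) (nonsoftE mode) :=
      S.dl_mem_nonsoft (S.config.soft_external _) hwH.2.1
    -- Exactly one end of `e` lies in `Z`, for otherwise `p_i` would not be connected to `H` even
    -- after `e` is added.
    have hs : sumOn Z (bvec G e) ≠ 0 := by
      intro h0
      have h1 : sumOn Z (dl (att (Sum.inl i)) w) = 0 := by
        obtain h2 | h2 := dl_mem_insert_iff.1 (hspan hw')
        · exact hZc'.sumOn_eq_zero h2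
        · have := hZc'.sumOn_eq_zero h2
          rwa [map_add, h0, add_zero] at this
      exact hw w (((sumOn_dl _ _ _).1 h1).1
        (show att (Sum.inl i) ∈ Z from dl_self_mem (spn (bvec G) (T ∩ jetE mode i)) _)) hwH
    -- Both these lines end outside `Z`, so joining them does not need `e`: they are already
    -- connected in `T`, a contradiction.
    obtain ⟨l, l', hl1, hl2, hll⟩ := S.term_exists_not_connected hT h i
    refine hll (spn_mono _ Set.inter_subset_left ((dl_mem_insert_iff.1
      (hspan (S.dl_att_mem l l'))).resolve_right fun h2 => ?_))
    have h3 := hZc'.sumOn_eq_zero h2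
    have h4 : ∀ l, l ≠ Sum.inl i → att l ∉ Z := fun l hl hlZ =>
      hl (eq_of_att_mem_jet (hZJ _ hlZ))
    rw [map_add, (sumOn_dl Z _ _).2 (iff_of_false (h4 l hl1) (h4 l' hl2)), zero_add] at h3
    exact hs h3

/-- With two nonsoft components and an invariant of order one, `H` is disconnected in `T`. -/
theorem not_hard_le_of_term {T : Set E} (hT : IsSpanningTwoTree G T)
    (h : (fun t => invariant G att (P t) T) =Θ[𝓝[>] (0 : ℝ)] (fun t => t ^ 0))
    (h2 : (T ∩ nonsoftE mode).ncard + 1 = rk (bvec G) (nonsoftE mode)) :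
    ¬ spn (bvec G) (hardE mode) ≤ spn (bvec G) (T ∩ nonsoftE mode) := by
  intro hle
  obtain ⟨⟨l, hl⟩, -⟩ := S.term_nonempty hT h (Classical.arbitrary V)
  obtain ⟨-, ⟨l', hl'⟩⟩ := S.term_nonempty hT h (Classical.arbitrary V)
  obtain ⟨w, hw, hwl⟩ := S.exists_enters_of_term hT h h2 l
  obtain ⟨w', hw', hwl'⟩ := S.exists_enters_of_term hT h h2 l'
  have hll : dl (att l) (att l') ∈ spn (bvec G) (T ∩ nonsoftE mode) :=
    dl_mem_trans (dl_mem_symm hwl) (dl_mem_trans (hle (S.dl_mem_hard hw.1 hw'.1)) hwl')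
  exact hl' (dl_mem_trans hl (spn_mono _ Set.inter_subset_left hll))

/-- The bounds on the numbers of hard and nonsoft edges of a term. -/
theorem ncard_bound_of_term {T : Set E} {n : ℕ} (hT : IsSpanningTwoTree G T)
    (h : (fun t => invariant G att (P t) T) =Θ[𝓝[>] (0 : ℝ)] (fun t => t ^ n)) :
    (T ∩ nonsoftE mode).ncard + 1 ≤ rk (bvec G) (nonsoftE mode) ∧
    (T ∩ hardE mode).ncard + (T ∩ nonsoftE mode).ncard + 2 ≤
      rk (bvec G) (hardE mode) + rk (bvec G) (nonsoftE mode) + n := by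
  have hH := hT.indep.ncard_inter_le (hardE mode)
  have hi : Indep (bvec G) (T ∩ nonsoftE mode) := hT.indep.mono Set.inter_subset_left
  have hJ' : (T ∩ nonsoftE mode).ncard < rk (bvec G) (nonsoftE mode) := by
    by_contra hcon
    refine S.not_spn_le_of_term hT h ((hi.spn_le_of_ncard (spn_mono _ Set.inter_subset_right)
      (by omega)).trans (spn_mono _ Set.inter_subset_left))
  refine ⟨hJ', ?_⟩
  -- The hard and nonsoft deficits must total at least `2 - n`. The nonsoft deficit is at least one,
  -- which is enough unless `n = 0`; then a nonsoft deficit of exactly one entails a hard one.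
  rcases Nat.eq_zero_or_pos n with rfl | hn
  · by_cases h2 : (T ∩ nonsoftE mode).ncard + 1 = rk (bvec G) (nonsoftE mode)
    · have h3 : (T ∩ hardE mode).ncard < rk (bvec G) (hardE mode) := by
        by_contra hcon
        refine S.not_hard_le_of_term hT h h2 (((hT.indep.mono
          Set.inter_subset_left).spn_le_of_ncard (spn_mono _ Set.inter_subset_right)
          (by omega)).trans (spn_mono _ ?_))
        exact Set.inter_subset_inter_right _ (hardE_subset mode)
      omega
    · omega
  · omega

/-- The minimal weight. -/
def minWeight (G : Graph V E) (mode : E → Mode K) : ℝ :=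
  ∑ e, (mode e).weight + 2 * rk (bvec G) Set.univ - rk (bvec G) (hardE mode) -
    rk (bvec G) (nonsoftE mode)

theorem minWeight_le {x : Set E × ℕ} (hx : x ∈ terms G att P) :
    minWeight G mode ≤ cosum (fun e => (mode e).weight) x.1 + x.2 := by
  rw [cosum_weight, minWeight]
  obtain ⟨h1, h2⟩ | ⟨h1, h2⟩ := hx
  · obtain ⟨hi, hs⟩ := S.isSpanningTree_iff.1 h1
    have hH := hi.ncard_inter_le (hardE mode)
    have hJ := hi.ncard_inter_le (nonsoftE mode)
    have hc := hi.ncard_eq (spn_mono _ (Set.subset_univ _)) hs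
    rw [h2, hc]
    have hH' : ((x.1 ∩ hardE mode).ncard : ℝ) ≤ rk (bvec G) (hardE mode) := by exact_mod_cast hH
    have hJ' : ((x.1 ∩ nonsoftE mode).ncard : ℝ) ≤ rk (bvec G) (nonsoftE mode) := by
      exact_mod_cast hJ
    push_cast
    linarith
  · have hb := (S.ncard_bound_of_term h1 h2).2
    have hc := S.ncard_of_isSpanningTwoTree h1
    have hb' : ((x.1 ∩ hardE mode).ncard : ℝ) + (x.1 ∩ nonsoftE mode).ncard + 2 ≤
      rk (bvec G) (hardE mode) + rk (bvec G) (nonsoftE mode) + x.2 := by exact_mod_cast hb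
    have hc' : (x.1.ncard : ℝ) + 1 = rk (bvec G) Set.univ := by exact_mod_cast hc
    linarith

omit S [Nonempty V] in
theorem cosum_of_isOptimal {T : Set E} (hT : IsOptimal G mode T) :
    cosum (fun e => (mode e).weight) T = minWeight G mode := by
  obtain ⟨h1, h2, h3⟩ := hT.ncard
  rw [cosum_weight, minWeight, h1, h2, h3]

omit [Fintype E] in
theorem isOptimal_mem_terms {T : Set E} (hT : IsOptimal G mode T) : (T, 0) ∈ terms G att P :=
  Or.inl ⟨S.isSpanningTree_iff.2 ⟨hT.indep, hT.span⟩, rfl⟩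

theorem mem_minTerms_iff {x : Set E × ℕ} :
    x ∈ minTerms G att P (fun e => (mode e).weight) ↔
      x ∈ terms G att P ∧ cosum (fun e => (mode e).weight) x.1 + x.2 = minWeight G mode := by
  refine and_congr_right fun hx => ⟨fun h => ?_, fun h y hy => h.le.trans (S.minWeight_le hy)⟩
  obtain ⟨T, hT⟩ := exists_isOptimal G mode
  refine le_antisymm ?_ (S.minWeight_le hx)
  have := h _ (S.isOptimal_mem_terms hT)
  rwa [cosum_of_isOptimal hT, Nat.cast_zero, add_zero] at this

theorem isOptimal_mem_minTerms {T : Set E} (hT : IsOptimal G mode T) :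
    (T, 0) ∈ minTerms G att P (fun e => (mode e).weight) :=
  S.mem_minTerms_iff.2 ⟨S.isOptimal_mem_terms hT, by simp [cosum_of_isOptimal hT]⟩

/-- The numbers of hard and nonsoft edges of a minimal term. -/
theorem minTerms_cases {T : Set E} {n : ℕ}
    (h : (T, n) ∈ minTerms G att P (fun e => (mode e).weight)) :
    IsOptimal G mode T ∨ (IsSpanningTwoTree G T ∧
      (fun t => invariant G att (P t) T) =Θ[𝓝[>] (0 : ℝ)] (fun t => t ^ n) ∧
      (((T ∩ hardE mode).ncard = rk (bvec G) (hardE mode) ∧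
          (T ∩ nonsoftE mode).ncard + 1 = rk (bvec G) (nonsoftE mode)) ∨
        (n = 0 ∧ (T ∩ hardE mode).ncard + 1 = rk (bvec G) (hardE mode) ∧
          (T ∩ nonsoftE mode).ncard + 1 = rk (bvec G) (nonsoftE mode)) ∨
        (n = 0 ∧ (T ∩ hardE mode).ncard = rk (bvec G) (hardE mode) ∧
          (T ∩ nonsoftE mode).ncard + 2 = rk (bvec G) (nonsoftE mode)))) := by
  obtain ⟨hx, hw⟩ := S.mem_minTerms_iff.1 h
  rw [cosum_weight, minWeight] at hw
  obtain ⟨h1, h2⟩ | ⟨h1, h2⟩ := hx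
  · left
    simp only at h1 h2 hw
    subst h2
    obtain ⟨hi, hs⟩ := S.isSpanningTree_iff.1 h1
    have hH := hi.ncard_inter_le (hardE mode)
    have hJ := hi.ncard_inter_le (nonsoftE mode)
    have hc := hi.ncard_eq (spn_mono _ (Set.subset_univ _)) hs
    rw [hc] at hw
    have hw' : ((T ∩ hardE mode).ncard + (T ∩ nonsoftE mode).ncard : ℝ) =
        rk (bvec G) (hardE mode) + rk (bvec G) (nonsoftE mode) := by
      push_cast at hw
      linarith
    have hw'' : (T ∩ hardE mode).ncard + (T ∩ nonsoftE mode).ncard =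
        rk (bvec G) (hardE mode) + rk (bvec G) (nonsoftE mode) := by exact_mod_cast hw'
    exact isOptimal_of_ncard hi hc.ge (by omega) (by omega)
  · right
    simp only at h1 h2 hw
    refine ⟨h1, h2, ?_⟩
    have hH := h1.indep.ncard_inter_le (hardE mode)
    have hb := S.ncard_bound_of_term h1 h2
    have hc := S.ncard_of_isSpanningTwoTree h1
    have hc' : (T.ncard : ℝ) + 1 = rk (bvec G) Set.univ := by exact_mod_cast hc
    have hw' : ((T ∩ hardE mode).ncard + (T ∩ nonsoftE mode).ncard + 2 : ℝ) =
        rk (bvec G) (hardE mode) + rk (bvec G) (nonsoftE mode) + n := by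
      linarith
    have hw'' : (T ∩ hardE mode).ncard + (T ∩ nonsoftE mode).ncard + 2 =
        rk (bvec G) (hardE mode) + rk (bvec G) (nonsoftE mode) + n := by exact_mod_cast hw'
    by_cases h0 : (T ∩ nonsoftE mode).ncard + 1 = rk (bvec G) (nonsoftE mode)
    · by_cases hn : n = 0
      · exact Or.inr (Or.inl ⟨hn, by omega, h0⟩)
      · exact Or.inl ⟨by omega, h0⟩
    · exact Or.inr (Or.inr ⟨by omega, by omega, by omega⟩)

omit [Fintype E] [Nonempty V] in
/-- Removing an edge from a spanning tree gives a spanning 2-tree. -/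
theorem diff_isSpanningTwoTree {T : Set E} (hT : Indep (bvec G) T)
    (hs : spn (bvec G) Set.univ ≤ spn (bvec G) T) {e : E} (he : e ∈ T) :
    IsSpanningTwoTree G (T \ {e}) := by
  refine isSpanningTwoTree_of_insert (e := e) S.conn (fun f _ => S.mem_edgeSet f) (S.mem_edgeSet e)
    (hT.mono Set.sdiff_subset) (hT.notMem_span he) ?_
  rw [Set.insert_sdiff_singleton, Set.insert_eq_of_mem he]
  exact hs

/-- Removing an edge of weight `-n` from an optimal tree gives a minimal term if the invariant is of
order `n`. -/
theorem diff_mem_minTerms {T : Set E} (hT : IsOptimal G mode T) {e : E} (he : e ∈ T) {n : ℕ}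
    (h : (fun t => invariant G att (P t) (T \ {e})) =Θ[𝓝[>] (0 : ℝ)] (fun t => t ^ n))
    (hn : (mode e).weight + n = 0) :
    (T \ {e}, n) ∈ minTerms G att P (fun e => (mode e).weight) := by
  refine S.mem_minTerms_iff.2 ⟨Or.inr ⟨S.diff_isSpanningTwoTree hT.indep hT.span he, h⟩, ?_⟩
  have := cosum_insert (fun e => (mode e).weight) (T := T \ {e}) (e := e) (by simp)
  rw [Set.insert_sdiff_singleton, Set.insert_eq_of_mem he, cosum_of_isOptimal hT] at this
  simp only [← this]
  linarith

end Setup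

end MinTerms

/-! ### The requirement of the hard subgraph is necessary -/

section HardNecessity

variable {V E : Type} [Fintype E] {d K L : ℕ}

/-- The vanishing of all the linear forms that are constant on the minimal terms. -/
def FacetCondition [Nonempty V] (G : Graph V E) (att : Leg K L → V) (P : ℝ → Leg K L → Momentum d)
    (mode : E → Mode K) : Prop :=
  ∀ a : E → ℝ, (∀ x ∈ minTerms G att P (fun e => (mode e).weight),
    ∀ y ∈ minTerms G att P (fun e => (mode e).weight), cosum a x.1 = cosum a y.1) → a = 0

theorem cosum_indicator_one (B T : Set E) :
    cosum (B.indicator 1) T + (T ∩ B).ncard = B.ncard := by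
  classical
  have h1 : cosum (B.indicator 1) T = ∑ e, ((Tᶜ ∩ B).indicator 1 e : ℝ) := by
    rw [cosum, ← Set.indicator_indicator]
  rw [h1, sum_indicator_one, ← Nat.cast_add, Nat.cast_inj,
    ← Set.ncard_union_eq (Set.disjoint_left.2 fun e h h' => h.1 h'.1), ← Set.union_inter_distrib_right,
    Set.compl_union_self, Set.univ_inter]

/-- Otherwise the indicator of `B` would be a nonzero form that is constant on the minimal terms.
Each necessity proof starts from the term found here. -/
theorem FacetCondition.exists_ncard_ne [Nonempty V] {G : Graph V E} {att : Leg K L → V}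
    {P : ℝ → Leg K L → Momentum d} {mode : E → Mode K} (hF : FacetCondition G att P mode)
    {B : Set E} (hB : B.Nonempty) (c : ℕ) :
    ∃ x ∈ minTerms G att P (fun e => (mode e).weight), (x.1 ∩ B).ncard ≠ c := by
  by_contra hcon
  push Not at hcon
  obtain ⟨e, he⟩ := hB
  have := congrFun (hF (B.indicator 1) fun x hx y hy => ?_) e
  · simp [he] at this
  · have h1 := cosum_indicator_one B x.1
    have h2 := cosum_indicator_one B y.1
    rw [hcon x hx] at h1
    rw [hcon y hy] at h2
    linarith

namespace Setup

variable {G : Graph V E} {att : Leg K L → V} {P : ℝ → Leg K L → Momentum d} {mode : E → Mode K}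
variable (S : Setup G att P mode)

include S

omit [Fintype E] in
theorem exists_enters (l : Leg K L) : ∃ w, Enters G att mode l w := by
  obtain h | ⟨i, rfl, h⟩ := S.att_cases l
  · exact ⟨_, h, Or.inl rfl⟩
  · obtain ⟨e, he, x, -, w, hw, hl⟩ := S.exists_jet_isLink_hard (jetE_nonempty_of_mem h)
    exact ⟨w, hw, Or.inr ⟨i, rfl, e, he, hl.inc_right⟩⟩

theorem hard_component_subset {B : Set E} (hB : IsOneVIComponent (hardGraph G att mode) B) :
    B ⊆ hardE mode := S.edgeSet_hardGraph (att := att) ▸ hB.1.2.1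

theorem hard_component_separates {B : Set E} (hB : IsOneVIComponent (hardGraph G att mode) B) :
    spn (bvec G) (∅ ∪ B) ⊓ spn (bvec G) (hardE mode \ B) ≤ spn (bvec G) ∅ := by
  rintro z ⟨h1, h2⟩
  rw [hB.isSep.eq_zero (z := z)]
  · exact Submodule.zero_mem _
  · rwa [S.spn_hardGraph, Set.inter_eq_left.2 (S.hard_component_subset hB), ← Set.empty_union B]
  · rwa [S.spn_hardGraph, Set.inter_comm, ← Set.sdiff_eq]

variable [Nonempty V]

/-- A spanning 2-tree that splits the set `B` of hard edges, but no other hard edges. -/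
structure HardSplit (G : Graph V E) (att : Leg K L → V) (P : ℝ → Leg K L → Momentum d)
    (mode : E → Mode K) (B T : Set E) : Prop where
  twoTree : IsSpanningTwoTree G T
  isTheta : (fun t => invariant G att (P t) T) =Θ[𝓝[>] (0 : ℝ)] (fun t => t ^ 0)
  enters : ∀ l, ∃ w, Enters G att mode l w ∧ dl w (att l) ∈ spn (bvec G) T
  rest : spn (bvec G) (hardE mode \ B) ≤ spn (bvec G) T
  splits : ∃ e ∈ B, bvec G e ∉ spn (bvec G) T

/-- A basis of `H` meets the separator `B` in a fixed number of edges. A minimal term violating this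
number does not span `H`, which leaves the case `n = 0` with one edge missing in `H` and one in `H ∪
J`. -/
theorem exists_hardSplit (hF : FacetCondition G att P mode) {B : Set E}
    (hB : IsOneVIComponent (hardGraph G att mode) B) : ∃ T, HardSplit G att P mode B T := by
  have hsep := S.hard_component_separates hB
  have hBH := S.hard_component_subset hB
  have h0 : rk (bvec G) (∅ : Set E) = 0 := by
    simpa using rk_le_ncard (bvec G) (∅ : Set E)
  have key : ∀ T, Indep (bvec G) T → spn (bvec G) (hardE mode) ≤ spn (bvec G) (T ∩ hardE mode) →
      (T ∩ B).ncard = rk (bvec G) (∅ ∪ B) ∧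
        spn (bvec G) (hardE mode \ B) ≤ spn (bvec G) (T ∩ (hardE mode \ B)) := by
    intro T hT h
    have := hT.ncard_inter_separator (Y := ∅) (Set.empty_subset _) hBH (Set.disjoint_empty B) h
      (spn_mono _ (Set.empty_subset _)) hsep
    rwa [h0, add_zero] at this
  obtain ⟨⟨T, n⟩, hx, hne⟩ := hF.exists_ncard_ne hB.1.1 (rk (bvec G) (∅ ∪ B))
  have hfull : Indep (bvec G) T → (T ∩ hardE mode).ncard = rk (bvec G) (hardE mode) → False :=
    fun h1 h2 => hne (key T h1 ((h1.mono Set.inter_subset_left).spn_le_of_ncard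
      (spn_mono _ Set.inter_subset_right) h2.ge)).1
  obtain h | ⟨h1, h2, h | ⟨rfl, h3, h4⟩ | h⟩ := S.minTerms_cases hx
  · exact (hfull h.indep h.ncard.2.1).elim
  · exact (hfull h1.indep h.1).elim
  · obtain ⟨h0, h0H, h0T⟩ := exists_not_mem_spn (S.not_hard_le_of_term h1 h2 h4)
    have hi : Indep (bvec G) (T ∩ nonsoftE mode) := h1.indep.mono Set.inter_subset_left
    have hspan := (indep_insert hi h0T).spn_le_of_ncard (X := nonsoftE mode)
      (spn_mono _ (Set.insert_subset (hardE_subset mode h0H) Set.inter_subset_right)) (by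
        rw [Set.ncard_insert_of_notMem fun h => h0T (mem_spn _ h)]
        omega)
    have h0T' : bvec G h0 ∉ spn (bvec G) T := by
      intro h
      refine S.not_spn_le_of_term h1 h2 (hspan.trans (spn_le _ ?_))
      rintro e (rfl | he)
      · exact h
      · exact mem_spn _ he.1
    have hi' := indep_insert h1.indep h0T'
    have heq : insert h0 T ∩ hardE mode = insert h0 (T ∩ hardE mode) :=
      Set.insert_inter_of_mem h0H
    obtain ⟨h5, h6⟩ := key _ hi' ((hi'.mono Set.inter_subset_left).spn_le_of_ncard
      (spn_mono _ Set.inter_subset_right) (by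
        rw [heq, Set.ncard_insert_of_notMem fun h => h0T' (mem_spn _ h.1), h3]))
    -- With `h0` added, `T` contains a basis of `H` and has the standard number of edges in `B`. As
    -- `T` has a different one, `h0` must count.
    have h0B : h0 ∈ B := by
      by_contra h0B
      rw [Set.insert_inter_of_notMem h0B] at h5
      exact hne h5
    refine ⟨T, h1, h2, fun l => ?_, h6.trans (spn_mono _ ?_), h0, h0B, h0T'⟩
    · obtain ⟨w, hw, hwl⟩ := S.exists_enters_of_term h1 h2 h4 l
      exact ⟨w, hw, spn_mono _ Set.inter_subset_left hwl⟩
    · rintro e ⟨rfl | h, h'⟩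
      · exact absurd h0B h'.2
      · exact h
  · exact (hfull h1.indep h.2.1).elim

/-- The external momenta entering `H` on the side of `v` of the 1VI component `B`. -/
def nearLegs (G : Graph V E) (att : Leg K L → V) (mode : E → Mode K) (B : Set E) (v : V) :
    Set (Leg K L) :=
  {l | ∃ w, Enters G att mode l w ∧ dl v w ∈ spn (bvec G) (hardE mode \ B)}

/-- The external momenta entering `H` on the other side. -/
def farLegs (G : Graph V E) (att : Leg K L → V) (mode : E → Mode K) (B : Set E) (v : V) :
    Set (Leg K L) :=
  {l | ∃ w, Enters G att mode l w ∧ dl v w ∉ spn (bvec G) (hardE mode \ B)}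

omit [Nonempty V] in
theorem spn_hardGraph_compl (B : Set E) :
    spn (bvec (hardGraph G att mode)) Bᶜ = spn (bvec G) (hardE mode \ B) := by
  rw [S.spn_hardGraph, Set.inter_comm, ← Set.sdiff_eq]

theorem HardSplit.not_exceptional_of_forall {B T : Set E} (h : HardSplit G att P mode B T) {v : V}
    {A : Set (Leg K L)}
    (hA : ∀ l w, Enters G att mode l w → dl v w ∉ spn (bvec G) T → l ∈ A) : ¬ Exceptional A := by
  refine not_exceptional_mono (S.term_not_exceptional h.twoTree h.isTheta v).2 fun l hl => ?_
  obtain ⟨w, hw, hwl⟩ := h.enters l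
  exact hA l w hw fun h' => hl (dl_mem_trans h' hwl)

/-- In the 2-tree that splits `B` the rest of `H` stays connected as in `H \ B`. So the lines cut
off from `v` must enter on the far side, and they are not exceptional. -/
theorem not_exceptional_farLegs (hF : FacetCondition G att P mode) {B : Set E}
    (hB : IsOneVIComponent (hardGraph G att mode) B) (v : V) :
    ¬ Exceptional (farLegs G att mode B v) := by
  obtain ⟨T, hT⟩ := S.exists_hardSplit hF hB
  exact hT.not_exceptional_of_forall S fun l w hw h => ⟨w, hw, fun h' => h (hT.rest h')⟩

/-- If `B` is a bridge, splitting it leaves on the component of `v` only lines that can enter on the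
near side. If another component `B'` also hangs at `v`, split `B'` instead: lines that can enter on
the far side of `B` stay connected to `v`, so those cut off enter near. If two momenta enter at `v`,
they are the witnesses. -/
theorem not_exceptional_nearLegs (hF : FacetCondition G att P mode) {f : E ⊕ (Set E × V)}
    {B : Set E} {v : V}
    (hf : BelongsTo (hardGraph G att mode) (multiEntry G att mode) f B v) :
    ¬ Exceptional (nearLegs G att mode B v) := by
  have hvH : v ∈ hardVerts G att mode := by
    obtain ⟨e, he, h⟩ := hf.mem_ends
    exact h.vertex_mem
  obtain ⟨e, -, rfl, -⟩ | ⟨-, -, hv⟩ := hf.kind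
  · obtain ⟨T, hT⟩ := S.exists_hardSplit hF hf.component
    obtain ⟨e', rfl, he⟩ := hT.splits
    refine not_exceptional_mono (S.term_not_exceptional hT.twoTree hT.isTheta v).1 fun l hl => ?_
    obtain ⟨w, hw, hwl⟩ := hT.enters l
    refine ⟨w, hw, ?_⟩
    have h1 := S.dl_mem_hard hvH hw.1
    rw [← Set.insert_eq_of_mem (S.hard_component_subset hf.component rfl),
      ← Set.insert_sdiff_singleton, dl_mem_insert_iff] at h1
    refine h1.resolve_right fun h2 => he ?_
    have h3 := Submodule.add_mem _ (hT.rest h2) (dl_mem_trans hl (dl_mem_symm hwl))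
    rwa [add_right_comm, add_self_eq_zero_zmod_two, zero_add] at h3
  · obtain ⟨B₁, B₂, h1, h2, hne, hv1, hv2⟩ | ⟨l, l', hne, h1, h2⟩ := hv
    · obtain ⟨B', hB', hne', hv'⟩ : ∃ B', IsOneVIComponent (hardGraph G att mode) B' ∧ B ≠ B' ∧
          v ∈ endsOf (hardGraph G att mode) B' := by
        by_cases h : B = B₁
        · exact ⟨B₂, h2, h ▸ hne, hv2⟩
        · exact ⟨B₁, h1, h, hv1⟩
      obtain ⟨T, hT⟩ := S.exists_hardSplit hF hB'
      refine hT.not_exceptional_of_forall S (v := v) fun l w hw h => ⟨w, hw, ?_⟩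
      by_contra hcon
      rw [← S.spn_hardGraph_compl] at hcon
      have := connected_avoiding_branch S.config.hard_connected hf.component hB' hne' hf.mem_ends
        hv' hw.1 hcon
      rw [S.spn_hardGraph_compl] at this
      exact h (hT.rest this)
    · exact not_exceptional_of_ne ⟨v, h1, dl_self_mem _ _⟩ ⟨v, h2, dl_self_mem _ _⟩ hne

variable [Fintype V]

-- Concentrating each `p_i` at one entry vertex makes the momentum of a branch a sum of whole
-- external momenta, to which the hypothesis on partial sums applies.
omit [Nonempty V] S [Fintype E] in
open Classical in
theorem branchSum_hardInflow (p : Leg K L → Momentum d) {w : Leg K L → V}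
    (hw : ∀ l, Enters G att mode l (w l)) (B : Set E) (v : V) :
    BelongsTo.branchSum (hardGraph G att mode) B
        (hardInflow att p fun i => Pi.single (w (Sum.inl i)) 1) v =
      legSum p {l | dl v (w l) ∈ spn (bvec (hardGraph G att mode)) Bᶜ} := by
  have hq : ∀ j, att (Sum.inr j) = w (Sum.inr j) := by
    intro j
    obtain h | ⟨i, h, -⟩ := (hw (Sum.inr j)).2
    · exact h
    · simp at h
  have h1 : ∀ u, hardInflow att p (fun i => Pi.single (w (Sum.inl i)) 1) u =
      ∑ l, if w l = u then p l else 0 := by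
    intro u
    rw [hardInflow, Fintype.sum_sum_type, add_comm]
    congr 1
    · refine Finset.sum_congr rfl fun i _ => ?_
      by_cases h : w (Sum.inl i) = u
      · subst h
        simp
      · rw [Pi.single_eq_of_ne (Ne.symm h), zero_smul, if_neg h]
    · simp only [hq]
  have h2 : ∀ l, w l ∈ V(hardGraph G att mode) := fun l => (hw l).1
  simp only [BelongsTo.branchSum, h1, legSum]
  have h3 : ∀ u, (if u ∈ V(hardGraph G att mode) ∧ dl v u ∈ spn (bvec (hardGraph G att mode)) Bᶜ then
      ∑ l, (if w l = u then p l else 0) else 0) =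
      ∑ l, if w l = u then (if dl v (w l) ∈ spn (bvec (hardGraph G att mode)) Bᶜ then p l else 0)
        else 0 := by
    intro u
    split_ifs with h
    · refine Finset.sum_congr rfl fun l _ => ?_
      by_cases hl : w l = u
      · subst hl
        simp [h.2]
      · simp [hl]
    · refine (Finset.sum_eq_zero fun l _ => ?_).symm
      by_cases hl : w l = u
      · subst hl
        rw [if_pos rfl, if_neg fun h' => h ⟨h2 l, h'⟩]
      · simp [hl]
  simp only [h3]
  rw [Finset.sum_comm]
  refine Finset.sum_congr rfl fun l _ => ?_
  simp

theorem requirementH (hF : FacetCondition G att P mode) : RequirementH G att mode P := by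
  classical
  intro f hf
  obtain ⟨B, v, hBv⟩ := exists_belongsTo hf
  obtain ⟨C, hC1, hC2, hC3, hC4⟩ := S.wide.exists_distribution (S.not_exceptional_nearLegs hF hBv)
    (S.not_exceptional_farLegs hF hBv.component v) (fun l => by
      obtain ⟨w, hw⟩ := S.exists_enters l
      by_cases h : dl v w ∈ spn (bvec G) (hardE mode \ B)
      · exact Or.inl ⟨w, hw, h⟩
      · exact Or.inr ⟨w, hw, h⟩) (by
      rintro j ⟨w, hw, h⟩ ⟨w', hw', h'⟩
      obtain rfl : att (Sum.inr j) = w := by simpa using hw.2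
      obtain rfl : att (Sum.inr j) = w' := by simpa using hw'.2
      exact h' h)
  have hch : ∀ l, ∃ w, Enters G att mode l w ∧
      (dl v w ∈ spn (bvec G) (hardE mode \ B) ↔ l ∈ C) := by
    intro l
    by_cases hl : l ∈ C
    · obtain ⟨w, hw, h⟩ := hC1 hl
      exact ⟨w, hw, iff_of_true h hl⟩
    · obtain ⟨w, hw, h⟩ := hC2 hl
      exact ⟨w, hw, iff_of_false h hl⟩
  -- Every line enters at one vertex, on the side of the propagator prescribed by `C`. The splitting
  -- has fractions 0 and 1 only.
  choose w hw hwC using hch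
  obtain ⟨x, y, hxy, hx, -⟩ := hBv.carried_cases S.config.hard_connected (P := Momentum d)
  refine ⟨fun i => Pi.single (w (Sum.inl i)) 1, fun i => ⟨fun u => ?_, ?_, fun u hu => ?_⟩, x,
    hxy.inc_left, ?_⟩
  · by_cases h : u = w (Sum.inl i)
    · subst h
      simp
    · exact (Pi.single_eq_of_ne (M := fun _ => ℝ) h 1).ge
  · simp
  · refine Pi.single_eq_of_ne (M := fun _ => ℝ) ?_ 1
    rintro rfl
    exact hu (hw _)
  · have : {l | dl v (w l) ∈ spn (bvec (hardGraph G att mode)) Bᶜ} = C := by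
      ext l
      rw [S.spn_hardGraph_compl]
      exact hwC l
    simp only [hx, branchSum_hardInflow _ hw, this]
    exact S.wide.sq_isTheta_one hC3 hC4

end Setup

end HardNecessity

/-! ### Contracted graphs -/

section Contraction

variable {α β : Type*}

theorem spn_apply_eq_zero {Γ : Graph α β} {X : Set β} {x : α} (h : ∀ e ∈ X, ¬ Γ.Inc e x)
    {z : α →₀ ZMod 2} (hz : z ∈ spn (bvec Γ) X) : z x = 0 := by
  suffices spn (bvec Γ) X ≤ LinearMap.ker (Finsupp.lapply (R := ZMod 2) (M := ZMod 2) x) from this hz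
  refine spn_le _ fun e he => ?_
  by_cases hE : e ∈ E(Γ)
  · obtain ⟨a, b, hab⟩ := Γ.exists_isLink_of_mem_edgeSet hE
    have ha : a ≠ x := fun h' => h e he (h' ▸ hab.inc_left)
    have hb : b ≠ x := fun h' => h e he (h' ▸ hab.inc_right)
    rw [LinearMap.mem_ker, bvec_eq hab]
    simp [dl, ha, hb]
  · rw [bvec_of_notMem hE]
    exact Submodule.zero_mem _

theorem sumOn_univ_spn {Γ : Graph α β} {X : Set β} {z : α →₀ ZMod 2} (hz : z ∈ spn (bvec Γ) X) :
    sumOn Set.univ z = 0 :=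
  IsClosedUnder.sumOn_eq_zero (Γ := Γ) (X := X) (fun _ _ _ _ _ _ => trivial) hz

/-- A combination of edges supported on a set of connected vertices. -/
theorem mem_of_spn_of_support {Γ : Graph α β} {X : Set β} {z : α →₀ ZMod 2}
    (hz : z ∈ spn (bvec Γ) X) {Z : Set α} {N : Submodule (ZMod 2) (α →₀ ZMod 2)}
    (hN : ∀ x ∈ Z, ∀ y ∈ Z, dl x y ∈ N) (h : ∀ x, x ∉ Z → z x = 0) : z ∈ N :=
  mem_of_forall_dl_mem hN h (sumOn_univ_spn hz)

open Classical in
/-- The map of vertices that keeps the vertices of `W` and identifies all the others. -/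
def keep (W : Set α) (v : α) : Option α := if v ∈ W then some v else none

theorem keep_of_mem {W : Set α} {v : α} (h : v ∈ W) : keep W v = some v := if_pos h

theorem keep_of_notMem {W : Set α} {v : α} (h : v ∉ W) : keep W v = none := if_neg h

/-- The map of chains induced by `keep`. -/
def keepMap (W : Set α) : (α →₀ ZMod 2) →ₗ[ZMod 2] (Option α →₀ ZMod 2) :=
  Finsupp.lmapDomain (ZMod 2) (ZMod 2) (keep W)

theorem keepMap_dl (W : Set α) (x y : α) : keepMap W (dl x y) = dl (keep W x) (keep W y) := by
  simp [keepMap, dl, Finsupp.mapDomain_add]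

theorem keepMap_apply_some {W : Set α} {x : α} (hx : x ∈ W) (z : α →₀ ZMod 2) :
    keepMap W z (some x) = z x := by
  classical
  induction z using Finsupp.induction_linear with
  | zero => simp
  | add f g hf hg => simp [hf, hg]
  | single a b =>
    simp only [keepMap, Finsupp.lmapDomain_apply, Finsupp.mapDomain_single, Finsupp.single_apply]
    by_cases ha : a ∈ W
    · simp [keep_of_mem ha]
    · have : a ≠ x := fun h => ha (h ▸ hx)
      simp [keep_of_notMem ha, this]

/-- The edges without ends in `W` are contracted. -/
theorem keepMap_eq_zero {Γ : Graph α β} {X : Set β} {W : Set α}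
    (h : ∀ e ∈ X, ∀ x ∈ W, ¬ Γ.Inc e x) {z : α →₀ ZMod 2} (hz : z ∈ spn (bvec Γ) X) :
    keepMap W z = 0 := by
  suffices spn (bvec Γ) X ≤ LinearMap.ker (keepMap W) from this hz
  refine spn_le _ fun e he => ?_
  by_cases hE : e ∈ E(Γ)
  · obtain ⟨a, b, hab⟩ := Γ.exists_isLink_of_mem_edgeSet hE
    rw [LinearMap.mem_ker, bvec_eq hab, keepMap_dl,
      keep_of_notMem fun h' => h e he a h' hab.inc_left,
      keep_of_notMem fun h' => h e he b h' hab.inc_right, dl_self]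
  · rw [bvec_of_notMem hE]
    exact Submodule.zero_mem _

end Contraction

/-! ### Edge vectors of contracted graphs. -/

section Contracted

variable {V E : Type}

theorem contracted_isLink {G : Graph V E} {X : Set E} {W : Set V} {e : E} {x y : V} (he : e ∈ X)
    (h : G.IsLink e x y) : (contracted G X W).IsLink e (keep W x) (keep W y) := by
  simp only [contracted, Graph.map_isLink]
  exact ⟨x, y, by rw [Graph.restrict_isLink]; tauto, rfl, rfl⟩

theorem exists_of_contracted_isLink {G : Graph V E} {X : Set E} {W : Set V} {e : E}
    {x y : Option V} (h : (contracted G X W).IsLink e x y) :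
    ∃ a b, e ∈ X ∧ G.IsLink e a b ∧ x = keep W a ∧ y = keep W b := by
  simp only [contracted, Graph.map_isLink] at h
  obtain ⟨a, b, h1, h2, h3⟩ := h
  rw [Graph.restrict_isLink] at h1
  exact ⟨a, b, by tauto, by tauto, h2.symm, h3.symm⟩

theorem edgeSet_contracted {G : Graph V E} (hG : E(G) = Set.univ) (X : Set E) (W : Set V) :
    E(contracted G X W) = X := by
  ext e
  constructor
  · intro h
    obtain ⟨x, y, hxy⟩ := Graph.exists_isLink_of_mem_edgeSet h
    obtain ⟨a, b, h1, -⟩ := exists_of_contracted_isLink hxy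
    exact h1
  · intro h
    obtain ⟨x, y, hxy⟩ := G.exists_isLink_of_mem_edgeSet (hG ▸ Set.mem_univ e)
    exact (contracted_isLink h hxy).edge_mem

theorem keep_mem_contracted {G : Graph V E} (hG : V(G) = Set.univ) (X : Set E) (W : Set V) (x : V) :
    keep W x ∈ V(contracted G X W) := by
  have : x ∈ V(G) := hG ▸ Set.mem_univ x
  simp only [contracted, Graph.vertexSet_map, Graph.vertexSet_restrict]
  exact ⟨x, this, rfl⟩

theorem mem_contracted {G : Graph V E} {X : Set E} {W : Set V} {y : Option V}
    (h : y ∈ V(contracted G X W)) : ∃ x, y = keep W x := by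
  simp only [contracted, Graph.vertexSet_map, Graph.vertexSet_restrict] at h
  obtain ⟨x, -, rfl⟩ := h
  exact ⟨x, rfl⟩

theorem bvec_contracted {G : Graph V E} (hG : E(G) = Set.univ) {X : Set E} {W : Set V} {e : E}
    (he : e ∈ X) : bvec (contracted G X W) e = keepMap W (bvec G e) := by
  obtain ⟨x, y, hxy⟩ := G.exists_isLink_of_mem_edgeSet (hG ▸ Set.mem_univ e)
  rw [bvec_eq (contracted_isLink he hxy), bvec_eq hxy, keepMap_dl]

/-- Identifying vertices acts linearly on chains, and edges outside `X` have zero vector in the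
contracted graph. -/
theorem spn_contracted {G : Graph V E} (hG : E(G) = Set.univ) (X : Set E) (W : Set V) (Y : Set E) :
    spn (bvec (contracted G X W)) Y = (spn (bvec G) (Y ∩ X)).map (keepMap W) := by
  apply le_antisymm
  · refine spn_le _ fun e he => ?_
    by_cases heX : e ∈ X
    · rw [bvec_contracted hG heX]
      exact Submodule.mem_map_of_mem (mem_spn _ ⟨he, heX⟩)
    · rw [bvec_of_notMem (by rwa [edgeSet_contracted hG])]
      exact Submodule.zero_mem _
  · rw [Submodule.map_le_iff_le_comap]
    refine spn_le _ fun e he => ?_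
    rw [Submodule.mem_comap, ← bvec_contracted hG he.2]
    exact mem_spn _ he.1

end Contracted

namespace Setup

variable {V E : Type} {d K L : ℕ}
variable {G : Graph V E} {att : Leg K L → V} {P : ℝ → Leg K L → Momentum d} {mode : E → Mode K}
variable (S : Setup G att P mode)

include S

/-! ### Relations between the subgraphs -/

/-- `H` is connected, so any even chain supported on its vertices is already a combination of hard
edges, whichever edges produced it. -/
theorem mem_spn_hardE {X : Set E} {z : V →₀ ZMod 2} (hz : z ∈ spn (bvec G) X)
    (h : ∀ x, x ∉ hardVerts G att mode → z x = 0) : z ∈ spn (bvec G) (hardE mode) :=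
  mem_of_spn_of_support hz (fun _ hx _ hy => S.dl_mem_hard hx hy) h

theorem mem_spn_nonsoftE {X : Set E} {z : V →₀ ZMod 2} (hz : z ∈ spn (bvec G) X)
    (h : ∀ x ∈ softVerts G att mode, z x = 0) : z ∈ spn (bvec G) (nonsoftE mode) := by
  refine mem_of_spn_of_support (Z := (softVerts G att mode)ᶜ) hz
    (fun _ hx _ hy => S.dl_mem_nonsoft hx hy) fun x hx => h x ?_
  simpa using hx

omit S in
theorem not_inc_jetVerts {e : E} {i : Fin K} (he : e ∈ nonsoftE mode) (hei : e ∉ jetE mode i)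
    {x : V} (hx : x ∈ jetVerts G att mode i) : ¬ G.Inc e x :=
  fun h => hei (jetE_of_inc_jetVerts he h hx)

theorem mem_of_inc_hard_or_jet {e : E} {i : Fin K} (he : e ∈ hardE mode ∪ jetE mode i) {x : V}
    (h : G.Inc e x) : x ∈ hardVerts G att mode ∨ x ∈ jetVerts G att mode i :=
  he.elim (fun he => Or.inl (S.mem_hard_of_inc he h)) (fun he => S.mem_of_inc_jet he h)

/-- The only relations of a jet with the rest of the nonsoft graph come from `H`. -/
theorem jet_separates (i : Fin K) : spn (bvec G) (hardE mode ∪ jetE mode i) ⊓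
    spn (bvec G) (nonsoftE mode \ jetE mode i) ≤ spn (bvec G) (hardE mode) := by
  rintro z ⟨h1, h2⟩
  -- Off `H`, a vertex of `J_i` is missed by the edges outside the jet, and any other vertex is
  -- missed by the edges of `H ∪ J_i`.
  refine S.mem_spn_hardE h1 fun x hx => ?_
  by_cases hxi : x ∈ jetVerts G att mode i
  · exact spn_apply_eq_zero (fun e he => not_inc_jetVerts he.1 he.2 hxi) h2
  · exact spn_apply_eq_zero
      (fun e he h => (S.mem_of_inc_hard_or_jet he h).elim hx hxi) h1

theorem contractedJet_edgeSet (i : Fin K) : E(contractedJet G att mode i) = jetE mode i :=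
  edgeSet_contracted S.edgeSet _ _

theorem keep_att (i : Fin K) (h : (jetE mode i).Nonempty) :
    keep (jetVerts G att mode i) (att (Sum.inl i)) = some (att (Sum.inl i)) :=
  keep_of_mem (S.att_mem_jet h)

omit S in
theorem keep_hard {x : V} (hx : x ∈ hardVerts G att mode) (i : Fin K) :
    keep (jetVerts G att mode i) x = none := keep_of_notMem fun h => not_mem_hard_of_jet h hx

/-- Connectedness in the contracted jet. -/
theorem dl_keep_mem_contractedJet {i : Fin K} {X : Set E} {x y : V}
    (hx : x ∈ hardVerts G att mode ∨ x ∈ jetVerts G att mode i)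
    (hy : y ∈ hardVerts G att mode ∨ y ∈ jetVerts G att mode i) :
    dl (keep (jetVerts G att mode i) x) (keep (jetVerts G att mode i) y) ∈
      spn (bvec (contractedJet G att mode i)) X ↔
    dl x y ∈ spn (bvec G) (hardE mode ∪ (X ∩ jetE mode i)) := by
  rw [contractedJet, spn_contracted S.edgeSet, ← keepMap_dl, Submodule.mem_map]
  constructor
  · rintro ⟨z, hz, hzxy⟩
    -- The discrepancy between `δ_x + δ_y` and the lifted chain is invisible after contraction,
    -- hence vanishes at jet vertices. It is supported on `H`.
    have h1 : dl x y + z ∈ spn (bvec G) (hardE mode) := by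
      refine S.mem_spn_hardE (X := Set.univ)
        (Submodule.add_mem _ (S.dl_mem x y) (spn_mono _ (Set.subset_univ _) hz)) fun u hu => ?_
      by_cases hui : u ∈ jetVerts G att mode i
      · rw [← keepMap_apply_some hui, map_add, hzxy, add_self_eq_zero_zmod_two]
        rfl
      · have h2 : z u = 0 :=
          spn_apply_eq_zero (fun e he h => (S.mem_of_inc_jet he.2 h).elim hu hui) hz
        have hxu : x ≠ u := fun h => hx.elim (h ▸ hu) (h ▸ hui)
        have hyu : y ≠ u := fun h => hy.elim (h ▸ hu) (h ▸ hui)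
        simp [dl, h2, hxu, hyu]
    rw [spn_union]
    exact Submodule.mem_sup.2 ⟨_, h1, z, hz, by
      rw [add_assoc, add_self_eq_zero_zmod_two, add_zero]⟩
  · intro h
    rw [spn_union] at h
    obtain ⟨a, ha, b, hb, hab⟩ := Submodule.mem_sup.1 h
    refine ⟨b, hb, ?_⟩
    have : keepMap (jetVerts G att mode i) a = 0 :=
      keepMap_eq_zero (fun e he u hu h => not_mem_hard_of_jet hu (S.mem_hard_of_inc he h)) ha
    rw [← hab, map_add, this, zero_add]

theorem contractedJet_connected (i : Fin K) : IsConn (contractedJet G att mode i) := by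
  obtain ⟨w, hw⟩ : (hardVerts G att mode).Nonempty := S.config.hard_connected.1
  have key : ∀ y ∈ V(contractedJet G att mode i),
      dl none y ∈ spn (bvec (contractedJet G att mode i)) Set.univ := by
    intro y hy
    obtain ⟨x, rfl⟩ := mem_contracted hy
    by_cases hx : x ∈ jetVerts G att mode i
    · rw [← keep_hard hw i, S.dl_keep_mem_contractedJet (Or.inl hw) (Or.inr hx), Set.univ_inter]
      exact dl_mem_symm (S.dl_mem_jet_hard hx hw)
    · rw [keep_of_notMem hx]
      exact dl_self_mem _ _
  refine (isConn_iff _).2 ⟨⟨_, keep_mem_contracted S.vertexSet _ _ w⟩, fun x hx y hy => ?_⟩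
  exact dl_mem_trans (dl_mem_symm (key x hx)) (key y hy)

end Setup

/-! ### The requirement of the jets is necessary -/

section JetNecessity

variable {V E : Type} [Fintype E] {d K L : ℕ}

theorem Indep.spn_le_insert {v : E → V →₀ ZMod 2} {D X : Set E} (hD : Indep v D) (hDX : D ⊆ X)
    (hc : D.ncard + 1 = rk v X) {e : E} (he : e ∈ X) (heD : v e ∉ spn v D) :
    spn v X ≤ spn v (insert e D) := by
  refine (indep_insert hD heD).spn_le_of_ncard (spn_mono _ (Set.insert_subset he hDX)) ?_
  rw [Set.ncard_insert_of_notMem fun h => heD (mem_spn _ h), hc]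

theorem Indep.exists_not_mem_spn {v : E → V →₀ ZMod 2} {D X : Set E} (hD : Indep v D) (hDX : D ⊆ X)
    (hc : D.ncard < rk v X) : ∃ e ∈ X, v e ∉ spn v D :=
  OnShell.exists_not_mem_spn fun h => hc.ne (hD.ncard_eq (spn_mono _ hDX) h)

namespace Setup

variable {G : Graph V E} {att : Leg K L → V} {P : ℝ → Leg K L → Momentum d} {mode : E → Mode K}
variable (S : Setup G att P mode)

include S

theorem jet_component_subset {i : Fin K} {B : Set E}
    (hB : IsOneVIComponent (contractedJet G att mode i) B) : B ⊆ jetE mode i :=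
  S.contractedJet_edgeSet (att := att) i ▸ hB.1.2.1

/-- After contraction to `J̃_i` only the contributions of `B` and of the rest of the jet survive.
They agree, so they vanish by the separator property, and the contribution of `B` is supported on
`H`. -/
theorem jet_isSep_separates {i : Fin K} {B : Set E} (hBi : B ⊆ jetE mode i)
    (hB : IsSep (contractedJet G att mode i) B) :
    spn (bvec G) (hardE mode ∪ B) ⊓ spn (bvec G) (nonsoftE mode \ B) ≤
      spn (bvec G) (hardE mode) := by
  rintro z ⟨h1, h2⟩
  have hX : nonsoftE mode \ B ⊆ (nonsoftE mode \ jetE mode i) ∪ (jetE mode i \ B) := by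
    rintro e ⟨h, h'⟩
    by_cases hi : e ∈ jetE mode i
    · exact Or.inr ⟨hi, h'⟩
    · exact Or.inl ⟨h, hi⟩
  have h2' := spn_mono (bvec G) hX h2
  rw [spn_union] at h1 h2'
  obtain ⟨a, ha, b, hb, hab⟩ := Submodule.mem_sup.1 h1
  obtain ⟨c, hc, e, he, hce⟩ := Submodule.mem_sup.1 h2'
  have hka : keepMap (jetVerts G att mode i) a = 0 :=
    keepMap_eq_zero (fun e he u hu h => not_mem_hard_of_jet hu (S.mem_hard_of_inc he h)) ha
  have hkc : keepMap (jetVerts G att mode i) c = 0 :=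
    keepMap_eq_zero (fun e he u hu => not_inc_jetVerts he.1 he.2 hu) hc
  have hbe : keepMap (jetVerts G att mode i) b = keepMap (jetVerts G att mode i) e := by
    have := congrArg (keepMap (jetVerts G att mode i)) (hab.trans hce.symm)
    rwa [map_add, map_add, hka, hkc, zero_add, zero_add] at this
  have hb0 : keepMap (jetVerts G att mode i) b = 0 := by
    refine hB.eq_zero ?_ ?_
    · rw [contractedJet, spn_contracted S.edgeSet, Set.inter_eq_left.2 hBi]
      exact Submodule.mem_map_of_mem hb
    · rw [hbe, contractedJet, spn_contracted S.edgeSet, Set.inter_comm, ← Set.sdiff_eq]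
      exact Submodule.mem_map_of_mem he
  rw [← hab]
  refine Submodule.add_mem _ ha (S.mem_spn_hardE hb fun x hx => ?_)
  by_cases hxi : x ∈ jetVerts G att mode i
  · rw [← keepMap_apply_some hxi, hb0]
    rfl
  · exact spn_apply_eq_zero (fun e he h => (S.mem_of_inc_jet (hBi he) h).elim hx hxi) hb

/-- If `p_i` reaches `H` without using `B`, every external line but `p_k` does so without using the
jet `k` either. -/
theorem dl_att_hard_mem {i : Fin K} {B : Set E} (hBi : B ⊆ jetE mode i) {w : V}
    (hw : w ∈ hardVerts G att mode)
    (hp : dl (att (Sum.inl i)) w ∈ spn (bvec G) (hardE mode ∪ (jetE mode i \ B))) (l : Leg K L) :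
    dl (att l) w ∈ spn (bvec G) (hardE mode) ∨ ∃ j, l = Sum.inl j ∧
      dl (att l) w ∈ spn (bvec G) (hardE mode ∪ (jetE mode j \ B)) := by
  obtain h | ⟨j, rfl, h⟩ := S.att_cases l
  · exact Or.inl (S.dl_mem_hard h hw)
  · refine Or.inr ⟨j, rfl, ?_⟩
    by_cases hij : j = i
    · subst hij
      exact hp
    · have hsub : jetE mode j ⊆ jetE mode j \ B :=
        fun e he => ⟨he, fun h' => hij (jetE_inj he (hBi h'))⟩
      exact spn_mono _ (Set.union_subset_union_right _ hsub) (S.dl_mem_jet_hard h hw)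

omit S [Fintype E] in
theorem hard_subset_diff {B : Set E} {i : Fin K} (hBi : B ⊆ jetE mode i) :
    hardE mode ⊆ nonsoftE mode \ B :=
  fun _ he => ⟨hardE_subset mode he, fun h => not_mem_hardE_of_jet (hBi h) he⟩

variable [Nonempty V]

/-- By `hp`, `B` is not needed to join any external line to `H`. If `T` connected everything outside
`B`, all lines would be on one side and the invariant would vanish. -/
theorem not_spn_diff_le_of_term {i : Fin K} {B : Set E} (hBi : B ⊆ jetE mode i) {w : V}
    (hw : w ∈ hardVerts G att mode)
    (hp : dl (att (Sum.inl i)) w ∈ spn (bvec G) (hardE mode ∪ (jetE mode i \ B)))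
    {T : Set E} {n : ℕ} (hT : IsSpanningTwoTree G T)
    (h : (fun t => invariant G att (P t) T) =Θ[𝓝[>] (0 : ℝ)] (fun t => t ^ n)) :
    ¬ spn (bvec G) (nonsoftE mode \ B) ≤ spn (bvec G) T := by
  intro hle
  have key : ∀ l, dl (att l) w ∈ spn (bvec G) T := by
    intro l
    obtain h | ⟨j, -, h⟩ := S.dl_att_hard_mem hBi hw hp l
    · exact hle (spn_mono _ (hard_subset_diff hBi) h)
    · exact hle (spn_mono _ (Set.union_subset (hard_subset_diff hBi)
        (Set.sdiff_subset_sdiff_left (jetE_subset mode j))) h)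
  obtain ⟨-, l, hl⟩ := S.term_nonempty hT h w
  exact hl (dl_mem_symm (key l))

/-- A term of order one cannot lack just one edge to connect all external lines without using
`B`. -/
theorem not_spn_diff_le_insert_of_term {i : Fin K} {B : Set E} (hBi : B ⊆ jetE mode i) {w : V}
    (hw : w ∈ hardVerts G att mode)
    (hp : dl (att (Sum.inl i)) w ∈ spn (bvec G) (hardE mode ∪ (jetE mode i \ B)))
    {T : Set E} (hT : IsSpanningTwoTree G T)
    (h : (fun t => invariant G att (P t) T) =Θ[𝓝[>] (0 : ℝ)] (fun t => t ^ 0))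
    (hH : spn (bvec G) (hardE mode) ≤ spn (bvec G) (T ∩ hardE mode)) {e : E}
    (he : e ∈ nonsoftE mode)
    (heT : bvec G e ∉ spn (bvec G) (T ∩ nonsoftE mode)) :
    ¬ spn (bvec G) (nonsoftE mode \ B) ≤
      spn (bvec G) (insert e (T ∩ nonsoftE mode) ∩ (nonsoftE mode \ B)) := by
  intro hle
  obtain he' | ⟨k, hk⟩ := mem_nonsoftE_cases he
  · refine heT (spn_mono _ (Set.inter_subset_inter_right _ (hardE_subset mode)) (hH ?_))
    exact mem_spn _ he'
  have hi := indep_insert (hT.indep.mono Set.inter_subset_left) heT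
  -- The missing edge `e` is not hard, so it lies in some jet `k`. What remains of that jet hangs on
  -- `H`, so without it the rest is already connected in `T`, and so are all lines but `p_k`.
  have h1 := (hi.ncard_inter_separator (X := nonsoftE mode \ B) (Y := hardE mode)
    (B := jetE mode k \ B) (hard_subset_diff hBi)
    (Set.sdiff_subset_sdiff_left (jetE_subset mode k))
    (Set.disjoint_left.2 fun e h h' => not_mem_hardE_of_jet h.1 h') hle
    (hH.trans (spn_mono _ fun e he => ⟨Or.inr ⟨he.1, hardE_subset mode he.2⟩, he.2⟩)) ?_).2
  · have h2 : spn (bvec G) ((nonsoftE mode \ B) \ (jetE mode k \ B)) ≤ spn (bvec G) T := by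
      refine h1.trans (spn_mono _ ?_)
      rintro f ⟨rfl | hf, hf'⟩
      · exact absurd ⟨hk, hf'.1.2⟩ hf'.2
      · exact hf.1
    have key : ∀ l, l ≠ Sum.inl k → dl (att l) w ∈ spn (bvec G) T := by
      intro l hl
      have hsub : hardE mode ⊆ (nonsoftE mode \ B) \ (jetE mode k \ B) :=
        fun e he => ⟨hard_subset_diff hBi he, fun h => not_mem_hardE_of_jet h.1 he⟩
      obtain h | ⟨j, rfl, h⟩ := S.dl_att_hard_mem hBi hw hp l
      · exact h2 (spn_mono _ hsub h)
      · refine h2 (spn_mono _ (Set.union_subset hsub ?_) h)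
        refine fun e he => ⟨⟨jetE_subset mode j he.1, he.2⟩, fun h => hl ?_⟩
        rw [jetE_inj h.1 he.1]
    obtain ⟨l, l', hl, hl', hll⟩ := S.term_exists_not_connected hT h k
    exact hll (dl_mem_trans (key l hl) (dl_mem_symm (key l' hl')))
  · refine le_trans (inf_le_inf (spn_mono _ ?_) (spn_mono _ ?_)) (S.jet_separates k)
    · exact Set.union_subset_union_right _ Set.sdiff_subset
    · rintro f ⟨h, h'⟩
      exact ⟨h.1, fun hf => h' ⟨hf, h.2⟩⟩

/-- Every 1VI component of a contracted jet separates `p_i` from the auxiliary vertex. -/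
theorem not_dl_mem_of_jet_component (hF : FacetCondition G att P mode) {i : Fin K} {B : Set E}
    (hB : IsOneVIComponent (contractedJet G att mode i) B) :
    dl (some (att (Sum.inl i))) none ∉ spn (bvec (contractedJet G att mode i)) Bᶜ := by
  intro hcon
  have hBi := S.jet_component_subset hB
  have hne : (jetE mode i).Nonempty := hB.1.1.mono hBi
  obtain ⟨w, hw⟩ : (hardVerts G att mode).Nonempty := S.config.hard_connected.1
  have hp : dl (att (Sum.inl i)) w ∈ spn (bvec G) (hardE mode ∪ (jetE mode i \ B)) := by
    rw [← S.keep_att i hne, ← keep_hard hw i,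
      S.dl_keep_mem_contractedJet (Or.inr (S.att_mem_jet hne)) (Or.inl hw), Set.inter_comm,
      ← Set.sdiff_eq] at hcon
    exact hcon
  have hsep := S.jet_isSep_separates hBi hB.isSep
  -- Any forest containing bases of `H` and of the nonsoft graph has a fixed number of edges in `B`
  -- and spans everything nonsoft outside `B`.
  have key : ∀ D, Indep (bvec G) D → spn (bvec G) (nonsoftE mode) ≤ spn (bvec G) (D ∩ nonsoftE mode) →
      spn (bvec G) (hardE mode) ≤ spn (bvec G) (D ∩ hardE mode) →
      (D ∩ B).ncard = rk (bvec G) (hardE mode ∪ B) - rk (bvec G) (hardE mode) ∧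
        spn (bvec G) (nonsoftE mode \ B) ≤ spn (bvec G) (D ∩ (nonsoftE mode \ B)) := by
    intro D h1 h2 h3
    obtain ⟨h4, h5⟩ := h1.ncard_inter_separator (hardE_subset mode)
      (hBi.trans (jetE_subset mode i))
      (Set.disjoint_left.2 fun e h h' => not_mem_hardE_of_jet (hBi h) h') h2 h3 hsep
    exact ⟨by omega, h5⟩
  obtain ⟨⟨T, n⟩, hx, hne⟩ := hF.exists_ncard_ne hB.1.1
    (rk (bvec G) (hardE mode ∪ B) - rk (bvec G) (hardE mode))
  have hBT : ∀ X : Set E, (X ∩ nonsoftE mode) ∩ B = X ∩ B := fun X => by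
    rw [Set.inter_assoc, Set.inter_eq_right.2 (hBi.trans (jetE_subset mode i))]
  obtain h | ⟨h1, h2, h⟩ := S.minTerms_cases hx
  · exact hne (key T h.indep h.nonsoft h.hard).1
  have hi : Indep (bvec G) (T ∩ nonsoftE mode) := h1.indep.mono Set.inter_subset_left
  have hiH : Indep (bvec G) (T ∩ hardE mode) := h1.indep.mono Set.inter_subset_left
  have hTns : T ∩ nonsoftE mode ⊆ nonsoftE mode := Set.inter_subset_right
  have hfull : (T ∩ hardE mode).ncard = rk (bvec G) (hardE mode) →
      spn (bvec G) (hardE mode) ≤ spn (bvec G) (T ∩ hardE mode) :=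
    fun hc => hiH.spn_le_of_ncard (spn_mono _ Set.inter_subset_right) hc.ge
  obtain ⟨h3, h4⟩ | ⟨rfl, h3, h4⟩ | ⟨rfl, h3, h4⟩ := h
  -- One nonsoft edge is missing. The wrong count in `B` puts it in `B`, so `T` spans the nonsoft
  -- edges outside `B`.
  · obtain ⟨e, he, heT⟩ := hi.exists_not_mem_spn hTns (by omega)
    have hspan := hi.spn_le_insert hTns h4 he heT
    obtain ⟨h5, h6⟩ := key _ (indep_insert hi heT) (by
      rwa [Set.inter_eq_left.2 (Set.insert_subset he hTns)])
      ((hfull h3).trans (spn_mono _ fun f hf => ⟨Or.inr ⟨hf.1, hardE_subset mode hf.2⟩, hf.2⟩))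
    have heB : e ∈ B := by
      by_contra heB
      rw [Set.insert_inter_of_notMem heB, hBT] at h5
      exact hne h5
    refine S.not_spn_diff_le_of_term hBi hw hp h1 h2 (h6.trans (spn_mono _ ?_))
    rintro f ⟨rfl | hf, hf'⟩
    · exact absurd heB hf'.2
    · exact hf.1
  -- The missing edge can be chosen hard, hence outside `B`. The count of `T` in `B` would then be
  -- the standard one.
  · obtain ⟨e, he, heT⟩ := OnShell.exists_not_mem_spn (S.not_hard_le_of_term h1 h2 h4)
    have hspan := hi.spn_le_insert hTns h4 (hardE_subset mode he) heT
    have heTH : bvec G e ∉ spn (bvec G) (T ∩ hardE mode) := fun h =>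
      heT (spn_mono _ (Set.inter_subset_inter_right _ (hardE_subset mode)) h)
    have hspanH := hiH.spn_le_insert Set.inter_subset_right h3 he heTH
    have h5 := (key _ (indep_insert hi heT) (by
      rwa [Set.inter_eq_left.2 (Set.insert_subset (hardE_subset mode he) hTns)])
      (hspanH.trans (spn_mono _ (by
        rintro f (rfl | hf)
        · exact ⟨Or.inl rfl, he⟩
        · exact ⟨Or.inr ⟨hf.1, hardE_subset mode hf.2⟩, hf.2⟩)))).1
    rw [Set.insert_inter_of_notMem fun h => not_mem_hardE_of_jet (hBi h) he, hBT] at h5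
    exact hne h5
  -- Two nonsoft edges are missing, at least one of them in `B` because of the count. Then at most
  -- one edge is missing outside `B`, too few for an invariant of order one.
  · obtain ⟨e₁, he₁, heT₁⟩ := hi.exists_not_mem_spn hTns (by omega)
    have hi₁ := indep_insert hi heT₁
    have hsub₁ := Set.insert_subset he₁ hTns
    have hc₁ : (insert e₁ (T ∩ nonsoftE mode)).ncard + 1 = rk (bvec G) (nonsoftE mode) := by
      rw [Set.ncard_insert_of_notMem fun h => heT₁ (mem_spn _ h)]
      omega
    obtain ⟨e₂, he₂, heT₂⟩ := hi₁.exists_not_mem_spn hsub₁ (by omega)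
    have hspan := hi₁.spn_le_insert hsub₁ hc₁ he₂ heT₂
    have heT₂' : bvec G e₂ ∉ spn (bvec G) (T ∩ nonsoftE mode) := fun h =>
      heT₂ (spn_mono _ (Set.subset_insert _ _) h)
    obtain ⟨h5, h6⟩ := key _ (indep_insert hi₁ heT₂) (by
      rwa [Set.inter_eq_left.2 (Set.insert_subset he₂ hsub₁)])
      ((hfull h3).trans (spn_mono _ fun f hf =>
        ⟨Or.inr (Or.inr ⟨hf.1, hardE_subset mode hf.2⟩), hf.2⟩))
    by_cases hB₁ : e₁ ∈ B <;> by_cases hB₂ : e₂ ∈ B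
    · refine S.not_spn_diff_le_of_term hBi hw hp h1 h2 (h6.trans (spn_mono _ ?_))
      rintro f ⟨rfl | rfl | hf, hf'⟩
      · exact absurd hB₂ hf'.2
      · exact absurd hB₁ hf'.2
      · exact hf.1
    · refine S.not_spn_diff_le_insert_of_term hBi hw hp h1 h2 (hfull h3) he₂ heT₂'
        (h6.trans (spn_mono _ ?_))
      rintro f ⟨rfl | rfl | hf, hf'⟩
      · exact ⟨Or.inl rfl, hf'⟩
      · exact absurd hB₁ hf'.2
      · exact ⟨Or.inr hf, hf'⟩
    · refine S.not_spn_diff_le_insert_of_term hBi hw hp h1 h2 (hfull h3) he₁ heT₁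
        (h6.trans (spn_mono _ ?_))
      rintro f ⟨rfl | rfl | hf, hf'⟩
      · exact absurd hB₂ hf'.2
      · exact ⟨Or.inl rfl, hf'⟩
      · exact ⟨Or.inr hf, hf'⟩
    · rw [Set.insert_inter_of_notMem hB₂, Set.insert_inter_of_notMem hB₁, hBT] at h5
      exact hne h5

/-- Each end of a propagator of the reduced form of a contracted jet is on the side of `p_i` or on
that of the auxiliary vertex. -/
theorem dl_mem_of_jet_belongsTo (hF : FacetCondition G att P mode) {i : Fin K}
    {f : E ⊕ (Set E × Option V)} {B : Set E} {v : Option V}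
    (hf : BelongsTo (contractedJet G att mode i) ∅ f B v) :
    dl v (some (att (Sum.inl i))) ∈ spn (bvec (contractedJet G att mode i)) Bᶜ ∨
      dl v none ∈ spn (bvec (contractedJet G att mode i)) Bᶜ := by
  by_contra hcon
  push Not at hcon
  have hΓ := S.contractedJet_connected i
  have hne : (jetE mode i).Nonempty := hf.component.1.1.mono (S.jet_component_subset hf.component)
  obtain ⟨w, hw⟩ : (hardVerts G att mode).Nonempty := S.config.hard_connected.1
  have hn : none ∈ V(contractedJet G att mode i) :=
    keep_hard hw i ▸ keep_mem_contracted S.vertexSet _ _ w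
  have hp : some (att (Sum.inl i)) ∈ V(contractedJet G att mode i) :=
    S.keep_att i hne ▸ keep_mem_contracted S.vertexSet _ _ (att (Sum.inl i))
  have hv : v ∈ V(contractedJet G att mode i) := by
    obtain ⟨e, -, h⟩ := hf.mem_ends
    exact h.vertex_mem
  obtain ⟨e, -, rfl, -⟩ | ⟨-, -, hsh⟩ := hf.kind
  · refine S.not_dl_mem_of_jet_component hF hf.component ?_
    -- Both `p_i` and the auxiliary vertex lie beyond the bridge `e`, so they are connected to each
    -- other without it.
    have key : ∀ u ∈ V(contractedJet G att mode i),
        dl v u ∉ spn (bvec (contractedJet G att mode i)) {e}ᶜ →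
        dl v u + bvec (contractedJet G att mode i) e ∈
          spn (bvec (contractedJet G att mode i)) {e}ᶜ := by
      intro u hu hvu
      have := ((isConn_iff _).1 hΓ).2 v hv u hu
      rw [show (Set.univ : Set E) = insert e {e}ᶜ by
        ext x; simp [Classical.em], dl_mem_insert_iff] at this
      exact this.resolve_left hvu
    have := Submodule.add_mem _ (key _ hp hcon.1) (key _ hn hcon.2)
    rwa [add_add_add_comm, add_self_eq_zero_zmod_two, add_zero, dl_comm v, dl_add_dl] at this
  · obtain ⟨B₁, B₂, h1, h2, hne, hv1, hv2⟩ | h := hsh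
    · obtain ⟨B', hB', hne', hv'⟩ : ∃ B', IsOneVIComponent (contractedJet G att mode i) B' ∧
          B ≠ B' ∧ v ∈ endsOf (contractedJet G att mode i) B' := by
        by_cases h : B = B₁
        · exact ⟨B₂, h2, h ▸ hne, hv2⟩
        · exact ⟨B₁, h1, h, hv1⟩
      -- Both lie beyond `B`, hence both are connected to `v` without `B'`. Then `B'` would not
      -- separate `p_i` from the auxiliary vertex.
      refine S.not_dl_mem_of_jet_component hF hB' ?_
      exact dl_mem_trans (dl_mem_symm (connected_avoiding_branch hΓ hf.component hB' hne'
        hf.mem_ends hv' hp hcon.1)) (connected_avoiding_branch hΓ hf.component hB' hne'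
        hf.mem_ends hv' hn hcon.2)
    · exact h

variable [Fintype V]

open Classical in
omit S [Fintype E] [Nonempty V] in
theorem sum_jetInflow (p : Leg K L → Momentum d) (i : Fin K) (Q : Option V → Prop)
    [DecidablePred Q] :
    ∑ w, (if Q w then jetInflow att p i w else 0) =
      (if Q (some (att (Sum.inl i))) then p (Sum.inl i) else 0) -
        if Q none then p (Sum.inl i) else 0 := by
  rw [Fintype.sum_option, add_comm, sub_eq_add_neg]
  congr 1
  · rw [Finset.sum_eq_single (att (Sum.inl i))]
    · simp [jetInflow]
    · intro b _ hb
      simp [jetInflow, Ne.symm hb]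
    · simp
  · by_cases h : Q none <;> simp [h, jetInflow]

/-- Each component separates `p_i` from the auxiliary vertex, where it leaves. The branch at `v`
contains exactly one of the two, so the propagator carries `p_i`; which one decides the direction,
hence the choice of end. -/
theorem requirementJ (hF : FacetCondition G att P mode) : RequirementJ G att mode P := by
  classical
  intro i f hf
  obtain ⟨B, v, hBv⟩ := exists_belongsTo hf
  have hΓ := S.contractedJet_connected i
  have hne : (jetE mode i).Nonempty :=
    hBv.component.1.1.mono (S.jet_component_subset hBv.component)
  obtain ⟨w, hw⟩ : (hardVerts G att mode).Nonempty := S.config.hard_connected.1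
  have hn : none ∈ V(contractedJet G att mode i) :=
    keep_hard hw i ▸ keep_mem_contracted S.vertexSet _ _ w
  have hp : some (att (Sum.inl i)) ∈ V(contractedJet G att mode i) :=
    S.keep_att i hne ▸ keep_mem_contracted S.vertexSet _ _ (att (Sum.inl i))
  obtain ⟨x, y, hxy, hx, hy⟩ := hBv.carried_cases hΓ (P := Momentum d)
  have hsep := S.not_dl_mem_of_jet_component hF hBv.component
  obtain h | h := S.dl_mem_of_jet_belongsTo hF hBv
  · have h' : dl v none ∉ spn (bvec (contractedJet G att mode i)) Bᶜ :=
      fun h' => hsep (dl_mem_trans (dl_mem_symm h) h')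
    refine ⟨x, hxy.inc_left, fun t => ?_⟩
    rw [hx, BelongsTo.branchSum, sum_jetInflow (P t) i (fun w => w ∈ V(contractedJet G att mode i) ∧
      dl v w ∈ spn (bvec (contractedJet G att mode i)) Bᶜ), if_pos ⟨hp, h⟩, if_neg fun h => h' h.2, sub_zero]
  · have h' : dl v (some (att (Sum.inl i))) ∉ spn (bvec (contractedJet G att mode i)) Bᶜ :=
      fun h' => hsep (dl_mem_trans (dl_mem_symm h') h)
    refine ⟨y, hxy.inc_right, fun t => ?_⟩
    rw [hy, BelongsTo.branchSum, sum_jetInflow (P t) i (fun w => w ∈ V(contractedJet G att mode i) ∧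
      dl v w ∈ spn (bvec (contractedJet G att mode i)) Bᶜ), if_neg fun h => h' h.2, if_pos ⟨hn, h⟩, zero_sub,
      neg_neg]
    rw [sum_jetInflow, if_pos hp, if_pos hn, sub_self]

end Setup

end JetNecessity

/-! ### The requirement of the soft subgraph is necessary -/

section SoftNecessity

variable {V E : Type} [Fintype E] {d K L : ℕ}

/-- The soft edges. -/
abbrev softE (mode : E → Mode K) : Set E := edgesOf mode Mode.soft

omit [Fintype E] in
theorem not_mem_nonsoftE {mode : E → Mode K} {e : E} (h : e ∈ softE mode) : e ∉ nonsoftE mode :=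
  fun h' => h' h

omit [Fintype E] in
theorem mem_nonsoftE_or_softE (mode : E → Mode K) (e : E) : e ∈ nonsoftE mode ∨ e ∈ softE mode :=
  (em (mode e = Mode.soft)).symm

omit [Fintype E] in
theorem IsSoftComponent.subset {G : Graph V E} {att : Leg K L → V} {mode : E → Mode K} {C : Set E}
    (hC : IsSoftComponent G att mode C) : C ⊆ softE mode := by
  obtain ⟨e, he, rfl⟩ := hC
  intro f hf
  obtain rfl | ⟨g, -, h⟩ := Relation.ReflTransGen.cases_tail hf
  · exact he
  · exact h.2.1

omit [Fintype E] in
theorem IsSoftComponent.nonempty {G : Graph V E} {att : Leg K L → V} {mode : E → Mode K} {C : Set E}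
    (hC : IsSoftComponent G att mode C) : C.Nonempty := by
  obtain ⟨e, he, rfl⟩ := hC
  exact ⟨e, Relation.ReflTransGen.refl⟩

omit [Fintype E] in
theorem IsSoftComponent.mem_of_inc {G : Graph V E} {att : Leg K L → V} {mode : E → Mode K}
    {C : Set E} (hC : IsSoftComponent G att mode C) {f g : E} (hf : f ∈ C) {x : V}
    (hx : x ∈ softVerts G att mode) (hfx : G.Inc f x) (hgx : G.Inc g x) : g ∈ C := by
  have hfs := hC.subset hf
  obtain ⟨e, he, rfl⟩ := hC
  exact Relation.ReflTransGen.tail hf ⟨hfs, hx.2.1 g hgx, x, hx, hfx, hgx⟩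

namespace Setup

variable {G : Graph V E} {att : Leg K L → V} {P : ℝ → Leg K L → Momentum d} {mode : E → Mode K}
variable (S : Setup G att P mode)

include S

/-- The only relations of a component of `S` with the other edges come from the nonsoft graph. -/
theorem soft_separates {C : Set E} (hC : IsSoftComponent G att mode C) :
    spn (bvec G) (nonsoftE mode ∪ C) ⊓ spn (bvec G) (Set.univ \ C) ≤
      spn (bvec G) (nonsoftE mode) := by
  rintro z ⟨h1, h2⟩
  refine S.mem_spn_nonsoftE h1 fun x hx => ?_
  by_cases hxC : ∃ f ∈ C, G.Inc f x
  · obtain ⟨f, hf, hfx⟩ := hxC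
    exact spn_apply_eq_zero (fun g hg hgx => hg.2 (hC.mem_of_inc hf hx hfx hgx)) h2
  · refine spn_apply_eq_zero ?_ h1
    rintro g (hg | hg) hgx
    · exact not_mem_soft_of_inc hg hgx hx
    · exact hxC ⟨g, hg, hgx⟩

theorem dl_mem_hard_or_jet {i : Fin K} {x y : V}
    (hx : x ∈ hardVerts G att mode ∨ x ∈ jetVerts G att mode i)
    (hy : y ∈ hardVerts G att mode ∨ y ∈ jetVerts G att mode i) :
    dl x y ∈ spn (bvec G) (hardE mode ∪ jetE mode i) := by
  obtain ⟨w, hw⟩ : (hardVerts G att mode).Nonempty := S.config.hard_connected.1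
  have key : ∀ z, z ∈ hardVerts G att mode ∨ z ∈ jetVerts G att mode i →
      dl z w ∈ spn (bvec G) (hardE mode ∪ jetE mode i) := fun z hz => hz.elim
    (fun hz => spn_mono _ Set.subset_union_left (S.dl_mem_hard hz hw))
    fun hz => S.dl_mem_jet_hard hz hw
  exact dl_mem_trans (key x hx) (dl_mem_symm (key y hy))

variable [Nonempty V]

/-- In a term of order one, removing the edges of a jet disconnects the other external lines. -/
theorem not_spn_diff_jet_le_of_term {T : Set E} (hT : IsSpanningTwoTree G T)
    (h : (fun t => invariant G att (P t) T) =Θ[𝓝[>] (0 : ℝ)] (fun t => t ^ 0)) (k : Fin K) :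
    ¬ spn (bvec G) (nonsoftE mode \ jetE mode k) ≤ spn (bvec G) T := by
  intro hle
  obtain ⟨w, hw⟩ : (hardVerts G att mode).Nonempty := S.config.hard_connected.1
  have hsub : hardE mode ⊆ nonsoftE mode \ jetE mode k :=
    fun e he => ⟨hardE_subset mode he, fun h => not_mem_hardE_of_jet h he⟩
  have key : ∀ l, l ≠ Sum.inl k → dl (att l) w ∈ spn (bvec G) T := by
    intro l hl
    obtain h | ⟨j, rfl, h⟩ := S.att_cases l
    · exact hle (spn_mono _ hsub (S.dl_mem_hard h hw))
    · have hj : jetE mode j ⊆ nonsoftE mode \ jetE mode k :=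
        fun e he => ⟨jetE_subset mode j he, fun h => hl (by rw [jetE_inj h he])⟩
      exact hle (spn_mono _ (Set.union_subset hsub hj) (S.dl_mem_jet_hard h hw))
  obtain ⟨l, l', hl, hl', hll⟩ := S.term_exists_not_connected hT h k
  exact hll (dl_mem_trans (key l hl) (dl_mem_symm (key l' hl')))

/-- If `C` touches at most one jet, every minimal term has the standard number of edges in `C`. The
only serious case is a 2-tree lacking two nonsoft edges `e₁`, `e₂`: there `C` can replace only an
edge of the one jet it touches, and this does not produce an invariant of order one. -/
theorem requirementS (hF : FacetCondition G att P mode) : RequirementS G att mode := by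
  intro C hC
  by_contra hcon
  have hCs := hC.subset
  have hCn : ∀ e ∈ nonsoftE mode, e ∉ C := fun e he h => he (hCs h)
  have hatt : ∀ k : Fin K, ∃ i, ∀ f ∈ C, ∀ x, G.Inc f x → x ∉ softVerts G att mode →
      x ∈ hardVerts G att mode ∨ x ∈ jetVerts G att mode i := by
    intro k
    by_cases h : ∃ i, ∃ e ∈ C, ∃ v ∈ jetVerts G att mode i, G.Inc e v
    · obtain ⟨i, e, he, v, hv, hev⟩ := h
      refine ⟨i, fun f hf x hfx hx => (S.not_mem_soft_cases hx).imp_right ?_⟩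
      rintro ⟨j, hj⟩
      by_cases hij : i = j
      · exact hij ▸ hj
      · exact absurd ⟨i, j, hij, ⟨e, he, v, hv, hev⟩, ⟨f, hf, x, hj, hfx⟩⟩ hcon
    · refine ⟨k, fun f hf x hfx hx => (S.not_mem_soft_cases hx).imp_right ?_⟩
      rintro ⟨j, hj⟩
      exact absurd ⟨j, f, hf, x, hj, hfx⟩ h
  have key : ∀ D, Indep (bvec G) D → spn (bvec G) Set.univ ≤ spn (bvec G) D →
      spn (bvec G) (nonsoftE mode) ≤ spn (bvec G) (D ∩ nonsoftE mode) →
      (D ∩ C).ncard = rk (bvec G) (nonsoftE mode ∪ C) - rk (bvec G) (nonsoftE mode) := by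
    intro D h1 h2 h3
    have h4 := (h1.ncard_inter_separator (X := Set.univ) (Y := nonsoftE mode) (B := C)
      (Set.subset_univ _) (Set.subset_univ _)
      (Set.disjoint_left.2 fun e h h' => h' (hCs h)) (by rwa [Set.inter_univ]) h3
      (S.soft_separates hC)).1
    omega
  obtain ⟨⟨T, n⟩, hx, hne⟩ := hF.exists_ncard_ne hC.nonempty
    (rk (bvec G) (nonsoftE mode ∪ C) - rk (bvec G) (nonsoftE mode))
  obtain h | ⟨h1, h2, h⟩ := S.minTerms_cases hx
  · exact hne (key T h.indep h.span h.nonsoft)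
  have hi : Indep (bvec G) (T ∩ nonsoftE mode) := h1.indep.mono Set.inter_subset_left
  have hTns : T ∩ nonsoftE mode ⊆ nonsoftE mode := Set.inter_subset_right
  obtain ⟨e₁, he₁, heT₁⟩ := exists_not_mem_spn (S.not_spn_le_of_term h1 h2)
  have heT₁' : bvec G e₁ ∉ spn (bvec G) (T ∩ nonsoftE mode) := fun h =>
    heT₁ (spn_mono _ Set.inter_subset_left h)
  have hi₁ := indep_insert h1.indep heT₁
  have hspan₁ := h1.spn_insert heT₁
  have hT₁ns : insert e₁ T ∩ nonsoftE mode = insert e₁ (T ∩ nonsoftE mode) :=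
    Set.insert_inter_of_mem he₁
  -- When a single nonsoft edge is missing, it restores an optimal tree and lies outside `C`, so the
  -- count in `C` is standard.
  have hcorank : (T ∩ nonsoftE mode).ncard + 1 = rk (bvec G) (nonsoftE mode) → False := by
    intro hc
    have h5 := key _ hi₁ hspan₁ (by
      rw [hT₁ns]
      exact hi.spn_le_insert hTns hc he₁ heT₁')
    rw [Set.insert_inter_of_notMem (hCn _ he₁)] at h5
    exact hne h5
  obtain ⟨-, h4⟩ | ⟨-, -, h4⟩ | ⟨rfl, h3, h4⟩ := h
  · exact hcorank h4
  · exact hcorank h4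
  have hH : spn (bvec G) (hardE mode) ≤ spn (bvec G) (T ∩ hardE mode) :=
    Indep.spn_le_of_ncard (h1.indep.mono Set.inter_subset_left)
      (spn_mono _ Set.inter_subset_right) h3.ge
  have hHns : T ∩ hardE mode ⊆ T ∩ nonsoftE mode :=
    Set.inter_subset_inter_right _ (hardE_subset mode)
  have hD₁ := indep_insert hi heT₁'
  have hsub₁ := Set.insert_subset he₁ hTns
  have hc₁ : (insert e₁ (T ∩ nonsoftE mode)).ncard + 1 = rk (bvec G) (nonsoftE mode) := by
    rw [Set.ncard_insert_of_notMem fun h => heT₁' (mem_spn _ h)]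
    omega
  obtain ⟨e₂, he₂, heT₂⟩ := hD₁.exists_not_mem_spn hsub₁ (by omega)
  have hD₂ := indep_insert hD₁ heT₂
  have hsub₂ := Set.insert_subset he₂ hsub₁
  have hspan₂ := hD₁.spn_le_insert hsub₁ hc₁ he₂ heT₂
  set D₁ : Set E := insert e₁ (T ∩ nonsoftE mode)
  set D₂ : Set E := insert e₂ D₁
  have hHD₁ : T ∩ hardE mode ⊆ D₁ := hHns.trans (Set.subset_insert _ _)
  have hHD₂ : T ∩ hardE mode ⊆ D₂ := hHD₁.trans (Set.subset_insert _ _)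
  obtain ⟨c, hc, hcs⟩ := (mem_spn_iff _ _ _).1 (hspan₁ (mem_spn (bvec G) (Set.mem_univ e₂)))
  -- Consider the circuit of `e₂` in the tree `T ∪ {e₁}`. A soft edge of it outside `C` could be
  -- exchanged for `e₂`, giving a tree that spans the nonsoft part and has the same count in `C` as
  -- `T`. So the soft edges of the circuit lie in `C`.
  have hcC : ∀ f, c f ≠ 0 → f ∈ D₁ ∪ (T ∩ C) := by
    intro f hf
    have hfT : f ∈ insert e₁ T := by
      by_contra hfT
      exact hf (hc f hfT)
    obtain hfn | hfs := mem_nonsoftE_or_softE mode f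
    · exact Or.inl (hT₁ns ▸ ⟨hfT, hfn⟩)
    by_contra hfC
    have hfe₁ : f ≠ e₁ := fun h => he₁ (h ▸ hfs)
    have hex : bvec G e₂ ∉ spn (bvec G) (insert e₁ T \ {f}) := hcs ▸ hi₁.not_mem_spn_diff hc hf
    have hns : insert e₂ (insert e₁ T \ {f}) ∩ nonsoftE mode = D₂ := by
      rw [Set.insert_inter_of_mem he₂, Set.sdiff_inter_right_comm, hT₁ns,
        Set.sdiff_singleton_eq_self fun h => not_mem_nonsoftE hfs (hsub₁ h)]
    have h5 := key _ (indep_insert (hi₁.mono Set.sdiff_subset) hex)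
      (hspan₁.trans (spn_le_exchange (hspan₁ (mem_spn (bvec G) (Set.mem_univ e₂))) hex))
      (by rwa [hns])
    rw [Set.insert_inter_of_notMem (hCn _ he₂), Set.sdiff_inter_right_comm,
      Set.insert_inter_of_notMem (hCn _ he₁),
      Set.sdiff_singleton_eq_self fun h => hfC (Or.inr h)] at h5
    exact hne h5
  have he₂mem : bvec G e₂ ∈ spn (bvec G) (D₁ ∪ (T ∩ C)) :=
    (mem_spn_iff _ _ _).2 ⟨c, fun f hf => by
      by_contra h
      exact hf (hcC f h), hcs⟩
  rw [spn_union] at he₂mem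
  obtain ⟨a, ha, b, hb, hab⟩ := Submodule.mem_sup.1 he₂mem
  have hb' : b = bvec G e₂ + a := by
    rw [← hab, add_comm, ← add_assoc, add_self_eq_zero_zmod_two, zero_add]
  obtain ⟨k₂, hk₂⟩ : ∃ k, e₂ ∈ jetE mode k := (mem_nonsoftE_cases he₂).resolve_left fun h =>
    heT₂ (spn_mono _ hHD₁ (hH (mem_spn _ h)))
  obtain ⟨k₁, hk₁⟩ : ∃ k, e₁ ∈ jetE mode k := (mem_nonsoftE_cases he₁).resolve_left fun h =>
    heT₁' (spn_mono _ hHns (hH (mem_spn _ h)))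
  obtain ⟨i, hi'⟩ := hatt k₂
  have hbns : b ∈ spn (bvec G) (nonsoftE mode) := by
    rw [hb']
    exact Submodule.add_mem _ (mem_spn _ he₂) (spn_mono _ hsub₁ ha)
  -- The contribution `b` of `C` has its boundary on nonsoft vertices touched by `C`, that is on `H
  -- ∪ J_i`, which is connected.
  have hbi : b ∈ spn (bvec G) (hardE mode ∪ jetE mode i) := by
    refine mem_of_spn_of_support (Z := {x | x ∈ hardVerts G att mode ∨ x ∈ jetVerts G att mode i})
      hb (fun x hx y hy => S.dl_mem_hard_or_jet hx hy) fun x hx => ?_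
    by_cases hxs : x ∈ softVerts G att mode
    · exact spn_apply_eq_zero (fun e he h => not_mem_soft_of_inc he h hxs) hbns
    · exact spn_apply_eq_zero (fun e he h => hx (hi' e he.2 x h hxs)) hb
  have hHi : hardE mode ∪ jetE mode i ⊆ nonsoftE mode :=
    Set.union_subset (hardE_subset mode) (jetE_subset mode i)
  have hbi' : b ∈ spn (bvec G) (D₂ ∩ (hardE mode ∪ jetE mode i)) := by
    have := (hD₂.ncard_inter_separator (X := nonsoftE mode) (Y := hardE mode)
      (B := nonsoftE mode \ (hardE mode ∪ jetE mode i)) (hardE_subset mode) Set.sdiff_subset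
      (Set.disjoint_left.2 fun e h h' => h.2 (Or.inl h'))
      (by rwa [Set.inter_eq_left.2 hsub₂])
      (hH.trans (spn_mono _ fun e he => ⟨hHD₂ he, he.2⟩)) ?_).2
    · rw [Set.sdiff_sdiff_cancel_left hHi] at this
      exact this hbi
    · rw [Set.sdiff_sdiff_cancel_left hHi, inf_comm]
      refine le_trans (inf_le_inf le_rfl (spn_mono _ ?_)) (S.jet_separates i)
      rintro e (he | he)
      · exact ⟨hardE_subset mode he, fun h => not_mem_hardE_of_jet h he⟩
      · exact ⟨he.1, fun h => he.2 (Or.inr h)⟩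
  -- `b` is a combination of basis edges in `H ∪ J_i`. If `e₂` were not among them, `b` and `a`
  -- would express it through the other basis edges.
  have he₂i : e₂ ∈ jetE mode i := by
    by_contra he₂i
    refine heT₂ (hab ▸ Submodule.add_mem _ ha (spn_mono _ ?_ hbi'))
    rintro f ⟨rfl | hf, hf'⟩
    · exact absurd hf' fun h => h.elim (not_mem_hardE_of_jet hk₂) he₂i
    · exact hf
  have hrest := (hD₂.ncard_inter_separator (X := nonsoftE mode) (Y := hardE mode)
    (B := jetE mode k₁) (hardE_subset mode) (jetE_subset mode k₁)
    (Set.disjoint_left.2 fun e h h' => not_mem_hardE_of_jet h h')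
    (by rwa [Set.inter_eq_left.2 hsub₂])
    (hH.trans (spn_mono _ fun e he => ⟨hHD₂ he, he.2⟩)) (S.jet_separates k₁)).2
  -- Outside the jet of `e₁`, only `e₂` is not itself in `T`. But then `a` lies in `H ∪ J_i` and
  -- does not use `e₁`, so `e₂ = a + b` is spanned by `T`.
  refine S.not_spn_diff_jet_le_of_term h1 h2 k₁ (hrest.trans (spn_le _ ?_))
  rintro f ⟨rfl | rfl | hf, hf'⟩
  · have hki : k₁ ≠ i := by
      rintro rfl
      exact hf'.2 he₂i
    have ha' : a ∈ spn (bvec G) (D₂ ∩ (hardE mode ∪ jetE mode i)) := by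
      have : a = b + bvec G f := by
        rw [hb', add_right_comm, add_self_eq_zero_zmod_two, zero_add]
      rw [this]
      exact Submodule.add_mem _ hbi' (mem_spn _ ⟨Or.inl rfl, Or.inr he₂i⟩)
    rw [← hab]
    refine Submodule.add_mem _ (spn_mono _ ?_ (hD₂.mem_spn_inter (Set.subset_insert _ _)
      Set.inter_subset_left ha ha')) (spn_mono _ Set.inter_subset_left hb)
    rintro g ⟨rfl | hg, -, hg'⟩
    · obtain h | h := hg'
      · exact absurd h (not_mem_hardE_of_jet hk₁)
      · exact absurd (jetE_inj hk₁ h) hki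
    · exact hg.1
  · exact absurd hk₁ hf'.2
  · exact mem_spn _ hf.1

end Setup

end SoftNecessity

/-! ### Linear forms that are constant on the minimal terms -/

section ConstantForms

/-- If every vector is a combination of those elements of the basis `T` that are in `X` if and only
if it is itself, relations can be restricted to `X`. -/
theorem Indep.indicator_relation {β M : Type*} [Fintype β] [AddCommGroup M] [Module (ZMod 2) M]
    {v : β → M} {T X : Set β} (hT : Indep v T) {φ : β → β → ZMod 2}
    (hφT : ∀ e f, f ∉ T → φ e f = 0) (hφ : ∀ e, ∑ f, φ e f • v f = v e)
    (hX : ∀ e f, φ e f ≠ 0 → (e ∈ X ↔ f ∈ X)) {c : β → ZMod 2} (hc : ∑ e, c e • v e = 0) :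
    ∑ e, X.indicator c e • v e = 0 := by
  -- Rewrite combinations in coordinates on `T`. Since coordinates never cross between `X` and its
  -- complement, restricting a relation to `X` restricts its coordinates to `X`.
  have key : ∀ d : β → ZMod 2, ∑ e, d e • v e = ∑ f, (∑ e, d e * φ e f) • v f := by
    intro d
    simp only [Finset.sum_smul, mul_smul]
    rw [Finset.sum_comm]
    refine Finset.sum_congr rfl fun e _ => ?_
    rw [← Finset.smul_sum, hφ]
  rw [key] at hc
  have h0 := hT.eq_zero (c := fun f => ∑ e, c e * φ e f)
    (fun f hf => Finset.sum_eq_zero fun e _ => by rw [hφT e f hf, mul_zero]) hc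
  rw [key]
  refine Finset.sum_eq_zero fun f _ => ?_
  suffices ∑ e, X.indicator c e * φ e f = 0 by rw [this, zero_smul]
  by_cases hf : f ∈ X
  · refine Eq.trans ?_ (congrFun h0 f)
    refine Finset.sum_congr rfl fun e _ => ?_
    by_cases h : φ e f = 0
    · simp [h]
    · rw [Set.indicator_of_mem ((hX e f h).2 hf)]
  · refine Finset.sum_eq_zero fun e _ => ?_
    by_cases h : φ e f = 0
    · simp [h]
    · rw [Set.indicator_of_notMem fun he => hf ((hX e f h).1 he), zero_mul]

/-- In a connected graph a 1VI component has a propagator of the reduced form, or is the whole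
graph. -/
theorem IsOneVIComponent.belongsTo_cases {α β : Type*} [Finite α] [Fintype β] {Γ : Graph α β}
    {M : Set α} {B : Set β} (hΓ : IsConn Γ) (hB : IsOneVIComponent Γ B) :
    (∃ f v, BelongsTo Γ M f B v) ∨
      (E(Γ) = B ∧ V(Γ) = endsOf Γ B ∧ ∀ v ∈ endsOf Γ B, ¬ IsShared Γ M v) := by
  by_cases hn : IsNontrivial Γ B
  · by_cases hs : ∃ v ∈ endsOf Γ B, IsShared Γ M v
    · obtain ⟨v, hv, hs⟩ := hs
      exact Or.inl ⟨Sum.inr (B, v), v, hB, hv, Or.inr ⟨rfl, hn, hs⟩⟩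
    · push Not at hs
      right
      have hinc : ∀ v ∈ endsOf Γ B, ∀ g, Γ.Inc g v → g ∈ B := by
        intro v hv g hg
        obtain ⟨B', hB', hgB', -⟩ := exists_isOneVIComponent hg.edge_mem
        by_contra hgB
        exact hs v hv (Or.inl ⟨B, B', hB, hB', fun h => hgB (h ▸ hgB'), hv, g, hgB', hg⟩)
      have hV : ∀ w ∈ V(Γ), w ∈ endsOf Γ B := by
        intro w hw
        obtain ⟨u, hu⟩ := endsOf_nonempty hB.1
        have huV : u ∈ V(Γ) := by
          obtain ⟨e, -, h⟩ := hu
          exact h.vertex_mem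
        refine (IsClosedUnder.mem_iff (Γ := Γ) (X := Set.univ) (Z := endsOf Γ B) ?_
          (((isConn_iff Γ).1 hΓ).2 u huV w hw)).1 hu
        exact fun e _ x y hxy hx => ⟨e, hinc x hx e hxy.inc_left, hxy.inc_right⟩
      refine ⟨Set.Subset.antisymm (fun g hg => ?_) hB.1.2.1, Set.Subset.antisymm hV ?_,
        hs⟩
      · obtain ⟨x, y, hxy⟩ := Γ.exists_isLink_of_mem_edgeSet hg
        exact hinc x (hV x hxy.left_mem) g hxy.inc_left
      · rintro v ⟨e, -, h⟩
        exact h.vertex_mem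
  · obtain ⟨e, x, y, -, hl, hBe⟩ := hB.1.eq_singleton fun h => hn ⟨hB, h⟩
    exact Or.inl ⟨Sum.inl e, x, hB, ⟨e, hBe ▸ rfl, hl.inc_left⟩, Or.inl ⟨e, rfl, hBe, hn⟩⟩

variable {V E : Type} [Fintype E] {d K L : ℕ}

/-- The exchanged edges are of one type, so they lie in the same ones of `H` and `H ∪ J`, and the
exchange takes place within each nested basis. -/
theorem IsOptimal.exchange {G : Graph V E} {mode : E → Mode K} {T : Set E}
    (hT : IsOptimal G mode T) {e f : E} (hm : mode e = mode f)
    (h : bvec G e ∉ spn (bvec G) (T \ {f})) : IsOptimal G mode (insert e (T \ {f})) := by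
  have key : ∀ X : Set E, (f ∈ X → e ∈ X) → spn (bvec G) X ≤ spn (bvec G) (T ∩ X) →
      spn (bvec G) X ≤ spn (bvec G) (insert e (T \ {f}) ∩ X) := by
    intro X hX hs
    by_cases hf : f ∈ X
    · rw [Set.insert_inter_of_mem (hX hf), Set.sdiff_inter_right_comm]
      refine hs.trans (spn_le_exchange (hs (mem_spn _ (hX hf))) fun h' => h ?_)
      exact spn_mono _ (Set.sdiff_subset_sdiff_left Set.inter_subset_left) h'
    · refine hs.trans (spn_mono _ fun g hg => ⟨Or.inr ⟨hg.1, ?_⟩, hg.2⟩)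
      rintro rfl
      exact hf hg.2
  refine ⟨indep_insert (hT.indep.mono Set.sdiff_subset) h, ?_, key _ ?_ hT.hard, key _ ?_ hT.nonsoft⟩
  · simpa using key Set.univ (fun _ => trivial) (by simpa using hT.span)
  · exact fun hf => hm.trans hf
  · exact fun hf he => hf (hm ▸ he)

/-- A linear form that is constant on the minimal terms. -/
def IsConstant [Nonempty V] (G : Graph V E) (att : Leg K L → V) (P : ℝ → Leg K L → Momentum d)
    (mode : E → Mode K) (a : E → ℝ) : Prop :=
  ∀ x ∈ minTerms G att P (fun e => (mode e).weight),
    ∀ y ∈ minTerms G att P (fun e => (mode e).weight), cosum a x.1 = cosum a y.1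

theorem cosum_diff (a : E → ℝ) {T : Set E} {f : E} (hf : f ∈ T) :
    cosum a T + a f = cosum a (T \ {f}) := by
  have := cosum_insert a (T := T \ {f}) (e := f) (by simp)
  rwa [Set.insert_sdiff_singleton, Set.insert_eq_of_mem hf] at this

namespace Setup

variable {G : Graph V E} {att : Leg K L → V} {P : ℝ → Leg K L → Momentum d} {mode : E → Mode K}
variable (S : Setup G att P mode)

include S

variable [Nonempty V] {a : E → ℝ} (ha : IsConstant G att P mode a)

include ha

/-- If the removal of an edge from an optimal tree gives a minimal term, the form vanishes on it. -/
theorem eq_zero_of_diff {T : Set E} (hT : IsOptimal G mode T) {e : E} (he : e ∈ T) {n : ℕ}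
    (h : (fun t => invariant G att (P t) (T \ {e})) =Θ[𝓝[>] (0 : ℝ)] (fun t => t ^ n))
    (hn : (mode e).weight + n = 0) : a e = 0 := by
  have h1 := ha _ (S.isOptimal_mem_minTerms hT) _ (S.diff_mem_minTerms hT he h hn)
  have h2 := cosum_diff a he
  simp only at h1
  linarith

theorem eq_of_exchange {T : Set E} (hT : IsOptimal G mode T) {e f : E} (hf : f ∈ T)
    (hm : mode e = mode f) (h : bvec G e ∉ spn (bvec G) (T \ {f})) : a e = a f := by
  have h1 := ha _ (S.isOptimal_mem_minTerms hT) _ (S.isOptimal_mem_minTerms (hT.exchange hm h))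
  have h2 := cosum_diff a hf
  have h3 := cosum_insert a (T := T \ {f}) (e := e) fun he => h (mem_spn _ he)
  simp only at h1
  linarith

/-- The form is constant on the 1VI subgraphs of the graph `Γ` whose edges are those of `X`, the
edges of `Z` being contracted. -/
theorem eq_of_isOneVI {α : Type*} {Γ : Graph α E} {κ : (V →₀ ZMod 2) →ₗ[ZMod 2] (α →₀ ZMod 2)}
    {X Z : Set E} (hΓ : E(Γ) = X) (hκ : ∀ e ∈ X, bvec Γ e = κ (bvec G e))
    (hκZ : ∀ e ∈ Z, κ (bvec G e) = 0)
    (hker : ∀ z ∈ spn (bvec G) X, κ z = 0 → z ∈ spn (bvec G) Z) (hXZ : Disjoint X Z)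
    (hm : ∀ e ∈ X, ∀ f ∈ X, mode e = mode f) {T : Set E} (hT : IsOptimal G mode T)
    (hTZ : spn (bvec G) Z ≤ spn (bvec G) (T ∩ Z))
    (hTX : spn (bvec G) (X ∪ Z) ≤ spn (bvec G) (T ∩ (X ∪ Z)))
    {B : Set E} (hB : IsOneVI Γ B) {e f : E} (he : e ∈ B) (hf : f ∈ B) : a e = a f := by
  classical
  have hmap : ∀ Y : Set E, Y ⊆ X → spn (bvec Γ) Y = (spn (bvec G) Y).map κ := by
    intro Y hY
    rw [spn, spn, Submodule.map_span, ← Set.image_comp]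
    congr 1
    exact Set.image_congr fun e he => hκ e (hY he)
  -- Since `T ∩ Z` already spans `Z`, the edges of `T` in `X` remain independent when `Z` is
  -- contracted.
  have hind : Indep (bvec Γ) (T ∩ X) := by
    refine indep_of_eq_zero fun c hc h0 => ?_
    have h1 : κ (∑ e, c e • bvec G e) = 0 := by
      rw [map_sum, ← h0]
      refine Finset.sum_congr rfl fun e _ => ?_
      by_cases he : e ∈ X
      · rw [map_smul, hκ e he]
      · rw [hc e fun h => he h.2, zero_smul, zero_smul, map_zero]
    have h2 : ∑ e, c e • bvec G e ∈ spn (bvec G) (T ∩ X) := (mem_spn_iff _ _ _).2 ⟨c, hc, rfl⟩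
    have h3 := hTZ (hker _ (spn_mono _ Set.inter_subset_right h2) h1)
    have h4 := hT.indep.mem_spn_inter Set.inter_subset_left Set.inter_subset_left h2 h3
    have h5 : (T ∩ X) ∩ (T ∩ Z) = ∅ := by
      rw [← Set.inter_inter_distrib_left, hXZ.inter_eq, Set.inter_empty]
    rw [h5] at h4
    refine (hT.indep.mono Set.inter_subset_left).eq_zero hc ?_
    rwa [spn, Set.image_empty, Submodule.span_empty, Submodule.mem_bot] at h4
  have hproj : ∀ Y ⊆ T, ∀ e ∈ X, bvec G e ∈ spn (bvec G) Y →
      bvec Γ e ∈ spn (bvec Γ) (Y ∩ X) := by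
    intro Y hY e he h
    have h1 := hT.indep.mem_spn_inter hY Set.inter_subset_left h (hTX (mem_spn _ (Or.inl he)))
    have h2 : Y ∩ (T ∩ (X ∪ Z)) ⊆ (Y ∩ X) ∪ Z := by
      rintro g ⟨hg, -, hg' | hg'⟩
      · exact Or.inl ⟨hg, hg'⟩
      · exact Or.inr hg'
    have h3 := spn_mono (bvec G) h2 h1
    rw [spn_union] at h3
    obtain ⟨y, hy, z, hz, hyz⟩ := Submodule.mem_sup.1 h3
    have hz0 : κ z = 0 := by
      have : spn (bvec G) Z ≤ LinearMap.ker κ := spn_le _ hκZ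
      exact this hz
    rw [hκ e he, ← hyz, map_add, hz0, add_zero, hmap _ Set.inter_subset_right]
    exact Submodule.mem_map_of_mem hy
  -- A tree edge with nonzero coordinate lies on the fundamental circuit of `e` and can be exchanged
  -- for it. Hence `a` agrees on both.
  have hφ : ∀ e, ∃ φ : E → ZMod 2, (∀ f, f ∉ T ∩ X → φ f = 0) ∧ ∑ f, φ f • bvec Γ f = bvec Γ e ∧
      ∀ f, φ f ≠ 0 → a e = a f := by
    intro e
    by_cases he : e ∈ X
    · have h1 := hproj T subset_rfl e he (hT.span (mem_spn _ (Set.mem_univ e)))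
      obtain ⟨φ, h2, h3⟩ := (mem_spn_iff _ _ _).1 h1
      refine ⟨φ, h2, h3, fun f hf => ?_⟩
      have hfT : f ∈ T ∩ X := by
        by_contra h
        exact hf (h2 f h)
      refine S.eq_of_exchange ha hT hfT.1 (hm e he f hfT.2) fun h => ?_
      have h4 := hproj _ Set.sdiff_subset e he h
      rw [Set.sdiff_inter_right_comm] at h4
      exact hind.not_mem_spn_diff h2 hf (h3 ▸ h4)
    · exact ⟨0, by simp, by simp [bvec_of_notMem (Γ := Γ) (e := e) (by rwa [hΓ])], by simp⟩
  choose φ hφ1 hφ2 hφ3 using hφ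
  -- Coordinates only relate edges with equal `a`, so the level sets of `a` split all relations, and
  -- a 1VI subgraph lies in one level set.
  have hsep : Splits Γ B {g | a g = a f} := fun c _ hc =>
    hind.indicator_relation hφ1 hφ2 (X := {g | a g = a f}) (fun g g' hg => by
      simp only [Set.mem_ofPred_eq, hφ3 g g' hg]) hc
  exact hB.subset_of_splits hsep hf rfl he

theorem eq_of_hard_isOneVI {B : Set E} (hB : IsOneVI (hardGraph G att mode) B) {e f : E}
    (he : e ∈ B) (hf : f ∈ B) : a e = a f := by
  obtain ⟨T, hT⟩ := exists_isOptimal G mode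
  refine S.eq_of_isOneVI ha (κ := LinearMap.id) (Z := ∅) S.edgeSet_hardGraph
    (fun e he => S.bvec_hardGraph he) (fun e he => absurd he (Set.notMem_empty e)) ?_
    (Set.disjoint_empty _) (fun e he f hf => ?_) hT (spn_mono _ (Set.empty_subset _)) ?_ hB he hf
  · intro z _ hz
    rw [LinearMap.id_apply] at hz
    exact hz ▸ Submodule.zero_mem _
  · exact Eq.trans he (Eq.symm hf)
  · rw [Set.union_empty]
    exact hT.hard

-- An optimal tree also spans `H` with one jet, and all the jets but one, since jets are related to
-- each other only through `H`.
omit ha [Nonempty V] in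
theorem IsOptimal.jet {T : Set E} (hT : IsOptimal G mode T) (i : Fin K) :
    spn (bvec G) (hardE mode ∪ jetE mode i) ≤ spn (bvec G) (T ∩ (hardE mode ∪ jetE mode i)) ∧
      spn (bvec G) (nonsoftE mode \ jetE mode i) ≤
        spn (bvec G) (T ∩ (nonsoftE mode \ jetE mode i)) := by
  have hHi : hardE mode ∪ jetE mode i ⊆ nonsoftE mode :=
    Set.union_subset (hardE_subset mode) (jetE_subset mode i)
  have hdis : ∀ e ∈ jetE mode i, e ∉ hardE mode := fun e h h' => not_mem_hardE_of_jet h h'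
  constructor
  · have := (hT.indep.ncard_inter_separator (X := nonsoftE mode) (Y := hardE mode)
      (B := nonsoftE mode \ (hardE mode ∪ jetE mode i)) (hardE_subset mode) Set.sdiff_subset
      (Set.disjoint_left.2 fun e h h' => h.2 (Or.inl h')) hT.nonsoft hT.hard ?_).2
    · rwa [Set.sdiff_sdiff_cancel_left hHi] at this
    · rw [Set.sdiff_sdiff_cancel_left hHi, inf_comm]
      refine le_trans (inf_le_inf le_rfl (spn_mono _ ?_)) (S.jet_separates i)
      rintro e (he | he)
      · exact ⟨hardE_subset mode he, fun h => hdis e h he⟩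
      · exact ⟨he.1, fun h => he.2 (Or.inr h)⟩
  · exact (hT.indep.ncard_inter_separator (hardE_subset mode) (jetE_subset mode i)
      (Set.disjoint_left.2 hdis) hT.nonsoft hT.hard (S.jet_separates i)).2

theorem eq_of_jet_isOneVI {i : Fin K} {B : Set E} (hB : IsOneVI (contractedJet G att mode i) B)
    {e f : E} (he : e ∈ B) (hf : f ∈ B) : a e = a f := by
  obtain ⟨T, hT⟩ := exists_isOptimal G mode
  have hkill : ∀ e ∈ hardE mode, ∀ x ∈ jetVerts G att mode i, ¬ G.Inc e x :=
    fun e he u hu h => not_mem_hard_of_jet hu (S.mem_hard_of_inc he h)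
  refine S.eq_of_isOneVI ha (κ := keepMap (jetVerts G att mode i)) (Z := hardE mode)
    (S.contractedJet_edgeSet i) (fun e he => bvec_contracted S.edgeSet he)
    (fun e he => keepMap_eq_zero hkill (mem_spn _ he)) (fun z hz h0 => ?_)
    (Set.disjoint_left.2 fun e h h' => not_mem_hardE_of_jet h h') (fun e he f hf => ?_) hT hT.hard
    ?_ hB he hf
  · refine S.mem_spn_hardE hz fun x hx => ?_
    by_cases hxi : x ∈ jetVerts G att mode i
    · rw [← keepMap_apply_some hxi, h0]
      rfl
    · exact spn_apply_eq_zero (fun e he h => (S.mem_of_inc_jet he h).elim hx hxi) hz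
  · exact Eq.trans he (Eq.symm hf)
  · rw [Set.union_comm]
    exact (IsOptimal.jet S hT i).1

theorem eq_of_soft_isOneVI {B : Set E} (hB : IsOneVI (contractedSoft G att mode) B) {e f : E}
    (he : e ∈ B) (hf : f ∈ B) : a e = a f := by
  obtain ⟨T, hT⟩ := exists_isOptimal G mode
  have hkill : ∀ e ∈ nonsoftE mode, ∀ x ∈ softVerts G att mode, ¬ G.Inc e x :=
    fun e he x hx h => not_mem_soft_of_inc he h hx
  refine S.eq_of_isOneVI ha (κ := keepMap (softVerts G att mode)) (Z := nonsoftE mode)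
    (X := softE mode) (edgeSet_contracted S.edgeSet _ _)
    (fun e he => bvec_contracted S.edgeSet he)
    (fun e he => keepMap_eq_zero hkill (mem_spn _ he)) (fun z hz h0 => ?_)
    (Set.disjoint_left.2 fun e h h' => h' h) (fun e he f hf => ?_) hT hT.nonsoft ?_ hB he hf
  · refine S.mem_spn_nonsoftE hz fun x hx => ?_
    rw [← keepMap_apply_some hx, h0]
    rfl
  · exact Eq.trans he (Eq.symm hf)
  · have : softE mode ∪ nonsoftE mode = Set.univ :=
      Set.eq_univ_of_forall fun e => (mem_nonsoftE_or_softE mode e).symm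
    rw [this, Set.inter_univ]
    exact hT.span

end Setup

end ConstantForms

/-! ### The requirements are sufficient: jet and soft edges -/

section JetSufficiency

variable {V E : Type} [Fintype E] {d K L : ℕ}

namespace Setup

variable {G : Graph V E} {att : Leg K L → V} {P : ℝ → Leg K L → Momentum d} {mode : E → Mode K}
variable (S : Setup G att P mode)

include S

/-- With `p_i` and the auxiliary vertex on one side, a propagator of the component would carry zero
momentum; the requirement then gives `p_i = 0`, against `p_i²` being of order `t`. If there is no
propagator, the component is the whole contracted jet and nothing connects outside it. -/
theorem jet_component_separates [Fintype V] (hJ : RequirementJ G att mode P) {i : Fin K}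
    {B : Set E} (hB : IsOneVIComponent (contractedJet G att mode i) B) :
    dl (some (att (Sum.inl i))) none ∉ spn (bvec (contractedJet G att mode i)) Bᶜ := by
  classical
  intro hcon
  have hΓ := S.contractedJet_connected i
  have hne : (jetE mode i).Nonempty := hB.1.1.mono (S.jet_component_subset hB)
  obtain ⟨w, hw⟩ : (hardVerts G att mode).Nonempty := S.config.hard_connected.1
  have hn : none ∈ V(contractedJet G att mode i) :=
    keep_hard hw i ▸ keep_mem_contracted S.vertexSet _ _ w
  have hp : some (att (Sum.inl i)) ∈ V(contractedJet G att mode i) :=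
    S.keep_att i hne ▸ keep_mem_contracted S.vertexSet _ _ (att (Sum.inl i))
  obtain ⟨f, v, hBv⟩ | ⟨hE, -, -⟩ := hB.belongsTo_cases (M := ∅) hΓ
  · obtain ⟨x, y, hxy, hx, hy⟩ := hBv.carried_cases hΓ (P := Momentum d)
    obtain ⟨z, hz, hzP⟩ := hJ i f hxy.edge_mem
    have hbr : ∀ t, BelongsTo.branchSum (contractedJet G att mode i) B (jetInflow att (P t) i) v
        = 0 := by
      intro t
      rw [BelongsTo.branchSum, sum_jetInflow (P t) i (fun w => w ∈ V(contractedJet G att mode i) ∧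
        dl v w ∈ spn (bvec (contractedJet G att mode i)) Bᶜ)]
      by_cases h : dl v none ∈ spn (bvec (contractedJet G att mode i)) Bᶜ
      · rw [if_pos ⟨hp, dl_mem_trans h (dl_mem_symm hcon)⟩, if_pos ⟨hn, h⟩, sub_self]
      · rw [if_neg fun h' => h (dl_mem_trans h'.2 hcon), if_neg fun h' => h h'.2, sub_self]
    have hP0 : ∀ t, P t (Sum.inl i) = 0 := by
      intro t
      rw [← hzP t]
      obtain rfl | rfl := hz.eq_or_eq_of_isLink hxy
      · rw [hx, hbr]
      · rw [hy, hbr, neg_zero]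
        rw [sum_jetInflow, if_pos hp, if_pos hn, sub_self]
    have := S.wide.on_shell i
    simp only [hP0, mdot_zero_left] at this
    exact not_zero_isTheta 1 (by simpa using this)
  · have h0 : spn (bvec (contractedJet G att mode i)) Bᶜ ≤ ⊥ := spn_le _ fun e he => by
      rw [bvec_of_notMem (hE ▸ he)]
      exact Submodule.zero_mem _
    have h1 := (Submodule.mem_bot _).1 (h0 hcon)
    have h2 := (sumOn_dl {none} (some (att (Sum.inl i))) none).1 (by rw [h1, map_zero])
    simp at h2

variable [Nonempty V] {a : E → ℝ} (ha : IsConstant G att P mode a)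

include ha

/-- The path of an optimal tree from `p_i` to `H` crosses the component at some edge `f`. Removing
`f` isolates `p_i` from all other lines: the invariant is of order `t`, and this compensates the
weight `-1` of `f`. -/
theorem jet_eq_zero [Fintype V] (hJ : RequirementJ G att mode P) {i : Fin K} {e : E}
    (he : e ∈ jetE mode i) : a e = 0 := by
  obtain ⟨B, hB, heB, -⟩ := exists_isOneVIComponent (Γ := contractedJet G att mode i) (e := e)
    (by rwa [S.contractedJet_edgeSet])
  have hBi := S.jet_component_subset hB
  have hp := S.att_mem_jet ⟨e, he⟩
  obtain ⟨w, hw⟩ : (hardVerts G att mode).Nonempty := S.config.hard_connected.1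
  have hsep := S.jet_component_separates hJ hB
  rw [← S.keep_att i ⟨e, he⟩, ← keep_hard hw i,
    S.dl_keep_mem_contractedJet (Or.inr hp) (Or.inl hw), Set.inter_comm, ← Set.sdiff_eq] at hsep
  obtain ⟨T, hT⟩ := exists_isOptimal G mode
  obtain ⟨hT1, hT2⟩ := IsOptimal.jet S hT i
  obtain ⟨c, hc, hcs⟩ := (mem_spn_iff _ _ _).1 (hT1 (S.dl_mem_jet_hard hp hw))
  obtain ⟨f, hfB, hf⟩ : ∃ f ∈ B, c f ≠ 0 := by
    by_contra hcon
    push Not at hcon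
    refine hsep ((mem_spn_iff _ _ _).2 ⟨c, fun g hg => ?_, hcs⟩)
    by_contra hg0
    have hgT : g ∈ T ∩ (hardE mode ∪ jetE mode i) := by
      by_contra h
      exact hg0 (hc g h)
    exact hg (hgT.2.imp_right fun h => ⟨h, fun h' => hg0 (hcon g h')⟩)
  have hfT : f ∈ T := by
    by_contra h
    exact hf (hc f fun h' => h h'.1)
  have hfi := hBi hfB
  rw [S.eq_of_jet_isOneVI ha hB.1 heB hfB]
  have hpw : dl (att (Sum.inl i)) w ∉ spn (bvec G) (T \ {f}) :=
    hcs ▸ hT.indep.not_mem_spn_diff (fun g hg => hc g fun h => hg h.1) hf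
  have hTf : spn (bvec G) (nonsoftE mode \ jetE mode i) ≤ spn (bvec G) (T \ {f}) := by
    refine hT2.trans (spn_mono _ ?_)
    rintro g ⟨hg, hg'⟩
    refine ⟨hg, ?_⟩
    rintro rfl
    exact hg'.2 hfi
  have hlegs : (conLegs G att (T \ {f}) w)ᶜ = {Sum.inl i} := by
    refine Set.Subset.antisymm (fun l hl => ?_) ?_
    · by_contra hli
      refine hl (show dl w (att l) ∈ spn (bvec G) (T \ {f}) from dl_mem_symm ?_)
      have hH : hardE mode ⊆ nonsoftE mode \ jetE mode i :=
        fun e he => ⟨hardE_subset mode he, fun h => not_mem_hardE_of_jet h he⟩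
      obtain h | ⟨k, rfl, h⟩ := S.att_cases l
      · exact hTf (spn_mono _ hH (S.dl_mem_hard h hw))
      · have hk : jetE mode k ⊆ nonsoftE mode \ jetE mode i :=
          fun e he => ⟨jetE_subset mode k he, fun h => hli (by rw [jetE_inj h he]; rfl)⟩
        exact hTf (spn_mono _ (Set.union_subset hH hk) (S.dl_mem_jet_hard h hw))
    · rintro _ rfl
      exact fun h => hpw (dl_mem_symm h)
  refine S.eq_zero_of_diff ha hT hfT (n := 1) ?_ ?_
  · simp only [S.invariant_eq (S.diff_isSpanningTwoTree hT.indep hT.span hfT) w, pow_one]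
    exact S.wide.sq_isTheta_id (Or.inr hlegs)
  · have : mode f = Mode.jet i := hfi
    simp [this, Mode.weight]

/-- The component joins jets `i` and `j`. Join them by a soft path and cut both links to `H`: the
invariant is `(p_i + p_j)²`, of order one. Compared with an optimal tree, a soft edge of weight `-2`
has replaced two jet edges of weight `-1`, so `a` on it is the sum of two values already known to
vanish. -/
theorem soft_eq_zero [Fintype V] (hJ : RequirementJ G att mode P) (hS : RequirementS G att mode)
    (h1VI : SoftComponentsOneVI G att mode) {e : E} (he : e ∈ softE mode) : a e = 0 := by
  classical
  have hC : IsSoftComponent G att mode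
      {f | EdgeLinked G (softE mode) (softVerts G att mode) e f} := ⟨e, he, rfl⟩
  have heC : e ∈ {f | EdgeLinked G (softE mode) (softVerts G att mode) e f} :=
    Relation.ReflTransGen.refl
  set C := {f | EdgeLinked G (softE mode) (softVerts G att mode) e f}
  have hCs := hC.subset
  obtain ⟨i, j, hij, ⟨f₁, hf₁, v, hv, hfv⟩, f₂, hf₂, w, hw, hfw⟩ := hS C hC
  -- `PC` joins `v` to `w`
  set PC : Set E := {g | g ∈ C ∧ ∀ z, G.Inc g z → z ∈ softVerts G att mode ∪ {v, w}} with hPC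
  have hvw : dl v w ∈ spn (bvec G) PC := by
    have hl : EdgeLinked G (softE mode) (softVerts G att mode) f₁ f₂ :=
      Relation.ReflTransGen.trans (edgeLinked_symm hf₁) hf₂
    refine spn_mono _ ?_ (EdgeLinked.dl_mem (W' := softVerts G att mode ∪ {v, w})
      Set.subset_union_left (hCs hf₁) hl hfv (by simp) hfw (by simp))
    exact fun g hg => ⟨Relation.ReflTransGen.trans hf₁ hg.2.1, hg.2.2⟩
  obtain ⟨j₀, hj₀, x₀, hx₀, w₀, hw₀, hl₀⟩ := S.exists_jet_isLink_hard (jetE_nonempty_of_mem hv)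
  obtain ⟨j₁, hj₁, x₁, hx₁, w₁, hw₁, hl₁⟩ := S.exists_jet_isLink_hard (jetE_nonempty_of_mem hw)
  -- All nonsoft edges except those by which the jets `i` and `j` are attached to `H`. The edges
  -- `j₀` and `j₁` are one such link for each.
  set Q₀ : Set E := {g | g ∈ nonsoftE mode ∧ (g ∈ jetE mode i → g ∈ innerJetE G att mode i) ∧
    (g ∈ jetE mode j → g ∈ innerJetE G att mode j)} with hQ₀
  have hHQ : hardE mode ⊆ Q₀ := fun g hg => ⟨hardE_subset mode hg,
    fun h => absurd hg (not_mem_hardE_of_jet h), fun h => absurd hg (not_mem_hardE_of_jet h)⟩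
  have hiQ : innerJetE G att mode i ⊆ Q₀ := fun g hg => ⟨jetE_subset mode i hg.1, fun _ => hg,
    fun h => absurd (jetE_inj hg.1 h) hij⟩
  have hjQ : innerJetE G att mode j ⊆ Q₀ := fun g hg => ⟨jetE_subset mode j hg.1,
    fun h => absurd (jetE_inj h hg.1) hij, fun _ => hg⟩
  have hkQ : ∀ k, k ≠ i → k ≠ j → jetE mode k ⊆ Q₀ := fun k hki hkj g hg =>
    ⟨jetE_subset mode k hg, fun h => absurd (jetE_inj hg h) hki,
      fun h => absurd (jetE_inj hg h) hkj⟩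
  have hclosed : ∀ k, k = i ∨ k = j → IsClosedUnder G Q₀ (jetVerts G att mode k) := by
    intro k hk g hg x y hxy hx
    have hgk := jetE_of_inc_jetVerts hg.1 hxy.inc_left hx
    obtain rfl | rfl := hk
    · exact (hg.2.1 hgk).2 y hxy.inc_right
    · exact (hg.2.2 hgk).2 y hxy.inc_right
  -- the jets `i` and `j`, joined by `PC`, are not connected to `H`
  have hj₀QP : bvec G j₀ ∉ spn (bvec G) (Q₀ ∪ PC) := by
    rw [bvec_eq hl₀]
    intro h
    have hc : IsClosedUnder G (Q₀ ∪ PC)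
        (jetVerts G att mode i ∪ jetVerts G att mode j ∪ softVerts G att mode) := by
      rintro g (hg | hg) x y hxy hx
      · obtain (hx | hx) | hx := hx
        · exact Or.inl (Or.inl (hclosed i (Or.inl rfl) g hg x y hxy hx))
        · exact Or.inl (Or.inr (hclosed j (Or.inr rfl) g hg x y hxy hx))
        · exact absurd hx (not_mem_soft_of_inc hg.1 hxy.inc_left)
      · obtain hy | rfl | rfl := hg.2 y hxy.inc_right
        · exact Or.inr hy
        · exact Or.inl (Or.inl hv)
        · exact Or.inl (Or.inr hw)
    obtain (h' | h') | h' := (hc.mem_iff h).1 (Or.inl (Or.inl hx₀))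
    · exact not_mem_hard_of_jet h' hw₀
    · exact not_mem_hard_of_jet h' hw₀
    · exact hw₀.2.1 h'
  have hj₁Q₀ : bvec G j₁ ∉ spn (bvec G) (insert j₀ Q₀) := by
    rw [bvec_eq hl₁]
    intro h
    have hc : IsClosedUnder G (insert j₀ Q₀) (jetVerts G att mode j) := by
      rintro g (rfl | hg) x y hxy hx
      · exact absurd (jetE_inj hj₀ (jetE_of_inc_jetVerts (jetE_subset mode i hj₀) hxy.inc_left hx))
          hij
      · exact hclosed j (Or.inr rfl) g hg x y hxy hx
    exact not_mem_hard_of_jet ((hc.mem_iff h).1 hx₁) hw₁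
  -- Build a basis by priority: hard edges, `Q₀`, the soft connection `PC`, then `j₀`, then
  -- anything. The resulting tree is not optimal, since `PC` takes the place of `j₁`.
  obtain ⟨T₁, hT₁, -, hs₁, hi₁⟩ := exists_indep_extension (bvec G) (S := ∅) (X := hardE mode)
    (linearIndepOn_empty (ZMod 2) _) (Set.empty_subset _)
  obtain ⟨T₂, hT₂, hT₁₂, hs₂, hi₂⟩ := exists_indep_extension (bvec G) hi₁ (hT₁.trans hHQ)
  obtain ⟨T₃, hT₃, hT₂₃, hs₃, hi₃⟩ := exists_indep_extension (bvec G) hi₂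
    (hT₂.trans (Set.subset_union_left (t := PC)))
  have hj₀T₃ : bvec G j₀ ∉ spn (bvec G) T₃ := fun h => hj₀QP (spn_mono _ hT₃ h)
  have hi₄ := indep_insert hi₃ hj₀T₃
  obtain ⟨T, -, hT₄, hs, hi⟩ := exists_indep_extension (bvec G) hi₄ (Set.subset_univ _)
  have hT₃T : T₃ ⊆ T := (Set.subset_insert _ _).trans hT₄
  have hj₀T : j₀ ∈ T := hT₄ (Set.mem_insert _ _)
  have hT₃j : T₃ ⊆ T \ {j₀} := fun g hg => ⟨hT₃T hg, fun h => hj₀T₃ (mem_spn _ (h ▸ hg))⟩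
  -- the relation that expresses `j₁`
  have hj₁mem : bvec G j₁ ∈ spn (bvec G) (insert j₀ T₃) := by
    rw [bvec_eq hl₁]
    have h3 : spn (bvec G) T₃ ≤ spn (bvec G) (insert j₀ T₃) := spn_mono _ (Set.subset_insert _ _)
    have h2 : spn (bvec G) Q₀ ≤ spn (bvec G) (insert j₀ T₃) :=
      (hs₂.trans (spn_mono _ hT₂₃)).trans h3
    refine dl_mem_trans (h2 (spn_mono _ hjQ (S.dl_mem_innerJet hx₁ hw))) (dl_mem_trans
      (dl_mem_symm (h3 (hs₃ (spn_mono _ Set.subset_union_right hvw)))) (dl_mem_trans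
      (h2 (spn_mono _ hiQ (S.dl_mem_innerJet hv hx₀))) (dl_mem_trans
      (dl_mem_of_isLink (Set.mem_insert _ _) hl₀) (h2 (spn_mono _ hHQ (S.dl_mem_hard hw₀ hw₁))))))
  obtain ⟨c, hc, hcs⟩ := (mem_spn_iff _ _ _).1 hj₁mem
  -- The circuit of `j₁` must use `PC`: in `Q₀` with `j₀` alone, the jet `j` is not attached to `H`.
  obtain ⟨s₀, hs₀P, hs₀Q, hcs₀⟩ : ∃ s ∈ PC, s ∉ Q₀ ∧ c s ≠ 0 := by
    by_contra hcon
    push Not at hcon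
    refine hj₁Q₀ ((mem_spn_iff _ _ _).2 ⟨c, fun g hg => ?_, hcs⟩)
    by_contra hg0
    have hgT : g ∈ insert j₀ T₃ := by
      by_contra h
      exact hg0 (hc g h)
    refine hg0 (hcon g ?_ fun h => hg (Or.inr h))
    obtain rfl | hgT := hgT
    · exact absurd (Or.inl rfl) hg
    · exact (hT₃ hgT).resolve_left fun h => hg (Or.inr h)
  have hs₀s : s₀ ∈ softE mode := hCs hs₀P.1
  have hs₀T : s₀ ∈ T := by
    by_contra h
    exact hcs₀ (hc s₀ fun h' => h (hT₄ h'))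
  have hj₁T : bvec G j₁ ∉ spn (bvec G) (T \ {s₀}) :=
    hcs ▸ hi.not_mem_spn_diff (fun g hg => hc g fun h => hg (hT₄ h)) hcs₀
  have hns₀ : ∀ X ⊆ nonsoftE mode, T ∩ X ⊆ insert j₁ (T \ {s₀}) ∩ X := by
    rintro X hX g ⟨hg, hgX⟩
    refine ⟨Or.inr ⟨hg, ?_⟩, hgX⟩
    rintro rfl
    exact not_mem_nonsoftE hs₀s (hX hgX)
  have hQ₀ns : Q₀ ⊆ nonsoftE mode := fun g hg => hg.1
  have hT₂T : T₂ ⊆ T := hT₂₃.trans hT₃T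
  -- Exchanging `s₀` for `j₁` attaches the jets `i` and `j` to `H` by `j₀` and `j₁`, so the nonsoft
  -- part of the new tree is connected.
  have hopt : IsOptimal G mode (insert j₁ (T \ {s₀})) := by
    refine ⟨indep_insert (hi.mono Set.sdiff_subset) hj₁T,
      hs.trans (spn_le_exchange (hs (mem_spn _ (Set.mem_univ _))) hj₁T),
      hs₁.trans (spn_mono _ fun g hg => hns₀ _ (hardE_subset mode)
        ⟨hT₂T (hT₁₂ hg), hT₁ hg⟩), ?_⟩
    have hQ : spn (bvec G) Q₀ ≤ spn (bvec G) (insert j₁ (T \ {s₀}) ∩ nonsoftE mode) :=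
      hs₂.trans (spn_mono _ fun g hg => hns₀ _ subset_rfl ⟨hT₂T hg, hQ₀ns (hT₂ hg)⟩)
    have h0 : j₀ ∈ insert j₁ (T \ {s₀}) ∩ nonsoftE mode :=
      hns₀ _ subset_rfl ⟨hj₀T, jetE_subset mode i hj₀⟩
    have h1 : j₁ ∈ insert j₁ (T \ {s₀}) ∩ nonsoftE mode :=
      ⟨Or.inl rfl, jetE_subset mode j hj₁⟩
    have key : ∀ x, x ∉ softVerts G att mode →
        dl x w₀ ∈ spn (bvec G) (insert j₁ (T \ {s₀}) ∩ nonsoftE mode) := by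
      intro x hx
      obtain hx | ⟨k, hx⟩ := S.not_mem_soft_cases hx
      · exact hQ (spn_mono _ hHQ (S.dl_mem_hard hx hw₀))
      by_cases hki : k = i
      · subst hki
        exact dl_mem_trans (hQ (spn_mono _ hiQ (S.dl_mem_innerJet hx hx₀)))
          (dl_mem_of_isLink h0 hl₀)
      by_cases hkj : k = j
      · subst hkj
        exact dl_mem_trans (hQ (spn_mono _ hjQ (S.dl_mem_innerJet hx hx₁))) (dl_mem_trans
          (dl_mem_of_isLink h1 hl₁) (hQ (spn_mono _ hHQ (S.dl_mem_hard hw₁ hw₀))))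
      · exact hQ (spn_mono _ (Set.union_subset hHQ (hkQ k hki hkj)) (S.dl_mem_jet_hard hx hw₀))
    refine spn_le _ fun g hg => ?_
    obtain ⟨x, y, hxy⟩ := S.exists_isLink g
    rw [bvec_eq hxy]
    exact dl_mem_trans (key x (not_mem_soft_of_inc hg hxy.inc_left))
      (dl_mem_symm (key y (not_mem_soft_of_inc hg hxy.inc_right)))
  -- the term without `j₀`
  have htree := S.diff_isSpanningTwoTree hi hs hj₀T
  have hQj : spn (bvec G) Q₀ ≤ spn (bvec G) (T \ {j₀}) :=
    hs₂.trans (spn_mono _ (hT₂₃.trans hT₃j))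
  have hx₀w₀ : dl x₀ w₀ ∉ spn (bvec G) (T \ {j₀}) := bvec_eq hl₀ ▸ hi.notMem_span hj₀T
  have hlegs : conLegs G att (T \ {j₀}) x₀ = {Sum.inl i, Sum.inl j} := by
    ext l
    constructor
    · intro hl
      by_contra hcon
      simp only [Set.mem_insert_iff, Set.mem_singleton_iff, not_or] at hcon
      refine hx₀w₀ (dl_mem_trans hl ?_)
      obtain h | ⟨k, rfl, h⟩ := S.att_cases l
      · exact hQj (spn_mono _ hHQ (S.dl_mem_hard h hw₀))
      · exact hQj (spn_mono _ (Set.union_subset hHQ (hkQ k (fun h => hcon.1 (by rw [h]))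
          fun h => hcon.2 (by rw [h]))) (S.dl_mem_jet_hard h hw₀))
    · rintro (rfl | rfl)
      · exact hQj (spn_mono _ hiQ (S.dl_mem_innerJet hx₀
          (S.att_mem_jet (jetE_nonempty_of_mem hv))))
      · refine dl_mem_trans (hQj (spn_mono _ hiQ (S.dl_mem_innerJet hx₀ hv))) (dl_mem_trans ?_
          (hQj (spn_mono _ hjQ (S.dl_mem_innerJet hw (S.att_mem_jet (jetE_nonempty_of_mem hw))))))
        exact spn_mono _ hT₃j (hs₃ (spn_mono _ Set.subset_union_right hvw))
  have hterm : (T \ {j₀}, 0) ∈ terms G att P := by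
    refine Or.inr ⟨htree, ?_⟩
    simp only [S.invariant_eq htree x₀, hlegs, pow_zero]
    exact S.wide.sq_isTheta_one (not_exceptional_of_ne (l := Sum.inl i) (l' := Sum.inl j) (by simp)
      (by simp) (by simpa using hij)) (S.wide.not_exceptional_compl_pair i j)
  -- Both sides are complements relative to the same tree `T`. Applied to the weights this shows
  -- that the 2-tree is minimal, applied to `a` it gives `a s₀ = a j₀ + a j₁`.
  have hsum : ∀ b : E → ℝ, cosum b (insert j₁ (T \ {s₀})) + b j₁ + b j₀ =
      cosum b (T \ {j₀}) + b s₀ := by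
    intro b
    have h1 := cosum_diff b hj₀T
    have h2 := cosum_diff b hs₀T
    have h3 := cosum_insert b (T := T \ {s₀}) (e := j₁) fun h => hj₁T (mem_spn _ h)
    linarith
  have hmin : (T \ {j₀}, 0) ∈ minTerms G att P (fun e => (mode e).weight) := by
    refine S.mem_minTerms_iff.2 ⟨hterm, ?_⟩
    have h1 := hsum fun e => (mode e).weight
    have h2 : (mode j₀).weight = -1 := by
      rw [show mode j₀ = Mode.jet i from hj₀, Mode.weight]
    have h3 : (mode j₁).weight = -1 := by
      rw [show mode j₁ = Mode.jet j from hj₁, Mode.weight]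
    have h4 : (mode s₀).weight = -2 := by
      rw [show mode s₀ = Mode.soft from hs₀s, Mode.weight]
    rw [cosum_of_isOptimal hopt] at h1
    simp only [Nat.cast_zero, add_zero]
    linarith
  have h1 := ha _ (S.isOptimal_mem_minTerms hopt) _ hmin
  have h2 := hsum a
  have h3 := S.jet_eq_zero ha hJ hj₀
  have h4 := S.jet_eq_zero ha hJ hj₁
  rw [S.eq_of_soft_isOneVI ha (h1VI C hC) heC hs₀P.1]
  simp only at h1
  linarith

end Setup

end JetSufficiency

/-! ### Connected partitions of a 1VI graph -/

section Partitions

variable {α β : Type*} {Γ : Graph α β} {B : Set β}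

/-- The edges of `B` with all their ends in `W`. -/
def edgesWithin (Γ : Graph α β) (B : Set β) (W : Set α) : Set β :=
  {g | g ∈ B ∧ ∀ z, Γ.Inc g z → z ∈ W}

/-- The vertices of `W` are connected by edges of `B` within `W`. -/
def IsConnectedWithin (Γ : Graph α β) (B : Set β) (W : Set α) : Prop :=
  ∀ x ∈ W, ∀ y ∈ W, dl x y ∈ spn (bvec Γ) (edgesWithin Γ B W)

theorem edgesWithin_mono {W W' : Set α} (h : W ⊆ W') :
    edgesWithin Γ B W ⊆ edgesWithin Γ B W' := fun _ hg => ⟨hg.1, fun z hz => h (hg.2 z hz)⟩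

theorem mem_edgesWithin {W : Set α} {g : β} (hg : g ∈ B) {x y : α} (h : Γ.IsLink g x y)
    (hx : x ∈ W) (hy : y ∈ W) : g ∈ edgesWithin Γ B W := by
  refine ⟨hg, fun z hz => ?_⟩
  obtain rfl | rfl := hz.eq_or_eq_of_isLink h <;> assumption

theorem isConnectedWithin_singleton (v : α) : IsConnectedWithin Γ B {v} := by
  rintro x rfl y rfl
  exact dl_self_mem _ _

theorem IsConnectedWithin.union {W W' : Set α} (h : IsConnectedWithin Γ B W)
    (h' : IsConnectedWithin Γ B W') {g : β} (hg : g ∈ B) {x y : α} (hxy : Γ.IsLink g x y)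
    (hx : x ∈ W) (hy : y ∈ W') : IsConnectedWithin Γ B (W ∪ W') := by
  have key : ∀ z ∈ W ∪ W', dl x z ∈ spn (bvec Γ) (edgesWithin Γ B (W ∪ W')) := by
    rintro z (hz | hz)
    · exact spn_mono _ (edgesWithin_mono Set.subset_union_left) (h x hx z hz)
    · exact dl_mem_trans (dl_mem_of_isLink (mem_edgesWithin hg hxy (Or.inl hx) (Or.inr hy)) hxy)
        (spn_mono _ (edgesWithin_mono Set.subset_union_right) (h' y hy z hz))
  exact fun z hz w hw => dl_mem_trans (dl_mem_symm (key z hz)) (key w hw)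

theorem IsOneVI.isConnectedWithin_diff (hB : IsOneVI Γ B) (v : α) :
    IsConnectedWithin Γ B (endsOf Γ B \ {v}) := by
  intro x hx y hy
  refine spn_mono _ ?_ (hB.dl_mem_avoid hx.1 hy.1 hx.2 hy.2)
  exact fun g hg => ⟨hg.1, fun z hz => ⟨⟨g, hg.1, hz⟩, hg.2 z hz⟩⟩

theorem IsOneVI.exists_isLink_between (hB : IsOneVI Γ B) {W : Set α} (hW : W ⊆ endsOf Γ B)
    (hne : W.Nonempty) (hne' : (endsOf Γ B \ W).Nonempty) :
    ∃ g ∈ B, ∃ x ∈ W, ∃ y ∈ endsOf Γ B \ W, Γ.IsLink g x y := by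
  by_contra hcon
  push Not at hcon
  obtain ⟨x, hx⟩ := hne
  obtain ⟨y, hy, hyW⟩ := hne'
  have hc : IsClosedUnder Γ B W := fun g hg a b hab ha => by
    by_contra hb
    exact hcon g hg a ha b ⟨⟨g, hg, hab.inc_right⟩, hb⟩ hab
  exact hyW ((hc.mem_iff (hB.dl_mem (hW hx) hy)).1 hx)

/-- Either part of a connected partition can be enlarged by pieces of the other one. -/
theorem IsOneVI.exists_connected_piece (hB : IsOneVI Γ B) {W W' : Set α}
    (hU : endsOf Γ B = W ∪ W') (hd : Disjoint W W') (hW : W.Nonempty) (hW' : W'.Nonempty)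
    (hc : IsConnectedWithin Γ B W) (hc' : IsConnectedWithin Γ B W') :
    (∃ x, W' = {x}) ∨ ∃ D ⊆ W', D.Nonempty ∧ (W' \ D).Nonempty ∧ IsConnectedWithin Γ B D ∧
      IsConnectedWithin Γ B (W' \ D) ∧ IsConnectedWithin Γ B (W ∪ D) ∧
      IsConnectedWithin Γ B (W ∪ (W' \ D)) := by
  have hUW : endsOf Γ B \ W = W' := by
    rw [hU, Set.union_sdiff_left, hd.symm.sdiff_eq_left]
  obtain ⟨g, hg, y, hy, x, hx, hyx⟩ := hB.exists_isLink_between (hU ▸ Set.subset_union_left) hW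
    (hUW ▸ hW')
  rw [hUW] at hx
  by_cases hx' : ∃ d ∈ W', d ≠ x
  · right
    obtain ⟨d, hdW, hdx⟩ := hx'
    -- `x` is a vertex of `W'` adjacent to `W`, and `D` is one component of `W'` without `x`.
    set D : Set α := {z | dl d z ∈ spn (bvec Γ) (edgesWithin Γ B (W' \ {x}))}
    have hdD : d ∈ D := dl_self_mem (spn (bvec Γ) (edgesWithin Γ B (W' \ {x}))) d
    have hDW : D ⊆ W' \ {x} := by
      intro z hz
      refine (IsClosedUnder.mem_iff (Γ := Γ) ?_ hz).1 ⟨hdW, hdx⟩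
      exact fun e he a b hab _ => he.2 b hab.inc_right
    have hDc : ∀ e ∈ B, ∀ a b, Γ.IsLink e a b → a ∈ D → b ∈ W' → b ≠ x → b ∈ D := by
      intro e he a b hab ha hb hbx
      exact dl_mem_trans ha (dl_mem_of_isLink (mem_edgesWithin he hab (hDW ha) ⟨hb, hbx⟩) hab)
    have hxD : x ∈ W' \ D := ⟨hx, fun h => (hDW h).2 rfl⟩
    have hcD : IsConnectedWithin Γ B D := by
      have key : ∀ z ∈ D, dl d z ∈ spn (bvec Γ) (edgesWithin Γ B D) := by
        intro z hz
        refine (IsClosedUnder.mem_iff (Γ := Γ) (X := edgesWithin Γ B (W' \ {x}))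
          (Z := {z | z ∈ D ∧ dl d z ∈ spn (bvec Γ) (edgesWithin Γ B D)}) ?_ hz).1
          ⟨hdD, dl_self_mem _ _⟩ |>.2
        rintro e he a b hab ⟨ha, hda⟩
        have hb := he.2 b hab.inc_right
        have hbD := hDc e he.1 a b hab ha hb.1 hb.2
        exact ⟨hbD, dl_mem_trans hda (dl_mem_of_isLink (mem_edgesWithin he.1 hab ha hbD) hab)⟩
      exact fun z hz w hw => dl_mem_trans (dl_mem_symm (key z hz)) (key w hw)
    -- The other components of `W' \ {x}` are attached to `x`, since `W'` is connected, so they stay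
    -- connected through `x`.
    have hcD' : IsConnectedWithin Γ B (W' \ D) := by
      have key : ∀ z ∈ W' \ D, dl x z ∈ spn (bvec Γ) (edgesWithin Γ B (W' \ D)) := by
        intro z hz
        suffices hcl : IsClosedUnder Γ (edgesWithin Γ B W')
            {z | (z ∈ D ∨ dl x z ∈ spn (bvec Γ) (edgesWithin Γ B (W' \ D))) ∧ z ∈ W'} by
          exact (((hcl.mem_iff (hc' x hx z hz.1)).1
            (show _ ∧ _ from And.intro (Or.inr (dl_self_mem _ x)) hx)).1).resolve_left hz.2
        rintro e he a b hab ⟨ha, haW⟩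
        have hbW := he.2 b hab.inc_right
        refine ⟨?_, hbW⟩
        by_cases hbD : b ∈ D
        · exact Or.inl hbD
        right
        by_cases haD : a ∈ D
        · have hbx : b = x := by
            by_contra hbx
            exact hbD (hDc e he.1 a b hab haD hbW hbx)
          rw [hbx]
          exact dl_self_mem _ _
        · exact dl_mem_trans (ha.resolve_left haD)
            (dl_mem_of_isLink (mem_edgesWithin (W := W' \ D) he.1 hab ⟨haW, haD⟩ ⟨hbW, hbD⟩) hab)
      exact fun z hz w hw => dl_mem_trans (dl_mem_symm (key z hz)) (key w hw)
    refine ⟨D, fun z hz => (hDW hz).1, ⟨d, hdD⟩, ⟨x, hxD⟩, hcD, hcD', ?_, hc.union hcD' hg hyx hy hxD⟩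
    -- `D` must be adjacent to `W`: otherwise removing `x` would separate `D` from `W` within the
    -- 1VI subgraph.
    obtain ⟨e, he, b, hb, z, hz, hbz⟩ : ∃ e ∈ B, ∃ b ∈ W, ∃ z ∈ D, Γ.IsLink e b z := by
      by_contra hcon
      push Not at hcon
      have hyx' : y ≠ x := fun h => Set.disjoint_left.1 hd hy (h ▸ hx)
      have h1 := hB.dl_mem_avoid (v := x) (x := d) (y := y) (hU ▸ Or.inr hdW) (hU ▸ Or.inl hy) hdx
        hyx'
      have h2 : y ∈ D := (IsClosedUnder.mem_iff (Γ := Γ) (Z := D) (fun e he a b hab ha => by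
        have hb : b ∈ W ∪ W' := hU ▸ ⟨e, he.1, hab.inc_right⟩
        obtain hb | hb := hb
        · exact absurd hab.symm (hcon e he.1 b hb a ha)
        · exact hDc e he.1 a b hab ha hb (he.2 b hab.inc_right)) h1).1 hdD
      exact Set.disjoint_left.1 hd hy (hDW h2).1
    exact hc.union hcD he hbz hb hz
  · left
    push Not at hx'
    exact ⟨x, Set.Subset.antisymm (fun z hz => hx' z hz) (by simpa using hx)⟩

end Partitions

/-! ### Exceptional sets of external lines -/

section ExceptionalSets

variable {d K L : ℕ} {P : ℝ → Leg K L → Momentum d}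

theorem IsWideAngle.not_exceptional_compl_singleton (hP : IsWideAngle P) (l : Leg K L) :
    ¬ Exceptional ({l}ᶜ : Set (Leg K L)) := by
  rcases l with i | j
  · simpa using hP.not_exceptional_compl_pair i i
  · exact hP.not_exceptional_compl_inr j

/-- Two exceptional sets contain at most two on-shell lines, and what remains is not exceptional.
Without on-shell lines, exceptional sets are empty. -/
theorem IsWideAngle.not_exceptional_cover (hP : IsWideAngle P) {A B C : Set (Leg K L)}
    (h : ∀ l, l ∈ A ∨ l ∈ B ∨ l ∈ C) (hA : Exceptional A) (hB : Exceptional B) :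
    ¬ Exceptional C := by
  rcases Nat.eq_zero_or_pos K with rfl | hK
  · have hempty : ∀ X : Set (Leg 0 L), Exceptional X → X = ∅ := by
      rintro X (hX | ⟨i, -⟩)
      · exact hX
      · exact i.elim0
    have hL : 0 < L := by
      have := hP.legs
      omega
    refine not_exceptional_of_inr (j := ⟨0, hL⟩) ?_
    obtain h' | h' | h' := h (Sum.inr ⟨0, hL⟩)
    · exact absurd h' (by simp [hempty A hA])
    · exact absurd h' (by simp [hempty B hB])
    · exact h'
  · have hsub : ∀ X : Set (Leg K L), Exceptional X → ∃ i : Fin K, X ⊆ {Sum.inl i} := by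
      rintro X (hX | ⟨i, hX⟩)
      · exact ⟨⟨0, hK⟩, hX ▸ Set.empty_subset _⟩
      · exact ⟨i, hX.le⟩
    obtain ⟨i, hi⟩ := hsub A hA
    obtain ⟨j, hj⟩ := hsub B hB
    refine not_exceptional_mono (hP.not_exceptional_compl_pair i j) fun l hl => ?_
    obtain h' | h' | h' := h l
    · exact absurd (Or.inl (hi h')) hl
    · exact absurd (Or.inr (hj h')) hl
    · exact h'

end ExceptionalSets

/-! ### Off-shell propagators -/

section OffShell

variable {V E : Type} [Fintype V] [Fintype E] {d K L : ℕ}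

open Classical in
/-- The fraction of the momentum of an external line that enters `H` at the vertices satisfying
`R`. -/
def share (att : Leg K L → V) (ξ : Fin K → V → ℝ) (R : V → Prop) : Leg K L → ℝ
  | Sum.inl i => ∑ w, if R w then ξ i w else 0
  | Sum.inr j => if R (att (Sum.inr j)) then 1 else 0

omit [Fintype E] in
open Classical in
theorem sum_hardInflow (att : Leg K L → V) (p : Leg K L → Momentum d) (ξ : Fin K → V → ℝ)
    (R : V → Prop) :
    ∑ w, (if R w then hardInflow att p ξ w else 0) = ∑ l, share att ξ R l • p l := by
  have h1 : ∀ w, (if R w then hardInflow att p ξ w else 0) =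
      (∑ j : Fin L, if att (Sum.inr j) = w then (share att ξ R (Sum.inr j) • p (Sum.inr j)) else 0)
        + ∑ i : Fin K, (if R w then ξ i w else 0) • p (Sum.inl i) := by
    intro w
    by_cases h : R w
    · simp only [h, if_true, hardInflow]
      congr 1
      refine Finset.sum_congr rfl fun j _ => ?_
      by_cases hj : att (Sum.inr j) = w
      · simp [share, hj, h]
      · simp [hj]
    · simp only [h, if_false, zero_smul, Finset.sum_const_zero, add_zero]
      refine (Finset.sum_eq_zero fun j _ => ?_).symm
      by_cases hj : att (Sum.inr j) = w
      · simp [share, hj, h]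
      · simp [hj]
  simp only [h1]
  rw [Finset.sum_add_distrib, Fintype.sum_sum_type, add_comm]
  congr 1
  · rw [Finset.sum_comm]
    simp only [share, Finset.sum_smul]
  · rw [Finset.sum_comm]
    simp

namespace Setup

variable {G : Graph V E} {att : Leg K L → V} {P : ℝ → Leg K L → Momentum d} {mode : E → Mode K}
variable (S : Setup G att P mode)

theorem share_add_share_not {ξ : Fin K → V → ℝ} (hξ : IsSplitting G att mode ξ) (R : V → Prop)
    (l : Leg K L) : share att ξ R l + share att ξ (fun w => ¬ R w) l = 1 := by
  classical
  rcases l with i | j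
  · rw [share, share, ← Finset.sum_add_distrib, ← (hξ i).2.1]
    refine Finset.sum_congr rfl fun w _ => ?_
    by_cases h : R w <;> simp [h]
  · by_cases h : R (att (Sum.inr j)) <;> simp [share, h]

include S

theorem share_eq_zero {ξ : Fin K → V → ℝ} (hξ : IsSplitting G att mode ξ) {R : V → Prop}
    {l : Leg K L} (h : ∀ w, Enters G att mode l w → ¬ R w) : share att ξ R l = 0 := by
  classical
  rcases l with i | j
  · refine Finset.sum_eq_zero fun w _ => ?_
    by_cases hw : Enters G att mode (Sum.inl i) w
    · rw [if_neg (h w hw)]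
    · rw [(hξ i).2.2 w hw, ite_self]
  · rw [share, if_neg (h _ ⟨S.config.hard_external j, Or.inl rfl⟩)]

/-- If no line can enter on this side the momentum is zero; if only `p_i` can, it is a fixed
multiple of `p_i`, with square `O(t)`. -/
theorem not_exceptional_of_sq_isTheta {ξ : Fin K → V → ℝ} (hξ : IsSplitting G att mode ξ)
    {R : V → Prop}
    (h : (fun t => mdot (∑ l, share att ξ R l • P t l) (∑ l, share att ξ R l • P t l))
      =Θ[𝓝[>] (0 : ℝ)] (fun _ => (1 : ℝ))) :
    ¬ Exceptional {l | ∃ w, Enters G att mode l w ∧ R w} := by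
  have h0 : ∀ l, l ∉ {l | ∃ w, Enters G att mode l w ∧ R w} → share att ξ R l = 0 :=
    fun l hl => S.share_eq_zero hξ fun w hw hR => hl ⟨w, hw, hR⟩
  rintro (hA | ⟨i, hA⟩)
  · rw [hA] at h0
    refine not_zero_isTheta 0 ?_
    simpa [h0, mdot_zero_left] using h
  · rw [hA] at h0
    refine not_isBigO_id h ?_
    have h1 : ∀ t, ∑ l, share att ξ R l • P t l =
        share att ξ R (Sum.inl i) • P t (Sum.inl i) := fun t =>
      Finset.sum_eq_single_of_mem _ (Finset.mem_univ _) fun l _ hl => by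
        rw [h0 l hl, zero_smul]
    refine ((S.wide.on_shell i).1.const_mul_left (share att ξ R (Sum.inl i) ^ 2)).congr_left
      fun t => ?_
    rw [h1, mdot_smul_left, mdot_smul_right]
    ring

/-- The requirement of `H` in terms of the lines on the two sides of a propagator. -/
theorem not_exceptional_of_requirementH (hH : RequirementH G att mode P)
    {f : E ⊕ (Set E × V)} {B : Set E} {v : V}
    (hf : BelongsTo (hardGraph G att mode) (multiEntry G att mode) f B v) :
    ¬ Exceptional (nearLegs G att mode B v) ∧ ¬ Exceptional (farLegs G att mode B v) := by
  classical
  have hΓ := S.config.hard_connected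
  obtain ⟨x, y, hxy, hx, hy⟩ := hf.carried_cases hΓ (P := Momentum d)
  obtain ⟨ξ, hξ, z, hz, hΘ⟩ := hH f hxy.edge_mem
  set R : V → Prop := fun w => w ∈ V(hardGraph G att mode) ∧
    dl v w ∈ spn (bvec (hardGraph G att mode)) Bᶜ with hR
  have htot : ∀ t, ∑ w, (if w ∈ V(hardGraph G att mode) then hardInflow att (P t) ξ w else 0)
      = 0 := by
    intro t
    rw [sum_hardInflow, ← S.wide.conservation t]
    refine Finset.sum_congr rfl fun l _ => ?_
    have h1 := share_add_share_not hξ (fun w => w ∈ V(hardGraph G att mode)) l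
    rw [S.share_eq_zero hξ (R := fun w => ¬ w ∈ V(hardGraph G att mode))
      fun w hw h => h hw.1, add_zero] at h1
    rw [h1, one_smul]
  have hbr : ∀ t, BelongsTo.branchSum (hardGraph G att mode) B (hardInflow att (P t) ξ) v =
      ∑ l, share att ξ R l • P t l := by
    intro t
    rw [← sum_hardInflow, BelongsTo.branchSum]
    refine Finset.sum_congr rfl fun w _ => ?_
    by_cases h : R w
    · rw [if_pos h, if_pos h]
    · rw [if_neg h, if_neg h]
  have hsq : (fun t => mdot (∑ l, share att ξ R l • P t l) (∑ l, share att ξ R l • P t l))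
      =Θ[𝓝[>] (0 : ℝ)] (fun _ => (1 : ℝ)) := by
    obtain rfl | rfl := hz.eq_or_eq_of_isLink hxy
    · simpa only [hx, hbr] using hΘ
    · simpa only [hy _ (htot _), hbr, mdot_neg_neg] using hΘ
  -- The fractions on the far side complement those on the near side, so the opposite momentum flows
  -- there and the square is the same.
  have hneg : ∀ t, ∑ l, share att ξ (fun w => ¬ R w) l • P t l =
      - ∑ l, share att ξ R l • P t l := by
    intro t
    rw [eq_neg_iff_add_eq_zero, ← S.wide.conservation t, ← Finset.sum_add_distrib]
    refine Finset.sum_congr rfl fun l _ => ?_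
    have h1 := share_add_share_not hξ R l
    rw [add_comm] at h1
    rw [← add_smul, h1, one_smul]
  constructor
  · refine not_exceptional_mono (S.not_exceptional_of_sq_isTheta hξ hsq) ?_
    rintro l ⟨w, hw, -, h⟩
    exact ⟨w, hw, S.spn_hardGraph_compl B ▸ h⟩
  · have hsq' : (fun t => mdot (∑ l, share att ξ (fun w => ¬ R w) l • P t l)
        (∑ l, share att ξ (fun w => ¬ R w) l • P t l)) =Θ[𝓝[>] (0 : ℝ)] (fun _ => (1 : ℝ)) := by
      simpa only [hneg, mdot_neg_neg] using hsq
    refine not_exceptional_mono (S.not_exceptional_of_sq_isTheta hξ hsq') ?_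
    rintro l ⟨w, hw, h⟩
    exact ⟨w, hw, fun h' => h ⟨hw.1, (S.spn_hardGraph_compl B).symm ▸ h'⟩⟩

/-- The external momenta that enter `H` on the branches of the component `B` at the vertices
`W`. -/
def entering (G : Graph V E) (att : Leg K L → V) (mode : E → Mode K) (B : Set E) (W : Set V) :
    Set (Leg K L) :=
  {l | ∃ w, Enters G att mode l w ∧ ∃ u ∈ W, dl u w ∈ spn (bvec G) (hardE mode \ B)}

omit S in
theorem entering_empty (B : Set E) : entering G att mode B ∅ = ∅ := by
  ext l
  simp [entering]

omit S in
theorem entering_union (B : Set E) (W W' : Set V) :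
    entering G att mode B (W ∪ W') = entering G att mode B W ∪ entering G att mode B W' := by
  ext l
  constructor
  · rintro ⟨w, hw, u, hu | hu, h⟩
    · exact Or.inl ⟨w, hw, u, hu, h⟩
    · exact Or.inr ⟨w, hw, u, hu, h⟩
  · rintro (⟨w, hw, u, hu, h⟩ | ⟨w, hw, u, hu, h⟩)
    · exact ⟨w, hw, u, Or.inl hu, h⟩
    · exact ⟨w, hw, u, Or.inr hu, h⟩

theorem exists_end_connected_hard {B : Set E} (hB : IsOneVIComponent (hardGraph G att mode) B)
    {w : V} (hw : w ∈ hardVerts G att mode) :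
    ∃ u ∈ endsOf (hardGraph G att mode) B, dl u w ∈ spn (bvec G) (hardE mode \ B) := by
  obtain ⟨u, hu, h⟩ := exists_end_connected S.config.hard_connected hB.1 hw
  exact ⟨u, hu, S.spn_hardGraph_compl B ▸ h⟩

theorem mem_entering {B : Set E} (hB : IsOneVIComponent (hardGraph G att mode) B)
    (l : Leg K L) : l ∈ entering G att mode B (endsOf (hardGraph G att mode) B) := by
  obtain ⟨w, hw⟩ := S.exists_enters l
  exact ⟨w, hw, S.exists_end_connected_hard hB hw.1⟩

/-- A partition of a 1VI component of `H` such that the momentum flowing between the parts can be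
off-shell. -/
structure HardPartition (G : Graph V E) (att : Leg K L → V) (mode : E → Mode K) (B : Set E)
    (W W' : Set V) : Prop where
  union : endsOf (hardGraph G att mode) B = W ∪ W'
  disjoint : Disjoint W W'
  conn : IsConnectedWithin (hardGraph G att mode) B W
  conn' : IsConnectedWithin (hardGraph G att mode) B W'
  offShell : ¬ Exceptional (entering G att mode B W)
  offShell' : ¬ Exceptional (entering G att mode B W')

omit S in
theorem nonempty_of_entering {B : Set E} {W : Set V}
    (h : ¬ Exceptional (entering G att mode B W)) : W.Nonempty := by
  by_contra hW
  rw [Set.not_nonempty_iff_eq_empty] at hW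
  rw [hW, entering_empty] at h
  exact h (Or.inl rfl)

/-- If `B` has a propagator of the reduced form at `v`, cutting `{v}` from the rest of `B` works.
Otherwise `H` consists of `B` alone with at most one line entering at each vertex, and a suitable
cut is found by enlarging one part as far as possible. -/
theorem exists_hardPartition (hH : RequirementH G att mode P) {B : Set E}
    (hB : IsOneVIComponent (hardGraph G att mode) B) :
    ∃ W W', HardPartition G att mode B W W' := by
  obtain ⟨f, v, hf⟩ | ⟨hE, hV, hs⟩ :=
    hB.belongsTo_cases (M := multiEntry G att mode) S.config.hard_connected
  · obtain ⟨h1, h2⟩ := S.not_exceptional_of_requirementH hH hf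
    refine ⟨{v}, endsOf (hardGraph G att mode) B \ {v}, ?_, Set.disjoint_sdiff_right,
      isConnectedWithin_singleton v, hB.1.isConnectedWithin_diff v,
      not_exceptional_mono h1 ?_, not_exceptional_mono h2 ?_⟩
    · rw [Set.union_sdiff_self, Set.union_eq_self_of_subset_left (by simpa using hf.mem_ends)]
    · rintro l ⟨w, hw, h⟩
      exact ⟨w, hw, v, rfl, h⟩
    · rintro l ⟨w, hw, h⟩
      obtain ⟨u, hu, hu'⟩ := S.exists_end_connected_hard hB hw.1
      refine ⟨w, hw, u, ⟨hu, ?_⟩, hu'⟩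
      rintro rfl
      exact h hu'
  · have hnone : spn (bvec G) (hardE mode \ B) = ⊥ := by
      rw [← hE, S.edgeSet_hardGraph, Set.sdiff_self, spn, Set.image_empty, Submodule.span_empty]
    have heq : ∀ {u w : V}, dl u w ∈ spn (bvec G) (hardE mode \ B) → u = w := by
      intro u w h
      rw [hnone, Submodule.mem_bot] at h
      have := (sumOn_dl {u} u w).1 (by rw [h, map_zero])
      simpa [eq_comm] using this
    have hone : ∀ v ∈ endsOf (hardGraph G att mode) B, ∀ l ∈ entering G att mode B {v},
        ∀ l' ∈ entering G att mode B {v}, l = l' := by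
      rintro v hv l ⟨w, hw, u, rfl, h⟩ l' ⟨w', hw', u', rfl, h'⟩
      obtain rfl := heq h
      obtain rfl := heq h'
      by_contra hne
      exact hs _ hv (Or.inr ⟨l, l', hne, hw, hw'⟩)
    set U := endsOf (hardGraph G att mode) B with hU
    -- Giving up one vertex loses at most one external line.
    have hrest : ∀ v ∈ U, ∃ l, {l}ᶜ ⊆ entering G att mode B (U \ {v}) := by
      intro v hv
      have hcov : ∀ l, l ∈ entering G att mode B {v} ∨ l ∈ entering G att mode B (U \ {v}) := by
        intro l
        have := S.mem_entering hB l
        rwa [← hU, ← Set.union_sdiff_cancel (Set.singleton_subset_iff.2 hv), entering_union] at this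
      by_cases hne : (entering G att mode B {v}).Nonempty
      · obtain ⟨l, hl⟩ := hne
        refine ⟨l, fun l' hl' => (hcov l').resolve_left fun h => hl' (hone v hv l' h l hl)⟩
      · obtain ⟨l⟩ : Nonempty (Leg K L) := by
          have := S.wide.legs
          rcases Nat.eq_zero_or_pos K with h | h
          · exact ⟨Sum.inr ⟨0, by omega⟩⟩
          · exact ⟨Sum.inl ⟨0, h⟩⟩
        exact ⟨l, fun l' _ => (hcov l').resolve_left fun h => hne ⟨l', h⟩⟩
    -- Choose a largest connected part whose complement is connected and not exceptional. It remains
    -- to see that the part itself is not exceptional.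
    obtain ⟨W, hW⟩ := (Set.toFinite {W : Set V | W ⊆ U ∧ W.Nonempty ∧
      IsConnectedWithin (hardGraph G att mode) B W ∧
      IsConnectedWithin (hardGraph G att mode) B (U \ W) ∧
      ¬ Exceptional (entering G att mode B (U \ W))}).exists_maximal (by
        obtain ⟨v, hv⟩ := endsOf_nonempty hB.1
        obtain ⟨l, hl⟩ := hrest v hv
        exact ⟨{v}, Set.singleton_subset_iff.2 hv, ⟨v, rfl⟩, isConnectedWithin_singleton v,
          hB.1.isConnectedWithin_diff v,
          not_exceptional_mono (S.wide.not_exceptional_compl_singleton l) hl⟩)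
    obtain ⟨⟨hWU, hWne, hWc, hWc', hWx⟩, hmax⟩ := hW
    have hWW : W ∪ U \ W = U := Set.union_sdiff_cancel hWU
    refine ⟨W, U \ W, hWW.symm, Set.disjoint_sdiff_right, hWc, hWc', fun hx => ?_, hWx⟩
    obtain ⟨x, hxW⟩ | ⟨D, hD, hDne, hDne', hc1, hc2, hc3, hc4⟩ := hB.1.exists_connected_piece
      (W := W) (W' := U \ W) hWW.symm Set.disjoint_sdiff_right hWne (nonempty_of_entering hWx) hWc hWc'
    · have hxU : x ∈ U \ W := hxW ▸ rfl
      obtain ⟨l, hl⟩ := hrest x hxU.1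
      refine not_exceptional_mono (S.wide.not_exceptional_compl_singleton l) hl ?_
      rwa [← hxW, Set.sdiff_sdiff_cancel_left hWU]
    -- Either piece of the complement could be moved to `W`; by maximality what would then remain is
    -- exceptional. So `W`, `D` and the rest would be three exceptional sets covering all the lines.
    · have key : ∀ D ⊆ U \ W, D.Nonempty → IsConnectedWithin (hardGraph G att mode) B (W ∪ D) →
          IsConnectedWithin (hardGraph G att mode) B ((U \ W) \ D) →
          Exceptional (entering G att mode B ((U \ W) \ D)) := by
        intro D hD hDne h1 h2
        by_contra h3
        rw [Set.sdiff_sdiff] at h2 h3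
        have h4 := hmax (y := W ∪ D) ⟨Set.union_subset hWU fun z hz => (hD hz).1,
          hWne.mono Set.subset_union_left, h1, h2, h3⟩ Set.subset_union_left
        obtain ⟨z, hz⟩ := hDne
        exact (hD hz).2 (h4 (Or.inr hz))
      have h1 := key D hD hDne hc3 hc2
      have h2 := key ((U \ W) \ D) Set.sdiff_subset hDne' hc4
        (by rwa [Set.sdiff_sdiff_cancel_left hD])
      rw [Set.sdiff_sdiff_cancel_left hD] at h2
      refine S.wide.not_exceptional_cover (fun l => ?_) h1 h2 hx
      have := S.mem_entering hB l
      rw [← hU, ← hWW, ← Set.union_sdiff_cancel hD, entering_union, entering_union] at this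
      obtain h | h | h := this
      · exact Or.inr (Or.inr h)
      · exact Or.inr (Or.inl h)
      · exact Or.inl h

end Setup

end OffShell

/-! ### The requirements are sufficient: hard edges -/

section HardSufficiency

variable {V E : Type} [Fintype V] [Fintype E] [Nonempty V] {d K L : ℕ}

namespace Setup

variable {G : Graph V E} {att : Leg K L → V} {P : ℝ → Leg K L → Momentum d} {mode : E → Mode K}
variable (S : Setup G att P mode)

include S

omit [Nonempty V] in
/-- Each external line can be assigned to one part of the partition. -/
theorem HardPartition.exists_distribution {B : Set E} {W W' : Set V}
    (h : HardPartition G att mode B W W') (hB : IsOneVIComponent (hardGraph G att mode) B) :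
    ∃ C : Set (Leg K L), ¬ Exceptional C ∧ ¬ Exceptional Cᶜ ∧ ∀ l, ∃ w, Enters G att mode l w ∧
      ((l ∈ C ∧ ∃ u ∈ W, dl u w ∈ spn (bvec G) (hardE mode \ B)) ∨
        (l ∉ C ∧ ∃ u ∈ W', dl u w ∈ spn (bvec G) (hardE mode \ B))) := by
  obtain ⟨C, h1, h2, h3, h4⟩ := S.wide.exists_distribution h.offShell h.offShell' (fun l => by
      have := S.mem_entering hB l
      rwa [h.union, entering_union] at this) (by
    rintro j ⟨w, hw, u, hu, huw⟩ ⟨w', hw', u', hu', huw'⟩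
    obtain rfl : att (Sum.inr j) = w := by simpa using hw.2
    obtain rfl : att (Sum.inr j) = w' := by simpa using hw'.2
    have huu := dl_mem_trans huw (dl_mem_symm huw')
    rw [← S.spn_hardGraph_compl] at huu
    have := hB.eq_of_dl_mem (h.union ▸ Or.inl hu) (h.union ▸ Or.inr hu') huu
    exact Set.disjoint_left.1 h.disjoint hu (this ▸ hu'))
  refine ⟨C, h3, h4, fun l => ?_⟩
  by_cases hl : l ∈ C
  · obtain ⟨w, hw, hu⟩ := h1 hl
    exact ⟨w, hw, Or.inl ⟨hl, hu⟩⟩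
  · obtain ⟨w, hw, hu⟩ := h2 hl
    exact ⟨w, hw, Or.inr ⟨hl, hu⟩⟩

/-- The edges of the jets that connect their vertices to each other and to the given hard vertex
only. -/
def jetRoutes (G : Graph V E) (att : Leg K L → V) (mode : E → Mode K) (w : Leg K L → V) : Set E :=
  {e | ∃ i, e ∈ innerJetE G att mode i ∨ (e ∈ jetE mode i ∧ G.Inc e (w (Sum.inl i)))}

omit [Fintype V] [Nonempty V] [Fintype E] in
/-- The jets do not connect different parts of `H` if they are attached to one vertex only. -/
theorem dl_mem_of_dl_mem_jetRoutes {Q : Set E} (hQ : Q ⊆ hardE mode) {w : Leg K L → V}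
    (hw : ∀ l, w l ∈ hardVerts G att mode) {x y : V} (hx : x ∈ hardVerts G att mode)
    (hy : y ∈ hardVerts G att mode) (h : dl x y ∈ spn (bvec G) (Q ∪ jetRoutes G att mode w)) :
    dl x y ∈ spn (bvec G) Q := by
  have hc : IsClosedUnder G (Q ∪ jetRoutes G att mode w)
      {z | (z ∈ hardVerts G att mode ∧ dl x z ∈ spn (bvec G) Q) ∨
        ∃ i, z ∈ jetVerts G att mode i ∧ dl x (w (Sum.inl i)) ∈ spn (bvec G) Q} := by
    rintro e (he | ⟨i, he | ⟨he, hew⟩⟩) a b hab ha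
    · obtain ⟨-, ha⟩ | ⟨i, hi, -⟩ := ha
      · exact Or.inl ⟨S.mem_hard_of_inc (hQ he) hab.inc_right,
          dl_mem_trans ha (dl_mem_of_isLink he hab)⟩
      · exact absurd (S.mem_hard_of_inc (hQ he) hab.inc_left) (not_mem_hard_of_jet hi)
    · obtain ⟨h1, -⟩ | ⟨j, hj, ha⟩ := ha
      · exact absurd h1 (not_mem_hard_of_jet (he.2 a hab.inc_left))
      · obtain rfl := jetVerts_inj (he.2 a hab.inc_left) hj
        exact Or.inr ⟨i, he.2 b hab.inc_right, ha⟩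
    · obtain ⟨x', hx', hl⟩ := S.jet_isLink_of_inc_hard he (hw _) hew
      obtain ⟨rfl, rfl⟩ | ⟨rfl, rfl⟩ := hab.eq_and_eq_or_eq_and_eq hl
      · obtain ⟨h1, -⟩ | ⟨j, hj, ha⟩ := ha
        · exact absurd h1 (not_mem_hard_of_jet hx')
        · obtain rfl := jetVerts_inj hx' hj
          exact Or.inl ⟨hw _, ha⟩
      · obtain ⟨-, ha⟩ | ⟨j, hj, -⟩ := ha
        · exact Or.inr ⟨i, hx', ha⟩
        · exact absurd (hw _) (not_mem_hard_of_jet hj)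
  obtain ⟨-, h1⟩ | ⟨i, hi, -⟩ := (hc.mem_iff h).1 (Or.inl ⟨hx, dl_self_mem (spn (bvec G) Q) x⟩)
  · exact h1
  · exact absurd hy (not_mem_hard_of_jet hi)

omit [Fintype V] [Nonempty V] [Fintype E] in
theorem dl_att_mem_jetRoutes {w : Leg K L → V} (hw : ∀ l, Enters G att mode l (w l))
    (l : Leg K L) : dl (w l) (att l) ∈ spn (bvec G) (jetRoutes G att mode w) := by
  obtain ⟨h1, h2 | ⟨i, rfl, e, he, hew⟩⟩ := hw l
  · rw [h2]
    exact dl_self_mem _ _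
  · obtain ⟨x, hx, hl⟩ := S.jet_isLink_of_inc_hard he h1 hew
    have h3 : e ∈ jetRoutes G att mode w := ⟨i, Or.inr ⟨he, hew⟩⟩
    have h4 : innerJetE G att mode i ⊆ jetRoutes G att mode w := fun g hg => ⟨i, Or.inl hg⟩
    exact dl_mem_trans (dl_mem_of_isLink h3 hl.symm)
      (spn_mono _ h4 (S.dl_mem_innerJet hx (S.att_mem_jet ⟨e, he⟩)))

/-- Cut the component into two parts with off-shell momentum between them, and let an optimal tree
cross the cut by a single hard edge `h₀`, each jet being attached to `H` on the side chosen for its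
line. Removing `h₀`, of weight 0, leaves an invariant of order one. -/
theorem hard_eq_zero {a : E → ℝ} (ha : IsConstant G att P mode a) (hH : RequirementH G att mode P)
    {e : E} (he : e ∈ hardE mode) : a e = 0 := by
  obtain ⟨B, hB, heB, -⟩ := exists_isOneVIComponent (Γ := hardGraph G att mode) (e := e)
    (by rwa [S.edgeSet_hardGraph])
  have hBH := S.hard_component_subset hB
  obtain ⟨W, W', hW⟩ := S.exists_hardPartition hH hB
  obtain ⟨C, hC, hC', hw⟩ := HardPartition.exists_distribution S hW hB
  choose w hw hwu using hw
  have hWW : endsOf (hardGraph G att mode) B \ W = W' := by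
    rw [hW.union, Set.union_sdiff_left, hW.disjoint.symm.sdiff_eq_left]
  obtain ⟨h₀, hh₀, y₁, hy₁, y₂, hy₂, hl₀⟩ := hB.1.exists_isLink_between
    (hW.union ▸ Set.subset_union_left) (nonempty_of_entering hW.offShell)
    (hWW ▸ nonempty_of_entering hW.offShell')
  rw [hWW] at hy₂
  have hb₀ : bvec G h₀ = dl y₁ y₂ := by rw [← S.bvec_hardGraph (att := att) (hBH hh₀), bvec_eq hl₀]
  -- All of `H` except the edges of `B` that cross the cut.
  set Q : Set E := hardE mode \ B ∪ (edgesWithin (hardGraph G att mode) B W ∪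
    edgesWithin (hardGraph G att mode) B W') with hQ
  have hQH : Q ⊆ hardE mode := by
    rintro g (hg | hg | hg)
    · exact hg.1
    · exact hBH hg.1
    · exact hBH hg.1
  have hQspn : spn (bvec (hardGraph G att mode)) Q = spn (bvec G) Q := by
    rw [S.spn_hardGraph, Set.inter_eq_left.2 hQH]
  have hrest : spn (bvec G) (hardE mode \ B) ≤ spn (bvec G) Q :=
    spn_mono _ Set.subset_union_left
  have hconn : ∀ u ∈ W, dl y₁ u ∈ spn (bvec G) Q := fun u hu => hQspn ▸ spn_mono _
    (Set.subset_union_left.trans Set.subset_union_right) (hW.conn y₁ hy₁ u hu)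
  have hconn' : ∀ u ∈ W', dl y₂ u ∈ spn (bvec G) Q := fun u hu => hQspn ▸ spn_mono _
    (Set.subset_union_right.trans Set.subset_union_right) (hW.conn' y₂ hy₂ u hu)
  -- `Q` does not connect the two parts
  have hsep : ∀ u ∈ W, ∀ u' ∈ W', dl u u' ∉ spn (bvec (hardGraph G att mode)) Bᶜ := by
    intro u hu u' hu' h
    have := hB.eq_of_dl_mem (hW.union ▸ Or.inl hu) (hW.union ▸ Or.inr hu') h
    exact Set.disjoint_left.1 hW.disjoint hu (this ▸ hu')
  have hyQ : dl y₁ y₂ ∉ spn (bvec G) Q := by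
    rw [← hQspn]
    intro hcon
    have hc : IsClosedUnder (hardGraph G att mode) Q
        {z | ∃ u ∈ W, dl u z ∈ spn (bvec (hardGraph G att mode)) Bᶜ} := by
      rintro g (hg | hg | hg) x y hxy ⟨u, hu, hux⟩
      · exact ⟨u, hu, dl_mem_trans hux (dl_mem_of_isLink hg.2 hxy)⟩
      · exact ⟨y, hg.2 y hxy.inc_right, dl_self_mem _ _⟩
      · exact absurd hux (hsep u hu x (hg.2 x hxy.inc_left))
    obtain ⟨u, hu, h⟩ := (hc.mem_iff hcon).1 ⟨y₁, hy₁, dl_self_mem _ _⟩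
    exact hsep u hu y₂ hy₂ h
  have hHQ : spn (bvec G) (hardE mode) ≤ spn (bvec G) (insert h₀ Q) := by
    have key : ∀ x ∈ hardVerts G att mode, dl y₁ x ∈ spn (bvec G) (insert h₀ Q) := by
      intro x hx
      have hQi : spn (bvec G) Q ≤ spn (bvec G) (insert h₀ Q) := spn_mono _ (Set.subset_insert _ _)
      obtain ⟨u, hu, hux⟩ := S.exists_end_connected_hard hB hx
      rw [hW.union] at hu
      obtain hu | hu := hu
      · exact dl_mem_trans (hQi (hconn u hu)) (hQi (hrest hux))
      · exact dl_mem_trans (hb₀ ▸ mem_spn _ (Set.mem_insert _ _))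
          (dl_mem_trans (hQi (hconn' u hu)) (hQi (hrest hux)))
    refine spn_le _ fun g hg => ?_
    obtain ⟨x, y, hxy⟩ := S.exists_isLink g
    rw [bvec_eq hxy]
    exact dl_mem_trans (dl_mem_symm (key x (S.mem_hard_of_inc hg hxy.inc_left)))
      (key y (S.mem_hard_of_inc hg hxy.inc_right))
  have hyH : y₁ ∈ hardVerts G att mode ∧ y₂ ∈ hardVerts G att mode :=
    ⟨hl₀.left_mem, hl₀.right_mem⟩
  -- an optimal tree containing `h₀` and spanning `Q` and the jets
  obtain ⟨T₁, h11, -, h12, h13⟩ := exists_indep_extension (bvec G) (S := ∅) (X := Q)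
    (linearIndepOn_empty (ZMod 2) _) (Set.empty_subset _)
  obtain ⟨T₂, h21, h22, h23, h24⟩ := exists_indep_extension (bvec G) (S := T₁)
    (X := Q ∪ jetRoutes G att mode w) h13 (h11.trans Set.subset_union_left)
  have hh₀T₂ : bvec G h₀ ∉ spn (bvec G) T₂ := fun h => hyQ (S.dl_mem_of_dl_mem_jetRoutes hQH
    (fun l => (hw l).1) hyH.1 hyH.2 (hb₀ ▸ spn_mono _ h21 h))
  have hns : insert h₀ T₂ ⊆ nonsoftE mode := by
    refine Set.insert_subset (hardE_subset mode (hBH hh₀)) (h21.trans ?_)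
    rintro g (hg | ⟨i, hg | hg⟩)
    · exact hardE_subset mode (hQH hg)
    · exact jetE_subset mode i hg.1
    · exact jetE_subset mode i hg.1
  obtain ⟨T₃, h31, h32, h33, h34⟩ := exists_indep_extension (bvec G) (indep_insert h24 hh₀T₂) hns
  obtain ⟨T, hT₃, hT⟩ := exists_isOptimal_of_subset (G := G) (mode := mode) h34 (by
      refine hHQ.trans ((spn_le _ ?_ : spn (bvec G) (insert h₀ Q) ≤
        spn (bvec G) (insert h₀ T₁)).trans (spn_mono _ ?_))
      · rintro g (rfl | hg)
        · exact mem_spn _ (Set.mem_insert _ _)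
        · exact spn_mono _ (Set.subset_insert _ _) (h12 (mem_spn _ hg))
      · rintro g (rfl | hg)
        · exact ⟨h32 (Set.mem_insert _ _), hBH hh₀⟩
        · exact ⟨h32 (Set.mem_insert_of_mem _ (h22 hg)), hQH (h11 hg)⟩)
    (h33.trans (spn_mono _ (Set.subset_inter subset_rfl h31)))
  have hh₀T : h₀ ∈ T := hT₃ (h32 (Set.mem_insert _ _))
  have hTQ : spn (bvec G) (Q ∪ jetRoutes G att mode w) ≤ spn (bvec G) (T \ {h₀}) := by
    refine h23.trans (spn_mono _ fun g hg => ⟨hT₃ (h32 (Set.mem_insert_of_mem _ hg)), ?_⟩)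
    rintro rfl
    exact hh₀T₂ (mem_spn _ hg)
  have hTQ' : spn (bvec G) Q ≤ spn (bvec G) (T \ {h₀}) :=
    (spn_mono _ Set.subset_union_left).trans hTQ
  have hTJ : ∀ l, dl (w l) (att l) ∈ spn (bvec G) (T \ {h₀}) := fun l =>
    hTQ (spn_mono _ Set.subset_union_right (S.dl_att_mem_jetRoutes hw l))
  have hyT : dl y₁ y₂ ∉ spn (bvec G) (T \ {h₀}) := hb₀ ▸ hT.indep.notMem_span hh₀T
  have hlegs : conLegs G att (T \ {h₀}) y₁ = C := by
    ext l
    obtain ⟨hl, u, hu, huw⟩ | ⟨hl, u, hu, huw⟩ := hwu l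
    · refine iff_of_true ?_ hl
      exact dl_mem_trans (dl_mem_trans (hTQ' (hconn u hu)) (hTQ' (hrest huw))) (hTJ l)
    · refine iff_of_false (fun h => hyT (dl_mem_trans h (dl_mem_symm ?_))) hl
      exact dl_mem_trans (dl_mem_trans (hTQ' (hconn' u hu)) (hTQ' (hrest huw))) (hTJ l)
  rw [S.eq_of_hard_isOneVI ha hB.1 heB hh₀]
  refine S.eq_zero_of_diff ha hT hh₀T (n := 0) ?_ ?_
  · simp only [S.invariant_eq (S.diff_isSpanningTwoTree hT.indep hT.span hh₀T) y₁, pow_zero, hlegs]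
    exact S.wide.sq_isTheta_one hC hC'
  · rw [show mode h₀ = Mode.hard from hBH hh₀]
    simp [Mode.weight]

theorem facetCondition (hH : RequirementH G att mode P) (hJ : RequirementJ G att mode P)
    (hS : RequirementS G att mode) (h1VI : SoftComponentsOneVI G att mode) :
    FacetCondition G att P mode := by
  intro a ha
  funext e
  rcases hm : mode e with _ | i | _
  · exact S.hard_eq_zero ha hH hm
  · exact S.jet_eq_zero ha hJ hm
  · exact S.soft_eq_zero ha hJ hS h1VI hm

end Setup

end HardSufficiency

end OnShell

end

theorem mainTheorem2 {V E : Type} [Fintype V] [Fintype E] [Nonempty V] {d K L : ℕ}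
    (G : Graph V E) (hV : V(G) = Set.univ) (hE : E(G) = Set.univ) (hG : OnShell.IsConn G)
    (att : OnShell.Leg K L → V)
    (P : ℝ → OnShell.Leg K L → OnShell.Momentum d) (hP : OnShell.IsWideAngle P)
    (mode : E → OnShell.Mode K) (hR : OnShell.IsConfiguration G att mode) :
    (OnShell.IsNormalToLowerFacet
        (OnShell.newtonPolytope fun t => OnShell.leePomeransky G att (P t))
        (OnShell.regionVector mode) →
      OnShell.RequirementH G att mode P ∧ OnShell.RequirementJ G att mode P ∧
        OnShell.RequirementS G att mode) ∧
    (OnShell.SoftComponentsOneVI G att mode →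
      OnShell.RequirementH G att mode P ∧ OnShell.RequirementJ G att mode P ∧
        OnShell.RequirementS G att mode →
      OnShell.IsNormalToLowerFacet
        (OnShell.newtonPolytope fun t => OnShell.leePomeransky G att (P t))
        (OnShell.regionVector mode)) := by
  have S : OnShell.Setup G att P mode := ⟨hV, hE, hG, hP, hR⟩
  have hiff := OnShell.isNormalToLowerFacet_newtonPolytope_iff G att P fun e => (mode e).weight
  refine ⟨fun h => ?_, fun h1 h2 => ?_⟩
  · have hF := (hiff.1 h).2
    exact ⟨S.requirementH hF, S.requirementJ hF, S.requirementS hF⟩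
  -- An optimal tree always exists, so the set of minimal terms is non-empty.
  · obtain ⟨T, hT⟩ := OnShell.exists_isOptimal G mode
    exact hiff.2 ⟨⟨_, S.isOptimal_mem_minTerms hT⟩, S.facetCondition h2.1 h2.2.1 h2.2.2 h1⟩
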